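/- Let $0<\alpha<1$, $q>1$ and $f(v)=|v|^{q-1}v/q$. Consider the Cauchy problem $$\partial_t u+|u|^{q-1}\partial_x u=\partial_x\mathcal D^\alpha[u(t,\cdot)],\quad t>0,\ x\in\mathbb R,\qquad u(0,\cdot)=u_0,\qquad(\ast)$$ where $\mathcal D^\alpha[g](x)=\frac1{\Gamma(-\alpha)}\int_{-\infty}^0\frac{g(x+z)-g(x)}{|z|^{\alpha+1}}\,dz$. Let $$K(t,x)=\frac1{2\pi}\int_{\mathbb R}e^{t(i\xi)^{1+\alpha}}e^{ix\xi}\,d\xi,\qquad t>0,\ x\in\mathbb R$$ (principal branch of the power), the fundamental solution of the linear equation $\partial_tU=\partial_x\mathcal D^\alpha[U]$. For $u_0\in L^\infty(\mathbb R)$, a global mild solution of $(\ast)$ is a bounded continuous function $u$ on $(0,\infty)\times\mathbb R$ such that, for a.e. $(t,x)\in(0,\infty)\times\mathbb R$, $$u(t,x)=\int_{\mathbb R}K(t,x-y)u_0(y)\,dy-\int_0^t\int_{\mathbb R}\partial_xK(t-s,x-y)f(u(s,y))\,dy\,ds.$$ Theorem. For every $u_0\in L^\infty(\mathbb R)$ there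 is a unique global mild solution $u$ of $(\ast)$. It satisfies $u\in C((0,\infty),C^1(\mathbb R))\cap C_b((0,\infty)\times\mathbb R)$, where $C^1(\mathbb R)$ denotes the space of bounded $C^1$ functions with bounded derivative and norm $\sup|g|+\sup|g'|$, and $$\operatorname{ess\,inf}u_0\le u(t,x)\le\operatorname{ess\,sup}u_0\qquad\text{for all }t>0,\ x\in\mathbb R.$$ If in addition $u_0\in L^1(\mathbb R)$, then $u\in C([0,\infty),L^1(\mathbb R))$ with $u(0,\cdot)=u_0$, one has $\|u(t,\cdot)\|_{L^1(\mathbb R)}\le\|u_0\|_{L^1(\mathbb R)}$ for all $t>0$, and $\|u(t,\cdot)\|_{L^1(\mathbb R)}\le\|u(s,\cdot)\|_{L^1(\mathbb R)}$ for all $0<s\le t$. -/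

import Mathlib

open MeasureTheory Filter Topology

noncomputable section

namespace RieszFeller

/-- The kernel `K(t, x)` of the linear equation `∂ₜU = ∂ₓ D^α U`, whose Fourier symbol is
`(iξ)^(α+1)`:
`K(t, x) = (1 / 2π) ∫ exp(t (iξ)^(α+1)) exp(i x ξ) dξ`, with the principal branch of the power.
The normalization is the one for which `K(t, ·)` has mass one. The integrand at `-ξ` is the complex
conjugate of the integrand at `ξ`, so that the integral is real and `re` loses nothing. -/
def kernel (α t x : ℝ) : ℝ :=
  (1 / (2 * Real.pi)) *
    (∫ ξ : ℝ, Complex.exp ((t : ℂ) * (Complex.I * (ξ : ℂ)) ^ ((α : ℂ) + 1)) *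
      Complex.exp (Complex.I * (x : ℂ) * (ξ : ℂ))).re

/-- The spatial derivative `∂ₓ K(t, x)`. -/
def kernelDx (α t x : ℝ) : ℝ :=
  deriv (fun y : ℝ => kernel α t y) x

/-- The flux `f(v) = |v|^(q-1) v / q`. -/
def flux (q v : ℝ) : ℝ :=
  |v| ^ (q - 1) * v / q

/-- The strip `(0, T) × ℝ`, where `T = ∞` is allowed. -/
def strip (T : EReal) : Set (ℝ × ℝ) :=
  {p | 0 < p.1 ∧ (p.1 : EReal) < T}

/-- `u ∈ C_b((0, T) × ℝ)`. -/
def IsContBdd (T : EReal) (u : ℝ → ℝ → ℝ) : Prop :=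
  ContinuousOn (fun p : ℝ × ℝ => u p.1 p.2) (strip T) ∧
    ∃ C : ℝ, ∀ p ∈ strip T, |u p.1 p.2| ≤ C

/-- `u` is a mild solution on `(0, T) × ℝ` of
`∂ₜu + |u|^(q-1) ∂ₓu = ∂ₓ D^α u`, `u(0, ·) = u₀`:
it lies in `C_b((0, T) × ℝ)` and satisfies Duhamel's formula almost everywhere. -/
def IsMildSolution (α q : ℝ) (T : EReal) (u₀ : ℝ → ℝ) (u : ℝ → ℝ → ℝ) : Prop :=
  IsContBdd T u ∧
    ∀ᵐ p : ℝ × ℝ ∂(volume.restrict (strip T)),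
      u p.1 p.2 = (∫ y : ℝ, kernel α p.1 (p.2 - y) * u₀ y) -
        ∫ s in (0 : ℝ)..p.1, ∫ y : ℝ, kernelDx α (p.1 - s) (p.2 - y) * flux q (u s y)

/-- `u ∈ C((0, ∞), C¹(ℝ))`, where `C¹(ℝ)` carries the norm `sup |g| + sup |g'|`: every `u(t, ·)` is
`C¹` and bounded with its derivative, and `u(t, ·)`, `∂ₓu(t, ·)` depend continuously on `t` in
the supremum norm. -/
def IsContIntoC1 (u : ℝ → ℝ → ℝ) : Prop :=
  ∀ t : ℝ, 0 < t →
    ContDiff ℝ 1 (u t) ∧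
    (∃ C : ℝ, ∀ x : ℝ, |u t x| ≤ C ∧ |deriv (u t) x| ≤ C) ∧
    TendstoUniformly u (u t) (𝓝 t) ∧
    TendstoUniformly (fun s : ℝ => deriv (u s)) (deriv (u t)) (𝓝 t)

/-- `u ∈ C([0, ∞), L¹(ℝ))` with value `u₀` at time `0`. -/
def IsContIntoL1 (u₀ : ℝ → ℝ) (u : ℝ → ℝ → ℝ) : Prop :=
  ∃ U : ℝ → Lp ℝ 1 (volume : Measure ℝ),
    ContinuousOn U (Set.Ici 0) ∧
    (U 0 : ℝ → ℝ) =ᵐ[volume] u₀ ∧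
    ∀ t : ℝ, 0 < t → (U t : ℝ → ℝ) =ᵐ[volume] u t

end RieszFeller

end

open MeasureTheory Filter Topology

noncomputable section

namespace RieszFeller

/-! ### The symbol -/

/-! Everything rests on three facts about the kernel: `K(t, ·)` is a probability density, the `K(t,
·)` form a convolution semigroup, and `‖∂ₓK(t, ·)‖₁ ≤ C t^(-b)` with `b = 1/(α+1) < 1`. The last
follows from scaling and decay at time one, the semigroup law from Fourier inversion. Nonnegativity
comes from approximating `(iξ)^(α+1)` by shifted fractional differences: for `1 < a < 2` the power
series of `(1 - z)^a` has only one negative coefficient, the linear one, and the shift turns its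
term into a constant. These facts are collected in `IsSmoothingKernel`; the rest uses only them and
a flux that is monotone, zero at zero and Lipschitz on `[-R, R]`.

Since `t^(-b)` is integrable at `0`, `∂ₓK` has small `L¹` norm for the weight `exp(-l t)` with `l`
large. The Duhamel term is then a contraction in the corresponding weighted sup norm, globally in
time, among functions bounded by a fixed `R`. This gives uniqueness (`duhamel_unique`). Iterating
the Duhamel map itself need not preserve the bound `R`, so existence goes through a monotone scheme:
`∂ₓ f(u)` is replaced by the backward difference of step `h`, the upwind choice for increasing `f`.
Adding and subtracting `μ w` with `μ = L/h` makes the source monotone in `w`; it maps `[m, M]` into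
`[μ m, μ M]` and multiplies the `L¹` bound by at most `μ`. The fixed point of the damped equation
(`exists_upwindMap_fixedPoint`) therefore keeps the bounds and the `L¹` norm of the datum. A
resolvent identity removes the damping (`eq_of_upwindMap_eq`): the fixed point solves Duhamel's
formula with a difference quotient of `K` in place of `∂ₓK`. These quotients converge to `∂ₓK` in
weighted `L¹`, so the approximations are Cauchy as `h → 0` and the limit solves Duhamel's formula
with all bounds (`exists_duhamel`).

For regularity, finite differences of `u` in `x` are estimated by `t^(-b)` on a short time interval
whose length depends only on the bound `R` of the solution. Restarting (`IsDuhamel.restart`) gives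
Lipschitz bounds on every half line `t ≥ t₀ > 0`, and Duhamel's formula restarted from a Lipschitz
datum can be differentiated under the integral (`IsDuhamel.contDiff`). Continuity in `L¹` comes from
continuity of translations in `L¹`. Restarting together with uniqueness makes the `L¹` norm
nonincreasing. -/

/-- The Fourier symbol `(iξ)^(α+1)` of the operator `∂ₓ D^α`. -/
def symbol (α ξ : ℝ) : ℂ := (Complex.I * (ξ : ℂ)) ^ ((α : ℂ) + 1)

lemma symbol_eq (α ξ : ℝ) : symbol α ξ = (Complex.I * (ξ : ℂ)) ^ ((α + 1 : ℝ) : ℂ) := by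
  simp [symbol]

lemma norm_I_mul_cpow (a ξ : ℝ) : ‖(Complex.I * (ξ : ℂ)) ^ (a : ℂ)‖ = |ξ| ^ a := by
  rw [Complex.norm_cpow_real]; simp

lemma arg_I_mul_of_pos {ξ : ℝ} (h : 0 < ξ) : (Complex.I * (ξ : ℂ)).arg = Real.pi / 2 := by
  rw [mul_comm, Complex.arg_real_mul _ h, Complex.arg_I]

lemma arg_I_mul_of_neg {ξ : ℝ} (h : ξ < 0) : (Complex.I * (ξ : ℂ)).arg = -(Real.pi / 2) := by
  have : Complex.I * (ξ : ℂ) = ((-ξ : ℝ) : ℂ) * (-Complex.I) := by push_cast; ring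
  rw [this, Complex.arg_real_mul _ (by linarith), Complex.arg_neg_I]

lemma I_mul_mem_slitPlane {ξ : ℝ} (h : ξ ≠ 0) : Complex.I * (ξ : ℂ) ∈ Complex.slitPlane := by
  simp [Complex.mem_slitPlane_iff, h]

/-- The argument of `iξ` is `±π/2`, so the real part involves `cos(π(α+1)/2) = -sin(πα/2)`, negative
for `0 < α < 1`. This is the source of all decay of the multiplier. -/
lemma symbol_re {α : ℝ} (hα : 0 < α) (ξ : ℝ) :
    (symbol α ξ).re = -Real.sin (Real.pi * α / 2) * |ξ| ^ (α + 1) := by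
  have hcos : Real.cos (Real.pi / 2 * (α + 1)) = -Real.sin (Real.pi * α / 2) := by
    rw [← Real.cos_add_pi_div_two]; congr 1; ring
  rw [symbol_eq, Complex.cpow_ofReal_re]
  rcases lt_trichotomy ξ 0 with h | h | h
  · rw [arg_I_mul_of_neg h, neg_mul, Real.cos_neg, hcos]; simp; ring
  · subst h
    simp [Real.zero_rpow (by linarith : α + 1 ≠ 0)]
  · rw [arg_I_mul_of_pos h, hcos]; simp; ring

lemma symbol_neg (α ξ : ℝ) : symbol α (-ξ) = (starRingEnd ℂ) (symbol α ξ) := by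
  by_cases h : ξ = 0
  · subst h
    simp only [neg_zero]
    by_cases h1 : α + 1 = 0
    · simp [symbol_eq, h1]
    · rw [symbol_eq]
      rw [Complex.ofReal_zero, mul_zero, Complex.zero_cpow (by exact_mod_cast h1), map_zero]
  · rw [symbol_eq, symbol_eq]
    have := Complex.conj_cpow (Complex.I * (ξ : ℂ)) ((α + 1 : ℝ) : ℂ)
      (Complex.slitPlane_arg_ne_pi (I_mul_mem_slitPlane h))
    rw [Complex.conj_ofReal] at this
    rw [← this]
    simp

lemma continuous_I_mul_cpow {a : ℝ} (ha : 0 < a) :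
    Continuous fun ξ : ℝ => (Complex.I * (ξ : ℂ)) ^ (a : ℂ) := by
  rw [continuous_iff_continuousAt]
  intro ξ
  by_cases h : ξ = 0
  · subst h
    have h1 : Tendsto (fun ξ : ℝ => |ξ| ^ a) (𝓝 0) (𝓝 0) := by
      have : Continuous fun ξ : ℝ => |ξ| ^ a := continuous_abs.rpow_const fun _ => Or.inr ha.le
      simpa [Real.zero_rpow ha.ne'] using this.tendsto 0
    have h0 : (Complex.I * ((0 : ℝ) : ℂ)) ^ (a : ℂ) = 0 := by
      rw [Complex.ofReal_zero, mul_zero, Complex.zero_cpow (by exact_mod_cast ha.ne')]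
    rw [ContinuousAt, h0, tendsto_zero_iff_norm_tendsto_zero]
    simpa only [norm_I_mul_cpow] using h1
  · exact ContinuousAt.cpow (by fun_prop) continuousAt_const (I_mul_mem_slitPlane h)

lemma measurable_I_mul_cpow (a : ℝ) :
    Measurable fun ξ : ℝ => (Complex.I * (ξ : ℂ)) ^ (a : ℂ) := by
  fun_prop

lemma hasDerivAt_I_mul_cpow (a : ℝ) {ξ : ℝ} (h : ξ ≠ 0) :
    HasDerivAt (fun ξ : ℝ => (Complex.I * (ξ : ℂ)) ^ (a : ℂ))
      ((a : ℂ) * Complex.I * (Complex.I * (ξ : ℂ)) ^ ((a - 1 : ℝ) : ℂ)) ξ := by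
  have h1 : HasDerivAt (fun ξ : ℝ => Complex.I * (ξ : ℂ)) Complex.I ξ := by
    simpa using (Complex.ofRealCLM.hasDerivAt (x := ξ)).const_mul Complex.I
  have h2 := (Complex.hasStrictDerivAt_cpow_const (c := (a : ℂ))
    (I_mul_mem_slitPlane h)).hasDerivAt.comp ξ h1
  refine h2.congr_deriv ?_
  rw [Complex.ofReal_sub, Complex.ofReal_one]; ring

lemma continuous_symbol {α : ℝ} (hα : 0 < α) : Continuous (symbol α) := by
  have h := continuous_I_mul_cpow (a := α + 1) (by linarith)
  simpa only [← symbol_eq] using h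

/-- The Fourier multiplier `exp (t (iξ)^(α+1))`. -/
def multiplier (α t ξ : ℝ) : ℂ := Complex.exp ((t : ℂ) * symbol α ξ)

lemma continuous_multiplier {α : ℝ} (hα : 0 < α) (t : ℝ) : Continuous (multiplier α t) := by
  have := continuous_symbol hα
  unfold multiplier; fun_prop

lemma norm_multiplier {α : ℝ} (hα : 0 < α) (t ξ : ℝ) :
    ‖multiplier α t ξ‖ = Real.exp (-(t * Real.sin (Real.pi * α / 2)) * |ξ| ^ (α + 1)) := by
  rw [multiplier, Complex.norm_exp]
  congr 1
  rw [Complex.re_ofReal_mul, symbol_re hα]; ring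

lemma sin_pos_of_exponent {α : ℝ} (hα : 0 < α) (hα' : α < 1) : 0 < Real.sin (Real.pi * α / 2) := by
  apply Real.sin_pos_of_pos_of_lt_pi
  · positivity
  · nlinarith [Real.pi_pos]

lemma integrable_abs_rpow_mul_exp {a p c : ℝ} (ha : -1 < a) (hp : 0 < p) (hc : 0 < c) :
    Integrable fun ξ : ℝ => |ξ| ^ a * Real.exp (-c * |ξ| ^ p) := by
  have h := integrableOn_rpow_mul_exp_neg_mul_rpow ha hp hc
  have h1 : IntegrableOn (fun ξ : ℝ => |ξ| ^ a * Real.exp (-c * |ξ| ^ p)) (Set.Ioi 0) := by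
    refine h.congr_fun (fun x hx => ?_) measurableSet_Ioi
    simp only [abs_of_pos (Set.mem_Ioi.mp hx)]
  have h2 := h1.integrable_indicator measurableSet_Ioi
  refine (h2.add h2.comp_neg).congr ?_
  filter_upwards [compl_mem_ae_iff.mpr (measure_singleton (0 : ℝ))] with x hx
  rcases lt_or_gt_of_ne hx with h' | h'
  · simp [Set.indicator, h', not_lt.mpr h'.le]
  · simp [Set.indicator, h', not_lt.mpr h'.le]

/-- The multiplier decays like `exp(-c|ξ|^(α+1))`, which absorbs polynomial growth; exponents down
to `-1` are admitted because second derivatives of the multiplier behave like `|ξ|^(α-1)` at the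
origin. -/
lemma integrable_mul_multiplier {α : ℝ} (hα : 0 < α) (hα' : α < 1) {t : ℝ} (ht : 0 < t)
    {g : ℝ → ℂ} (hg : AEStronglyMeasurable g volume) {a C : ℝ} (ha : -1 < a)
    (hb : ∀ ξ, ‖g ξ‖ ≤ C * |ξ| ^ a) :
    Integrable fun ξ => g ξ * multiplier α t ξ := by
  have h := (integrable_abs_rpow_mul_exp ha (by linarith : 0 < α + 1)
    (mul_pos ht (sin_pos_of_exponent hα hα'))).const_mul C
  refine h.mono' (hg.mul (continuous_multiplier hα t).aestronglyMeasurable) (ae_of_all _ fun ξ => ?_)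
  rw [norm_mul, norm_multiplier hα, ← mul_assoc]
  exact mul_le_mul_of_nonneg_right (hb ξ) (Real.exp_pos _).le

lemma integrable_multiplier {α : ℝ} (hα : 0 < α) (hα' : α < 1) {t : ℝ} (ht : 0 < t) :
    Integrable (multiplier α t) := by
  simpa using integrable_mul_multiplier hα hα' ht (g := fun _ => 1) (a := 0) (C := 1)
    aestronglyMeasurable_const (by norm_num) (by simp)

/-! ### Integration by parts for Fourier integrals -/

/-- The line is cut at `0`, where the symbol is not smooth. Continuity makes the two boundary values
at `0` cancel, and integrability of `f` and `f'` makes the limits at infinity vanish. -/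
lemma integral_eq_zero_of_hasDerivAt_off_zero {f f' : ℝ → ℂ} (hc : Continuous f)
    (hd : ∀ x, x ≠ 0 → HasDerivAt f (f' x) x) (hf : Integrable f) (hf' : Integrable f') :
    ∫ x, f' x = 0 := by
  have htop := tendsto_zero_of_hasDerivAt_of_integrableOn_Ioi (a := 0)
    (fun x hx => hd x (ne_of_gt hx)) hf'.integrableOn hf.integrableOn
  -- Only the limit at `-∞` matters here; the endpoint `-1` keeps the closed half line away from
  -- `0`.
  have hbot := tendsto_zero_of_hasDerivAt_of_integrableOn_Iic (a := -1)
    (fun x hx => hd x (ne_of_lt (lt_of_le_of_lt hx (by norm_num)))) hf'.integrableOn hf.integrableOn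
  have h1 := integral_Ioi_of_hasDerivAt_of_tendsto (a := 0) hc.continuousWithinAt
    (fun x hx => hd x (ne_of_gt hx)) hf'.integrableOn htop
  have h2 := integral_Iic_of_hasDerivAt_of_tendsto (a := 0) hc.continuousWithinAt
    (fun x hx => hd x (ne_of_lt hx)) hf'.integrableOn hbot
  rw [← intervalIntegral.integral_Iic_add_Ioi (b := 0) hf'.integrableOn hf'.integrableOn, h1, h2]
  ring

/-- The phase `exp (i x ξ)`. -/
def phase (x ξ : ℝ) : ℂ := Complex.exp (Complex.I * (x : ℂ) * (ξ : ℂ))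

lemma norm_phase (x ξ : ℝ) : ‖phase x ξ‖ = 1 := by
  rw [phase, show Complex.I * (x : ℂ) * (ξ : ℂ) = ((x * ξ : ℝ) : ℂ) * Complex.I by push_cast; ring]
  exact Complex.norm_exp_ofReal_mul_I _

lemma continuous_phase : Continuous fun p : ℝ × ℝ => phase p.1 p.2 := by
  unfold phase; fun_prop

lemma continuous_phase_right (x : ℝ) : Continuous (phase x) := by
  unfold phase; fun_prop

lemma hasDerivAt_phase (x ξ : ℝ) : HasDerivAt (phase x) (Complex.I * x * phase x ξ) ξ := by
  have h1 : HasDerivAt (fun ξ : ℝ => Complex.I * (x : ℂ) * (ξ : ℂ)) (Complex.I * x) ξ := by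
    simpa using (Complex.ofRealCLM.hasDerivAt (x := ξ)).const_mul (Complex.I * x)
  exact h1.cexp.congr_deriv (mul_comm _ _)

lemma integrable_mul_phase {φ : ℝ → ℂ} (h : Integrable φ) (x : ℝ) :
    Integrable fun ξ => φ ξ * phase x ξ :=
  h.mul_bdd (c := 1) (continuous_phase_right x).aestronglyMeasurable
    (ae_of_all _ fun ξ => (norm_phase x ξ).le)

lemma integral_mul_phase_by_parts {φ φ' : ℝ → ℂ} (hc : Continuous φ)
    (hd : ∀ x, x ≠ 0 → HasDerivAt φ (φ' x) x) (hφ : Integrable φ) (hφ' : Integrable φ') (x : ℝ) :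
    Complex.I * x * ∫ ξ, φ ξ * phase x ξ = -∫ ξ, φ' ξ * phase x ξ := by
  have h1 := integrable_mul_phase hφ x
  have h2 := integrable_mul_phase hφ' x
  have h3 : ∫ ξ, (φ' ξ * phase x ξ + Complex.I * x * (φ ξ * phase x ξ)) = 0 := by
    refine integral_eq_zero_of_hasDerivAt_off_zero (hc.mul (continuous_phase_right x))
      (fun ξ hξ => ?_) h1 (h2.add (h1.const_mul _))
    refine ((hd ξ hξ).mul (hasDerivAt_phase x ξ)).congr_deriv ?_
    ring
  rw [integral_add h2 (h1.const_mul _), integral_const_mul] at h3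
  linear_combination h3

lemma norm_integral_mul_phase_le (φ : ℝ → ℂ) (x : ℝ) :
    ‖∫ ξ, φ ξ * phase x ξ‖ ≤ ∫ ξ, ‖φ ξ‖ := by
  refine (norm_integral_le_integral_norm _).trans_eq ?_
  simp [norm_phase]

/-- Two integrations by parts gain a factor `x²`. Only integrability is asked of `φ''`, so it may be
singular at `0`. -/
lemma norm_integral_mul_phase_le_decay {φ φ' φ'' : ℝ → ℂ} (hc : Continuous φ) (hc' : Continuous φ')
    (hd : ∀ x, x ≠ 0 → HasDerivAt φ (φ' x) x) (hd' : ∀ x, x ≠ 0 → HasDerivAt φ' (φ'' x) x)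
    (hφ : Integrable φ) (hφ' : Integrable φ') (hφ'' : Integrable φ'') :
    ∃ C : ℝ, 0 ≤ C ∧ ∀ x : ℝ, ‖∫ ξ, φ ξ * phase x ξ‖ ≤ C * (1 + x ^ 2)⁻¹ := by
  refine ⟨(∫ ξ, ‖φ ξ‖) + ∫ ξ, ‖φ'' ξ‖, by positivity, fun x => ?_⟩
  have h1 := integral_mul_phase_by_parts hc hd hφ hφ' x
  have h2 := integral_mul_phase_by_parts hc' hd' hφ' hφ'' x
  have h3 : ((x ^ 2 : ℝ) : ℂ) * ∫ ξ, φ ξ * phase x ξ = -∫ ξ, φ'' ξ * phase x ξ := by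
    push_cast
    linear_combination (-Complex.I * x) * h1 + h2 +
      (x ^ 2 * ∫ ξ, φ ξ * phase x ξ) * Complex.I_sq
  have h4 : x ^ 2 * ‖∫ ξ, φ ξ * phase x ξ‖ ≤ ∫ ξ, ‖φ'' ξ‖ := by
    have := congrArg norm h3
    rw [norm_mul, norm_neg, Complex.norm_real, Real.norm_of_nonneg (sq_nonneg x)] at this
    rw [this]; exact norm_integral_mul_phase_le _ _
  have h5 := norm_integral_mul_phase_le φ x
  rw [← div_eq_mul_inv, le_div_iff₀ (by positivity)]
  nlinarith

/-! ### The kernel as a Fourier integral -/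

lemma kernel_eq (α t x : ℝ) :
    kernel α t x = (1 / (2 * Real.pi)) * (∫ ξ, multiplier α t ξ * phase x ξ).re := rfl

lemma multiplier_neg (α t ξ : ℝ) :
    multiplier α t (-ξ) = (starRingEnd ℂ) (multiplier α t ξ) := by
  simp [multiplier, symbol_neg, ← Complex.exp_conj]

lemma phase_neg (x ξ : ℝ) : phase x (-ξ) = (starRingEnd ℂ) (phase x ξ) := by
  simp [phase, ← Complex.exp_conj]

/-- The substitution `ξ ↦ -ξ` conjugates the integrand, so the integral equals its own conjugate. -/
lemma kernel_ofReal (α t x : ℝ) :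
    (kernel α t x : ℂ) = (1 / (2 * Real.pi)) * ∫ ξ, multiplier α t ξ * phase x ξ := by
  have h : (starRingEnd ℂ) (∫ ξ, multiplier α t ξ * phase x ξ) =
      ∫ ξ, multiplier α t ξ * phase x ξ := by
    rw [← integral_conj, ← integral_neg_eq_self]
    simp [multiplier_neg, phase_neg]
  rw [kernel_eq, Complex.ofReal_mul, Complex.conj_eq_iff_re.mp h]
  push_cast; ring

lemma hasDerivAt_phase_left (x ξ : ℝ) :
    HasDerivAt (fun y => phase y ξ) (Complex.I * ξ * phase x ξ) x := by
  have h := hasDerivAt_phase ξ x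
  have h1 : (fun y => phase y ξ) = phase ξ := by
    funext y; simp only [phase]; congr 1; ring
  have h2 : phase x ξ = phase ξ x := congrFun h1 x
  rw [h1, h2]; exact h

lemma integrable_ofReal_mul_multiplier {α : ℝ} (hα : 0 < α) (hα' : α < 1) {t : ℝ} (ht : 0 < t) :
    Integrable fun ξ : ℝ => (ξ : ℂ) * multiplier α t ξ :=
  integrable_mul_multiplier hα hα' ht (Complex.continuous_ofReal.aestronglyMeasurable)
    (a := 1) (C := 1) (by norm_num) (by simp)

lemma hasDerivAt_integral_multiplier {α : ℝ} (hα : 0 < α) (hα' : α < 1) {t : ℝ} (ht : 0 < t)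
    (x : ℝ) : HasDerivAt (fun y => ∫ ξ, multiplier α t ξ * phase y ξ)
      (∫ ξ : ℝ, Complex.I * ((ξ : ℂ) * multiplier α t ξ) * phase x ξ) x := by
  have h1 := integrable_multiplier hα hα' ht
  have h2 := integrable_ofReal_mul_multiplier hα hα' ht
  refine (hasDerivAt_integral_of_dominated_loc_of_deriv_le (s := Set.univ)
    (F' := fun y (ξ : ℝ) => Complex.I * ((ξ : ℂ) * multiplier α t ξ) * phase y ξ)
    (bound := fun ξ : ℝ => ‖(ξ : ℂ) * multiplier α t ξ‖) univ_mem
    (.of_forall fun y => (integrable_mul_phase h1 y).aestronglyMeasurable)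
    (integrable_mul_phase h1 x)
    (integrable_mul_phase (h2.const_mul Complex.I) x).aestronglyMeasurable
    (ae_of_all _ fun ξ y _ => ?_) h2.norm (ae_of_all _ fun ξ y _ => ?_)).2
  · simp [norm_phase]
  · refine ((hasDerivAt_phase_left y ξ).const_mul _).congr_deriv ?_
    ring

lemma hasDerivAt_kernel {α : ℝ} (hα : 0 < α) (hα' : α < 1) {t : ℝ} (ht : 0 < t) (x : ℝ) :
    HasDerivAt (kernel α t) ((1 / (2 * Real.pi)) *
      (∫ ξ : ℝ, Complex.I * ((ξ : ℂ) * multiplier α t ξ) * phase x ξ).re) x := by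
  have h := (hasDerivAt_integral_multiplier hα hα' ht x)
  have h1 := (Complex.reCLM.hasFDerivAt.comp_hasDerivAt x h).const_mul (1 / (2 * Real.pi))
  exact h1

lemma kernelDx_eq {α : ℝ} (hα : 0 < α) (hα' : α < 1) {t : ℝ} (ht : 0 < t) (x : ℝ) :
    kernelDx α t x = (1 / (2 * Real.pi)) *
      (∫ ξ : ℝ, Complex.I * ((ξ : ℂ) * multiplier α t ξ) * phase x ξ).re :=
  (hasDerivAt_kernel hα hα' ht x).deriv

lemma hasDerivAt_kernel' {α : ℝ} (hα : 0 < α) (hα' : α < 1) {t : ℝ} (ht : 0 < t) (x : ℝ) :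
    HasDerivAt (kernel α t) (kernelDx α t x) x := by
  rw [kernelDx_eq hα hα' ht]; exact hasDerivAt_kernel hα hα' ht x

lemma continuous_integral_mul_phase {φ : ℝ → ℂ} (h : Integrable φ) :
    Continuous fun x => ∫ ξ, φ ξ * phase x ξ := by
  refine continuous_of_dominated (bound := fun ξ : ℝ => ‖φ ξ‖)
    (fun x => (integrable_mul_phase h x).aestronglyMeasurable)
    (fun x => ae_of_all _ fun ξ => ?_) h.norm (ae_of_all _ fun ξ => ?_)
  · simp [norm_phase]
  · exact continuous_const.mul (continuous_phase.comp (continuous_id.prodMk continuous_const))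

lemma continuous_kernel {α : ℝ} (hα : 0 < α) (hα' : α < 1) {t : ℝ} (ht : 0 < t) :
    Continuous (kernel α t) :=
  continuous_iff_continuousAt.mpr fun x => (hasDerivAt_kernel hα hα' ht x).continuousAt

lemma continuous_kernelDx {α : ℝ} (hα : 0 < α) (hα' : α < 1) {t : ℝ} (ht : 0 < t) :
    Continuous (kernelDx α t) := by
  have h := continuous_integral_mul_phase
    ((integrable_ofReal_mul_multiplier hα hα' ht).const_mul Complex.I)
  have h1 : kernelDx α t = fun x => (1 / (2 * Real.pi)) *
      (∫ ξ : ℝ, Complex.I * ((ξ : ℂ) * multiplier α t ξ) * phase x ξ).re :=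
    funext fun x => kernelDx_eq hα hα' ht x
  rw [h1]
  exact continuous_const.mul (Complex.continuous_re.comp h)

/-! ### Decay of the kernel at unit time -/

lemma hasDerivAt_multiplier (α : ℝ) {ξ : ℝ} (h : ξ ≠ 0) :
    HasDerivAt (multiplier α 1) ((((α + 1 : ℝ) : ℂ) * Complex.I *
      (Complex.I * (ξ : ℂ)) ^ (α : ℂ)) * multiplier α 1 ξ) ξ := by
  have h1 := hasDerivAt_I_mul_cpow (α + 1) h
  rw [show α + 1 - 1 = α by ring] at h1
  have h2 : multiplier α 1 = fun ξ : ℝ =>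
      Complex.exp ((Complex.I * (ξ : ℂ)) ^ ((α + 1 : ℝ) : ℂ)) := by
    funext ξ; simp [multiplier, symbol_eq]
  rw [h2]
  exact h1.cexp.congr_deriv (mul_comm _ _)

section Decay

variable {α : ℝ} (hα : 0 < α) (hα' : α < 1)
include hα hα'

lemma integrable_cpow_mul_multiplier (c : ℂ) {a : ℝ} (ha : -1 < a) :
    Integrable fun ξ : ℝ => c * (Complex.I * (ξ : ℂ)) ^ (a : ℂ) * multiplier α 1 ξ :=
  integrable_mul_multiplier hα hα' one_pos
    (((measurable_I_mul_cpow a).const_mul c).aestronglyMeasurable) (a := a) (C := ‖c‖) ha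
    (fun ξ => by rw [norm_mul, norm_I_mul_cpow])

lemma integrable_cpow_mul_cpow_mul_multiplier (c : ℂ) {a b : ℝ} (ha : 0 ≤ a) (hb : 0 ≤ b) :
    Integrable fun ξ : ℝ => c * (Complex.I * (ξ : ℂ)) ^ (a : ℂ) * (Complex.I * (ξ : ℂ)) ^ (b : ℂ) *
      multiplier α 1 ξ :=
  integrable_mul_multiplier hα hα' one_pos
    ((((measurable_I_mul_cpow a).const_mul c).mul (measurable_I_mul_cpow b)).aestronglyMeasurable)
    (a := a + b) (C := ‖c‖) (by linarith)
    (fun ξ => by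
      rw [norm_mul, norm_mul, norm_I_mul_cpow, norm_I_mul_cpow,
        Real.rpow_add_of_nonneg (abs_nonneg _) ha hb, mul_assoc])

/-- The worst term of the second derivative is of size `|ξ|^(α-1)`, integrable at `0` because `α >
0`. -/
lemma norm_integral_multiplier_le : ∃ C : ℝ, 0 ≤ C ∧ ∀ x : ℝ,
    ‖∫ ξ, multiplier α 1 ξ * phase x ξ‖ ≤ C * (1 + x ^ 2)⁻¹ := by
  set γ : ℂ := ((α + 1 : ℝ) : ℂ) * Complex.I
  refine norm_integral_mul_phase_le_decay
    (φ' := fun ξ => (γ * (Complex.I * (ξ : ℂ)) ^ (α : ℂ)) * multiplier α 1 ξ)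
    (φ'' := fun ξ => γ * (α * Complex.I) * (Complex.I * (ξ : ℂ)) ^ ((α - 1 : ℝ) : ℂ) *
        multiplier α 1 ξ + γ ^ 2 * (Complex.I * (ξ : ℂ)) ^ (α : ℂ) * (Complex.I * (ξ : ℂ)) ^ (α : ℂ)
        * multiplier α 1 ξ)
    (continuous_multiplier hα 1)
    ((continuous_const.mul (continuous_I_mul_cpow hα)).mul (continuous_multiplier hα 1))
    (fun ξ hξ => hasDerivAt_multiplier α hξ) (fun ξ hξ => ?_)
    (integrable_multiplier hα hα' one_pos)
    (integrable_cpow_mul_multiplier hα hα' _ (by linarith))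
    ((integrable_cpow_mul_multiplier hα hα' _ (by linarith)).add
      (integrable_cpow_mul_cpow_mul_multiplier hα hα' _ hα.le hα.le))
  refine (((hasDerivAt_I_mul_cpow α hξ).const_mul γ).mul
    (hasDerivAt_multiplier α hξ)).congr_deriv ?_
  ring

/-- The extra factor `ξ` softens the singular term of the second derivative to `|ξ|^α`. -/
lemma norm_integral_ofReal_mul_multiplier_le : ∃ C : ℝ, 0 ≤ C ∧ ∀ x : ℝ,
    ‖∫ ξ : ℝ, ((ξ : ℂ) * multiplier α 1 ξ) * phase x ξ‖ ≤ C * (1 + x ^ 2)⁻¹ := by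
  set γ : ℂ := ((α + 1 : ℝ) : ℂ) * Complex.I
  have hm := fun (a : ℝ) => measurable_I_mul_cpow a
  have hx : Measurable fun ξ : ℝ => (ξ : ℂ) := Complex.measurable_ofReal
  have i1 : Integrable fun ξ : ℝ => (γ * (ξ * (Complex.I * (ξ : ℂ)) ^ (α : ℂ))) *
      multiplier α 1 ξ :=
    integrable_mul_multiplier hα hα' one_pos
      ((hx.mul (hm α)).const_mul γ).aestronglyMeasurable (a := 1 + α) (C := ‖γ‖) (by linarith)
      (fun ξ => by
        rw [norm_mul, norm_mul (ξ : ℂ), norm_I_mul_cpow,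
          Real.rpow_add_of_nonneg (abs_nonneg _) zero_le_one hα.le]
        simp)
  have i2 : Integrable fun ξ : ℝ => (γ * (α * Complex.I) *
      (ξ * (Complex.I * (ξ : ℂ)) ^ ((α - 1 : ℝ) : ℂ))) * multiplier α 1 ξ :=
    integrable_mul_multiplier hα hα' one_pos
      ((hx.mul (hm (α - 1))).const_mul _).aestronglyMeasurable (a := α)
      (C := ‖γ * (α * Complex.I)‖) (by linarith)
      (fun ξ => by
        rw [norm_mul, norm_mul (ξ : ℂ), norm_I_mul_cpow, Complex.norm_real, Real.norm_eq_abs]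
        refine mul_le_mul_of_nonneg_left ?_ (norm_nonneg _)
        rcases eq_or_ne ξ 0 with h | h
        · simp [h]; positivity
        · have := Real.rpow_add (abs_pos.mpr h) 1 (α - 1)
          rw [Real.rpow_one, show 1 + (α - 1) = α by ring] at this
          exact this.ge)
  have i3 : Integrable fun ξ : ℝ => (γ ^ 2 * (ξ * ((Complex.I * (ξ : ℂ)) ^ (α : ℂ) *
      (Complex.I * (ξ : ℂ)) ^ (α : ℂ)))) * multiplier α 1 ξ :=
    integrable_mul_multiplier hα hα' one_pos
      ((hx.mul ((hm α).mul (hm α))).const_mul _).aestronglyMeasurable (a := 1 + (α + α))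
      (C := ‖γ ^ 2‖) (by linarith)
      (fun ξ => by
        rw [norm_mul, norm_mul (ξ : ℂ), norm_mul, norm_I_mul_cpow,
          Real.rpow_add_of_nonneg (abs_nonneg _) zero_le_one (by linarith),
          Real.rpow_add_of_nonneg (abs_nonneg _) hα.le hα.le]
        simp)
  refine norm_integral_mul_phase_le_decay
    (φ' := fun ξ => multiplier α 1 ξ +
      (γ * (ξ * (Complex.I * (ξ : ℂ)) ^ (α : ℂ))) * multiplier α 1 ξ)
    (φ'' := fun ξ => 2 * γ * (Complex.I * (ξ : ℂ)) ^ (α : ℂ) * multiplier α 1 ξ +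
      (γ * (α * Complex.I) * (ξ * (Complex.I * (ξ : ℂ)) ^ ((α - 1 : ℝ) : ℂ))) *
        multiplier α 1 ξ + (γ ^ 2 * (ξ * ((Complex.I * (ξ : ℂ)) ^ (α : ℂ) *
          (Complex.I * (ξ : ℂ)) ^ (α : ℂ)))) * multiplier α 1 ξ)
    (Complex.continuous_ofReal.mul (continuous_multiplier hα 1))
    ((continuous_multiplier hα 1).add ((continuous_const.mul
      (Complex.continuous_ofReal.mul (continuous_I_mul_cpow hα))).mul (continuous_multiplier hα 1)))
    (fun ξ hξ => ?_) (fun ξ hξ => ?_)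
    (integrable_ofReal_mul_multiplier hα hα' one_pos)
    ((integrable_multiplier hα hα' one_pos).add i1)
    (((integrable_cpow_mul_multiplier hα hα' _ (by linarith)).add i2).add i3)
  · refine ((Complex.ofRealCLM.hasDerivAt (x := ξ)).mul (hasDerivAt_multiplier α hξ)).congr_deriv ?_
    simp only [Complex.ofRealCLM_apply, Complex.ofReal_one, γ]; ring
  · refine ((hasDerivAt_multiplier α hξ).add ((((Complex.ofRealCLM.hasDerivAt (x := ξ)).mul
      (hasDerivAt_I_mul_cpow α hξ)).const_mul γ).mul (hasDerivAt_multiplier α hξ))).congr_deriv ?_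
    simp only [Complex.ofRealCLM_apply, Complex.ofReal_one, Pi.mul_apply, γ]; ring

lemma abs_kernel_one_le : ∃ C : ℝ, 0 ≤ C ∧ ∀ x : ℝ, |kernel α 1 x| ≤ C * (1 + x ^ 2)⁻¹ := by
  obtain ⟨C, hC, h⟩ := norm_integral_multiplier_le hα hα'
  refine ⟨1 / (2 * Real.pi) * C, by positivity, fun x => ?_⟩
  rw [kernel_eq, abs_mul, abs_of_pos (by positivity), mul_assoc]
  exact mul_le_mul_of_nonneg_left ((Complex.abs_re_le_norm _).trans (h x)) (by positivity)

lemma abs_kernelDx_one_le : ∃ C : ℝ, 0 ≤ C ∧ ∀ x : ℝ, |kernelDx α 1 x| ≤ C * (1 + x ^ 2)⁻¹ := by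
  obtain ⟨C, hC, h⟩ := norm_integral_ofReal_mul_multiplier_le hα hα'
  refine ⟨1 / (2 * Real.pi) * C, by positivity, fun x => ?_⟩
  rw [kernelDx_eq hα hα' one_pos, abs_mul, abs_of_pos (by positivity), mul_assoc]
  refine mul_le_mul_of_nonneg_left ((Complex.abs_re_le_norm _).trans ?_) (by positivity)
  simp only [mul_assoc Complex.I]
  rw [integral_const_mul, norm_mul, Complex.norm_I, one_mul]
  exact h x

end Decay

/-! ### Scaling -/

lemma symbol_mul {α : ℝ} (hα : 0 < α) {r : ℝ} (hr : 0 < r) (ξ : ℝ) :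
    symbol α (r * ξ) = ((r ^ (α + 1) : ℝ) : ℂ) * symbol α ξ := by
  by_cases h : ξ = 0
  · subst h
    have h1 : ((α + 1 : ℝ) : ℂ) ≠ 0 := by exact_mod_cast (by linarith : α + 1 ≠ 0)
    simp only [symbol_eq, mul_zero, Complex.ofReal_zero, Complex.zero_cpow h1]
  · have hI : Complex.I * (ξ : ℂ) ≠ 0 := by simp [h]
    have hr' : (r : ℂ) ≠ 0 := by exact_mod_cast hr.ne'
    rw [symbol_eq, symbol_eq, show Complex.I * ((r * ξ : ℝ) : ℂ) = (r : ℂ) * (Complex.I * ξ) by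
      push_cast; ring, Complex.cpow_def_of_ne_zero (mul_ne_zero hr' hI),
      Complex.log_ofReal_mul hr hI, add_mul, Complex.exp_add, ← Complex.cpow_def_of_ne_zero hI,
      Complex.ofReal_log hr.le, ← Complex.cpow_def_of_ne_zero hr', Complex.ofReal_cpow hr.le]

/-- The symbol is homogeneous of degree `α + 1`, so dilating `ξ` by `t^(1/(α+1))` turns time `t`
into time one. -/
lemma kernel_scaling {α : ℝ} (hα : 0 < α) {t : ℝ} (ht : 0 < t) (x : ℝ) :
    kernel α t x = t ^ (-(1 / (α + 1))) * kernel α 1 (t ^ (-(1 / (α + 1))) * x) := by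
  set r := t ^ (-(1 / (α + 1))) with hr
  have hr0 : 0 < r := Real.rpow_pos_of_pos ht _
  have hrt : (r⁻¹) ^ (α + 1) = t := by
    rw [hr, ← Real.rpow_neg ht.le, ← Real.rpow_mul ht.le]
    have : - -(1 / (α + 1)) * (α + 1) = 1 := by field_simp
    rw [this, Real.rpow_one]
  have h : ∫ ξ, multiplier α t ξ * phase x ξ =
      (r : ℂ) * ∫ ξ, multiplier α 1 ξ * phase (r * x) ξ := by
    have h1 := Measure.integral_comp_mul_left
      (fun ξ => multiplier α 1 ξ * phase (r * x) ξ) r⁻¹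
    rw [inv_inv, abs_of_pos hr0] at h1
    rw [show (r : ℂ) * ∫ ξ, multiplier α 1 ξ * phase (r * x) ξ =
      r • ∫ ξ, multiplier α 1 ξ * phase (r * x) ξ from rfl, ← h1]
    refine integral_congr_ae (ae_of_all _ fun ξ => ?_)
    simp only [multiplier, phase]
    rw [symbol_mul hα (inv_pos.mpr hr0), hrt]
    have hr' : (r : ℂ) ≠ 0 := by exact_mod_cast hr0.ne'
    congr 2
    · push_cast; ring
    · push_cast; field_simp
  rw [kernel_eq, kernel_eq, h, Complex.re_ofReal_mul]
  ring

lemma kernelDx_scaling {α : ℝ} (hα : 0 < α) {t : ℝ} (ht : 0 < t) (x : ℝ) :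
    kernelDx α t x = t ^ (-(1 / (α + 1))) * (t ^ (-(1 / (α + 1))) *
      kernelDx α 1 (t ^ (-(1 / (α + 1))) * x)) := by
  rw [kernelDx, kernelDx]
  set r := t ^ (-(1 / (α + 1))) with hr
  have h : (fun y => kernel α t y) = fun y => r * kernel α 1 (r * y) :=
    funext fun y => kernel_scaling hα ht y
  rw [h, deriv_const_mul_field, deriv_comp_mul_left, smul_eq_mul]

/-! ### Fourier inversion and the semigroup property -/

lemma multiplier_mul (α s t ξ : ℝ) :
    multiplier α s ξ * multiplier α t ξ = multiplier α (s + t) ξ := by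
  rw [multiplier, multiplier, multiplier, ← Complex.exp_add]; congr 1; push_cast; ring

section Semigroup

variable {α : ℝ} (hα : 0 < α) (hα' : α < 1)
include hα hα'

lemma integrable_kernel {t : ℝ} (ht : 0 < t) : Integrable (kernel α t) := by
  obtain ⟨C, hC, h⟩ := abs_kernel_one_le hα hα'
  have h1 : Integrable (kernel α 1) :=
    (integrable_inv_one_add_sq.const_mul C).mono'
      (continuous_kernel hα hα' one_pos).aestronglyMeasurable (ae_of_all _ h)
  have hr : t ^ (-(1 / (α + 1))) ≠ 0 := (Real.rpow_pos_of_pos ht _).ne'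
  rw [show kernel α t = _ from funext fun x => kernel_scaling hα ht x]
  exact (h1.comp_mul_left' hr).const_mul _

lemma integrable_kernelDx {t : ℝ} (ht : 0 < t) : Integrable (kernelDx α t) := by
  obtain ⟨C, hC, h⟩ := abs_kernelDx_one_le hα hα'
  have h1 : Integrable (kernelDx α 1) :=
    (integrable_inv_one_add_sq.const_mul C).mono'
      (continuous_kernelDx hα hα' one_pos).aestronglyMeasurable (ae_of_all _ h)
  have hr : t ^ (-(1 / (α + 1))) ≠ 0 := (Real.rpow_pos_of_pos ht _).ne'
  rw [show kernelDx α t = _ from funext fun x => kernelDx_scaling hα ht x]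
  exact ((h1.comp_mul_left' hr).const_mul _).const_mul _

/-- Fourier inversion applies since the multiplier is continuous and integrable and its transform, a
dilated kernel, is integrable by the decay estimate. The factors `2π` convert between the two
normalizations of the transform. -/
lemma integral_kernel_mul_phase {t : ℝ} (ht : 0 < t) (ξ : ℝ) :
    ∫ x, (kernel α t x : ℂ) * phase (-ξ) x = multiplier α t ξ := by
  have hπ : (0 : ℝ) < 2 * Real.pi := by positivity
  have hpi : (Real.pi : ℂ) ≠ 0 := by exact_mod_cast Real.pi_ne_zero
  have hφ : ∀ x : ℝ, ∫ v, multiplier α t v * phase x v = 2 * Real.pi * kernel α t x := fun x => by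
    rw [kernel_ofReal]; field_simp
  have hinv : ∀ w : ℝ, FourierTransformInv.fourierInv (multiplier α t) w =
      2 * Real.pi * kernel α t (2 * Real.pi * w) := fun w => by
    rw [Real.fourierInv_eq', ← hφ]
    refine integral_congr_ae (ae_of_all _ fun v => ?_)
    simp only [smul_eq_mul, phase]
    rw [mul_comm]
    congr 2
    simp; ring
  have hf : ∀ w : ℝ, FourierTransform.fourier (multiplier α t) w =
      2 * Real.pi * kernel α t (-(2 * Real.pi) * w) := fun w => by
    rw [Real.fourier_eq', ← hφ]
    refine integral_congr_ae (ae_of_all _ fun v => ?_)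
    simp only [smul_eq_mul, phase]
    rw [mul_comm]
    congr 2
    simp; ring
  have hi : Integrable (FourierTransform.fourier (multiplier α t)) := by
    rw [show FourierTransform.fourier (multiplier α t) = _ from funext hf]
    exact (((integrable_kernel hα hα' ht).comp_mul_left' (neg_ne_zero.mpr hπ.ne')).ofReal).const_mul _
  have h1 := congrFun ((continuous_multiplier hα t).fourier_fourierInv_eq
    (integrable_multiplier hα hα' ht) hi) ξ
  rw [Real.fourier_eq'] at h1
  rw [← h1]
  have h2 := Measure.integral_comp_mul_left
    (fun x => (kernel α t x : ℂ) * phase (-ξ) x) (2 * Real.pi)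
  rw [abs_of_pos (inv_pos.mpr hπ)] at h2
  have h3 : ∫ x, (kernel α t x : ℂ) * phase (-ξ) x = (2 * Real.pi) •
      ∫ x, (kernel α t (2 * Real.pi * x) : ℂ) * phase (-ξ) (2 * Real.pi * x) := by
    rw [h2, smul_inv_smul₀ hπ.ne']
  rw [h3, ← integral_smul]
  refine integral_congr_ae (ae_of_all _ fun v => ?_)
  simp only [hinv, phase, smul_eq_mul, Complex.real_smul]
  rw [mul_comm (Complex.exp _), ← mul_assoc]
  congr 2
  · push_cast; ring
  · simp; ring

lemma integral_kernel {t : ℝ} (ht : 0 < t) : ∫ x, kernel α t x = 1 := by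
  have h := integral_kernel_mul_phase hα hα' ht 0
  have h0 : multiplier α t 0 = 1 := by
    have h1 : ((α + 1 : ℝ) : ℂ) ≠ 0 := by exact_mod_cast (by linarith : α + 1 ≠ 0)
    rw [multiplier, symbol_eq, Complex.ofReal_zero, mul_zero, Complex.zero_cpow h1]
    simp
  rw [h0] at h
  simp only [phase, neg_zero, Complex.ofReal_zero, mul_zero, zero_mul, Complex.exp_zero,
    mul_one] at h
  rw [integral_complex_ofReal] at h
  exact_mod_cast h

/-- Fubini: on the Fourier side, convolution with `K(s, ·)` is multiplication by `multiplier α s`.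
Both semigroup identities are instances. -/
lemma integral_kernel_mul_integral {s : ℝ} (hs : 0 < s) {φ : ℝ → ℂ} (hφ : Integrable φ) (x : ℝ) :
    ∫ y, (kernel α s y : ℂ) * ∫ ξ, φ ξ * phase (x - y) ξ =
      ∫ ξ, (multiplier α s ξ * φ ξ) * phase x ξ := by
  have hphase : ∀ y ξ, phase (x - y) ξ = phase x ξ * phase (-ξ) y := fun y ξ => by
    rw [phase, phase, phase, ← Complex.exp_add]; congr 1; push_cast; ring
  have hint : Integrable (Function.uncurry fun y ξ => (kernel α s y : ℂ) * (φ ξ * phase (x - y) ξ))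
      (volume.prod volume) := by
    have h1 := ((integrable_kernel hα hα' hs).ofReal (𝕜 := ℂ)).mul_prod hφ
    have h2 : Continuous fun p : ℝ × ℝ => phase (x - p.1) p.2 :=
      continuous_phase.comp ((continuous_const.sub continuous_fst).prodMk continuous_snd)
    refine (h1.mul_bdd (c := 1) h2.aestronglyMeasurable
      (ae_of_all _ fun p => (norm_phase _ _).le)).congr (ae_of_all _ fun p => ?_)
    simp [Function.uncurry, mul_assoc]
  simp_rw [← integral_const_mul]
  rw [integral_integral_swap hint]
  refine integral_congr_ae (ae_of_all _ fun ξ => ?_)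
  simp only
  rw [← integral_kernel_mul_phase hα hα' hs ξ, mul_assoc, ← integral_mul_const]
  refine integral_congr_ae (ae_of_all _ fun y => ?_)
  simp only [hphase]; ring

lemma kernel_semigroup {s t : ℝ} (hs : 0 < s) (ht : 0 < t) (x : ℝ) :
    ∫ y, kernel α s y * kernel α t (x - y) = kernel α (s + t) x := by
  have h := integral_kernel_mul_integral hα hα' hs (integrable_multiplier hα hα' ht) x
  simp only [multiplier_mul] at h
  apply Complex.ofReal_injective
  rw [← integral_complex_ofReal, kernel_ofReal, ← h, ← integral_const_mul]
  refine integral_congr_ae (ae_of_all _ fun y => ?_)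
  simp only [Complex.ofReal_mul, kernel_ofReal α t]
  ring

lemma kernelDx_ofReal {t : ℝ} (ht : 0 < t) (x : ℝ) : (kernelDx α t x : ℂ) = (1 / (2 * Real.pi)) *
    ∫ ξ : ℝ, Complex.I * ((ξ : ℂ) * multiplier α t ξ) * phase x ξ := by
  have h1 := (hasDerivAt_integral_multiplier hα hα' ht x).const_mul ((1 / (2 * Real.pi) : ℂ))
  have h2 := (Complex.ofRealCLM.hasFDerivAt (x := kernel α t x)).comp_hasDerivAt x
    (hasDerivAt_kernel' hα hα' ht x)
  refine h2.unique (h1.congr_of_eventuallyEq (.of_forall fun y => ?_))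
  exact kernel_ofReal α t y

lemma kernelDx_semigroup {s t : ℝ} (hs : 0 < s) (ht : 0 < t) (x : ℝ) :
    ∫ y, kernel α s y * kernelDx α t (x - y) = kernelDx α (s + t) x := by
  have h := integral_kernel_mul_integral hα hα' hs
    ((integrable_ofReal_mul_multiplier hα hα' ht).const_mul Complex.I) x
  have h1 : ∀ ξ : ℝ, multiplier α s ξ * (Complex.I * ((ξ : ℂ) * multiplier α t ξ)) =
      Complex.I * ((ξ : ℂ) * multiplier α (s + t) ξ) := fun ξ => by
    rw [← multiplier_mul]; ring
  simp only [h1] at h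
  apply Complex.ofReal_injective
  rw [← integral_complex_ofReal, kernelDx_ofReal hα hα' (by positivity), ← h, ← integral_const_mul]
  refine integral_congr_ae (ae_of_all _ fun y => ?_)
  simp only [Complex.ofReal_mul, kernelDx_ofReal hα hα' ht]
  ring

end Semigroup

/-! ### Positivity of the kernel -/

/-- The integrable functions whose inverse Fourier transform has nonnegative real part. -/
def HasNonnegTransform (ψ : ℝ → ℂ) : Prop :=
  Integrable ψ ∧ ∀ x, 0 ≤ (∫ ξ, ψ ξ * phase x ξ).re

/-- The bounded multipliers that preserve `HasNonnegTransform`. -/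
def IsPositiveMultiplier (φ : ℝ → ℂ) : Prop :=
  Measurable φ ∧ (∃ C : ℝ, ∀ ξ, ‖φ ξ‖ ≤ C) ∧
    ∀ ψ, HasNonnegTransform ψ → HasNonnegTransform fun ξ => φ ξ * ψ ξ

namespace IsPositiveMultiplier

variable {φ φ₁ φ₂ : ℝ → ℂ}

lemma mul (h₁ : IsPositiveMultiplier φ₁) (h₂ : IsPositiveMultiplier φ₂) :
    IsPositiveMultiplier fun ξ => φ₁ ξ * φ₂ ξ := by
  obtain ⟨m₁, ⟨C₁, b₁⟩, p₁⟩ := h₁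
  obtain ⟨m₂, ⟨C₂, b₂⟩, p₂⟩ := h₂
  refine ⟨m₁.mul m₂, ⟨C₁ * C₂, fun ξ => ?_⟩, fun ψ hψ => ?_⟩
  · rw [norm_mul]
    exact mul_le_mul (b₁ ξ) (b₂ ξ) (norm_nonneg _) ((norm_nonneg _).trans (b₁ ξ))
  · simpa only [mul_assoc] using p₁ _ (p₂ ψ hψ)

lemma add (h₁ : IsPositiveMultiplier φ₁) (h₂ : IsPositiveMultiplier φ₂) :
    IsPositiveMultiplier fun ξ => φ₁ ξ + φ₂ ξ := by
  obtain ⟨m₁, ⟨C₁, b₁⟩, p₁⟩ := h₁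
  obtain ⟨m₂, ⟨C₂, b₂⟩, p₂⟩ := h₂
  refine ⟨m₁.add m₂, ⟨C₁ + C₂, fun ξ => (norm_add_le _ _).trans (add_le_add (b₁ ξ) (b₂ ξ))⟩,
    fun ψ hψ => ?_⟩
  obtain ⟨i₁, n₁⟩ := p₁ ψ hψ
  obtain ⟨i₂, n₂⟩ := p₂ ψ hψ
  simp only [add_mul]
  refine ⟨i₁.add i₂, fun x => ?_⟩
  have := integral_add (integrable_mul_phase i₁ x) (integrable_mul_phase i₂ x)
  simp only [add_mul]
  rw [this, Complex.add_re]
  exact add_nonneg (n₁ x) (n₂ x)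

lemma const {c : ℝ} (hc : 0 ≤ c) : IsPositiveMultiplier fun _ => (c : ℂ) := by
  refine ⟨measurable_const, ⟨‖(c : ℂ)‖, fun _ => le_rfl⟩, fun ψ hψ => ⟨hψ.1.const_mul _, fun x => ?_⟩⟩
  simp only [mul_assoc]
  rw [integral_const_mul, Complex.re_ofReal_mul]
  exact mul_nonneg hc (hψ.2 x)

/-- Multiplication by a phase translates the inverse transform. -/
lemma phase (a : ℝ) : IsPositiveMultiplier (phase a) := by
  refine ⟨(continuous_phase_right a).measurable, ⟨1, fun ξ => (norm_phase a ξ).le⟩, fun ψ hψ =>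
    ⟨(integrable_mul_phase hψ.1 a).congr (ae_of_all _ fun ξ => mul_comm _ _), fun x => ?_⟩⟩
  convert hψ.2 (x + a) using 4 with ξ
  beta_reduce
  rw [mul_comm (RieszFeller.phase a ξ), mul_assoc]
  congr 1
  rw [RieszFeller.phase, RieszFeller.phase, RieszFeller.phase, ← Complex.exp_add]
  congr 1; push_cast; ring

lemma pow (h : IsPositiveMultiplier φ) (n : ℕ) : IsPositiveMultiplier fun ξ => φ ξ ^ n := by
  induction n with
  | zero => simpa using const zero_le_one
  | succ n ih => simpa only [pow_succ] using ih.mul h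

lemma sum {f : ℕ → ℝ → ℂ} (h : ∀ n, IsPositiveMultiplier (f n)) (N : ℕ) :
    IsPositiveMultiplier fun ξ => ∑ k ∈ Finset.range N, f k ξ := by
  induction N with
  | zero => simpa using const le_rfl
  | succ n ih => simpa only [Finset.sum_range_succ] using ih.add (h n)

lemma of_tendsto {f : ℕ → ℝ → ℂ} (h : ∀ n, IsPositiveMultiplier (f n)) {C : ℝ}
    (hb : ∀ n ξ, ‖f n ξ‖ ≤ C) (hlim : ∀ ξ, Tendsto (fun n => f n ξ) atTop (𝓝 (φ ξ))) :
    IsPositiveMultiplier φ := by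
  have hm : Measurable φ := measurable_of_tendsto_metrizable (fun n => (h n).1)
    (tendsto_pi_nhds.mpr hlim)
  have hφ : ∀ ξ, ‖φ ξ‖ ≤ C := fun ξ => le_of_tendsto (hlim ξ).norm (.of_forall fun n => hb n ξ)
  refine ⟨hm, ⟨C, hφ⟩, fun ψ hψ =>
    ⟨hψ.1.bdd_mul hm.aestronglyMeasurable (ae_of_all _ hφ), fun x => ?_⟩⟩
  have ht : Tendsto (fun n => ∫ ξ, f n ξ * ψ ξ * RieszFeller.phase x ξ) atTop
      (𝓝 (∫ ξ, φ ξ * ψ ξ * RieszFeller.phase x ξ)) := by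
    refine tendsto_integral_of_dominated_convergence (fun ξ => C * ‖ψ ξ‖)
      (fun n => (integrable_mul_phase ((h n).2.2 ψ hψ).1 x).aestronglyMeasurable)
      (hψ.1.norm.const_mul C) (fun n => ae_of_all _ fun ξ => ?_)
      (ae_of_all _ fun ξ => ((hlim ξ).mul_const _).mul_const _)
    rw [norm_mul, norm_mul, norm_phase, mul_one]
    exact mul_le_mul_of_nonneg_right (hb n ξ) (norm_nonneg _)
  exact ge_of_tendsto ((Complex.continuous_re.tendsto _).comp ht)
    (.of_forall fun n => ((h n).2.2 ψ hψ).2 x)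

/-- The approximants `(1 + φ/n)^n` lie in the class by closure under sums and products, and are
bounded by `exp C` uniformly in `n`. -/
lemma exp (h : IsPositiveMultiplier φ) : IsPositiveMultiplier fun ξ => Complex.exp (φ ξ) := by
  obtain ⟨C, hC⟩ := h.2.1
  have hC0 : 0 ≤ C := (norm_nonneg _).trans (hC 0)
  refine of_tendsto (f := fun n ξ => (1 + φ ξ / n) ^ n) (C := Real.exp C) (fun n => ?_)
    (fun n ξ => ?_) (fun ξ => Complex.tendsto_one_add_div_pow_exp (φ ξ))
  · have h1 : IsPositiveMultiplier fun ξ => ((1 : ℝ) : ℂ) + (((n : ℝ)⁻¹ : ℝ) : ℂ) * φ ξ :=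
      (const zero_le_one).add ((const (by positivity)).mul h)
    convert h1.pow n using 4 with ξ
    · simp
    · push_cast; rw [div_eq_inv_mul]
  · rw [norm_pow]
    have h1 : ‖1 + φ ξ / n‖ ≤ Real.exp (C / n) := by
      refine (norm_add_le _ _).trans ?_
      rw [norm_one, norm_div, Complex.norm_natCast]
      have := Real.add_one_le_exp (C / n)
      have h2 : ‖φ ξ‖ / n ≤ C / n := by gcongr; exact hC ξ
      linarith
    refine (pow_le_pow_left₀ (norm_nonneg _) h1 n).trans ?_
    rw [← Real.exp_nat_mul]
    refine Real.exp_le_exp.mpr ?_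
    -- For `n = 0` the quotient `C / 0` is `0`, and the claim reduces to `0 ≤ C`.
    rcases eq_or_ne n 0 with hn | hn
    · simp [hn, hC0]
    · have : (n : ℝ) ≠ 0 := by exact_mod_cast hn
      rw [mul_div_cancel₀ _ this]

end IsPositiveMultiplier

/-! ### Fractional difference approximation of the symbol. -/

/-- The coefficients of the power series of `(1 - z)^a`. -/
def binomialCoeff (a : ℝ) (k : ℕ) : ℝ := (-1) ^ k * Ring.choose a k

lemma binomialCoeff_zero (a : ℝ) : binomialCoeff a 0 = 1 := by simp [binomialCoeff]

lemma binomialCoeff_one (a : ℝ) : binomialCoeff a 1 = -a := by simp [binomialCoeff]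

lemma binomialCoeff_succ (a : ℝ) (k : ℕ) :
    binomialCoeff a (k + 1) = (k - a) / (k + 1) * binomialCoeff a k := by
  have h1 := Ring.descPochhammer_eq_factorial_smul_choose a k
  have h2 := Ring.descPochhammer_eq_factorial_smul_choose a (k + 1)
  rw [descPochhammer_succ_right, Polynomial.smeval_mul, h1] at h2
  simp only [nsmul_eq_mul, Polynomial.smeval_sub, Polynomial.smeval_X, Polynomial.smeval_natCast,
    pow_one, pow_zero, mul_one, Nat.factorial_succ, Nat.cast_mul] at h2
  have h3 : ((k.factorial : ℕ) : ℝ) ≠ 0 := by exact_mod_cast k.factorial_ne_zero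
  have h4 : (k : ℝ) + 1 ≠ 0 := by positivity
  have h5 : ((k + 1 : ℕ) : ℝ) * Ring.choose a (k + 1) = Ring.choose a k * (a - k) := by
    apply mul_left_cancel₀ h3
    linear_combination -h2
  push_cast at h5
  rw [binomialCoeff, binomialCoeff, pow_succ]
  rw [div_mul_eq_mul_div, eq_div_iff h4]
  linear_combination (-1 : ℝ) ^ k * (-1 : ℝ) * h5

/-- The coefficient of order two is `a(a-1)/2`, and from there on each ratio `(k - a)/(k + 1)` is
nonnegative because `a < 2`. The only negative coefficient is thus `-a`, of order one. -/
lemma binomialCoeff_nonneg {a : ℝ} (h1 : 1 < a) (h2 : a < 2) (k : ℕ) :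
    0 ≤ binomialCoeff a (k + 2) := by
  induction k with
  | zero =>
    rw [binomialCoeff_succ, binomialCoeff_one]
    push_cast
    rw [show (1 - a) / (1 + 1) * -a = a * (a - 1) / 2 by ring]
    have := mul_nonneg (by linarith : 0 ≤ a) (by linarith : 0 ≤ a - 1)
    positivity
  | succ n ih =>
    rw [show n + 1 + 2 = (n + 2) + 1 by ring, binomialCoeff_succ]
    refine mul_nonneg (div_nonneg ?_ (by positivity)) ih
    push_cast
    have : (0 : ℝ) ≤ n := n.cast_nonneg
    linarith

lemma hasSum_one_sub_cpow (a : ℝ) {z : ℂ} (hz : ‖z‖ < 1) :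
    HasSum (fun k : ℕ => (binomialCoeff a k : ℂ) * z ^ k) ((1 - z) ^ (a : ℂ)) := by
  have hz' : -z ∈ Metric.eball (0 : ℂ) 1 := by
    rw [← ENNReal.ofReal_one, Metric.eball_ofReal]
    simpa using hz
  have h := (Complex.one_add_cpow_hasFPowerSeriesOnBall_zero (a := (a : ℂ))).hasSum hz'
  rw [zero_add, ← sub_eq_add_neg] at h
  refine (congrArg (fun f => HasSum f _) (funext fun k => ?_)).mp h
  rw [binomialSeries_apply, List.ofFn_const, List.prod_replicate, smul_eq_mul, binomialCoeff,
    neg_pow]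
  push_cast
  ring

/-- After multiplication by `phase h`, the series of `(1 - r phase(-h))^a` consists of a translation
(order zero), the constant `-a r` (order one), and nonnegative multiples of translations. The
exponential of the negative constant is still a positive factor. -/
lemma isPositiveMultiplier_exp_one_sub_cpow {a : ℝ} (h1 : 1 < a) (h2 : a < 2) {s r : ℝ}
    (hs : 0 ≤ s) (hr : 0 < r) (hr' : r < 1) (h : ℝ) :
    IsPositiveMultiplier (fun ξ =>
      Complex.exp (s * (phase h ξ * (1 - r * phase (-h) ξ) ^ (a : ℂ)))) ∧
    ∀ ξ, ‖Complex.exp (s * (phase h ξ * (1 - r * phase (-h) ξ) ^ (a : ℂ)))‖ ≤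
      Real.exp (s * (1 - r) ^ a) := by
  have hpp : ∀ ξ, phase h ξ * phase (-h) ξ = 1 := fun ξ => by
    rw [phase, phase, ← Complex.exp_add]; simp
  have hz : ∀ ξ, ‖(r : ℂ) * phase (-h) ξ‖ < 1 := fun ξ => by
    rw [norm_mul, norm_phase, mul_one, Complex.norm_real, Real.norm_of_nonneg hr.le]; exact hr'
  -- The tail from order two on, evaluated at the real point `r`; it dominates the complex tail
  -- termwise.
  set b : ℕ → ℝ := fun k => binomialCoeff a (k + 2) * r ^ (k + 2)
  have hb0 : ∀ k, 0 ≤ b k := fun k => mul_nonneg (binomialCoeff_nonneg h1 h2 k) (by positivity)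
  have hreal : HasSum b ((1 - r) ^ a - 1 + a * r) := by
    have := hasSum_one_sub_cpow a (z := (r : ℂ)) (by
      rwa [Complex.norm_real, Real.norm_of_nonneg hr.le])
    have h3 := (hasSum_nat_add_iff' 2).mpr this
    rw [← Complex.hasSum_ofReal]
    have e : (((1 - r) ^ a - 1 + a * r : ℝ) : ℂ) = (1 - (r : ℂ)) ^ (a : ℂ) -
        ∑ i ∈ Finset.range 2, (binomialCoeff a i : ℂ) * (r : ℂ) ^ i := by
      rw [Finset.sum_range_succ, Finset.sum_range_one, binomialCoeff_zero, binomialCoeff_one]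
      push_cast [Complex.ofReal_cpow (by linarith : 0 ≤ 1 - r)]
      ring
    rw [e]
    refine (congrArg (fun f => HasSum f _) (funext fun k => ?_)).mp h3
    simp [b]
  set f : ℕ → ℝ → ℂ := fun k ξ => ((b k : ℝ) : ℂ) * (phase (-h) ξ ^ (k + 1))
  have hf : ∀ ξ, HasSum (fun k => f k ξ)
      (phase h ξ * (1 - r * phase (-h) ξ) ^ (a : ℂ) - phase h ξ + a * r) := fun ξ => by
    have h3 := ((hasSum_nat_add_iff' 2).mpr (hasSum_one_sub_cpow a (hz ξ))).mul_left (phase h ξ)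
    have e : phase h ξ * (1 - r * phase (-h) ξ) ^ (a : ℂ) - phase h ξ + a * r =
        phase h ξ * ((1 - r * phase (-h) ξ) ^ (a : ℂ) -
          ∑ i ∈ Finset.range 2, (binomialCoeff a i : ℂ) * (r * phase (-h) ξ) ^ i) := by
      rw [Finset.sum_range_succ, Finset.sum_range_one, binomialCoeff_zero, binomialCoeff_one]
      push_cast
      linear_combination (-(a : ℂ) * r) * hpp ξ
    rw [e]
    refine (congrArg (fun f => HasSum f _) (funext fun k => ?_)).mp h3
    simp only [f, b]
    push_cast
    linear_combination ((binomialCoeff a (k + 2) : ℂ) * r ^ (k + 2) * phase (-h) ξ ^ (k + 1)) *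
      hpp ξ
  have hfn : ∀ k ξ, ‖f k ξ‖ = b k := fun k ξ => by
    simp only [f]
    rw [norm_mul, norm_pow, norm_phase, one_pow, mul_one, Complex.norm_real,
      Real.norm_of_nonneg (hb0 k)]
  have hfp : ∀ k, IsPositiveMultiplier (f k) := fun k =>
    (IsPositiveMultiplier.const (hb0 k)).mul ((IsPositiveMultiplier.phase (-h)).pow (k + 1))
  have hg : IsPositiveMultiplier fun ξ =>
      phase h ξ * (1 - r * phase (-h) ξ) ^ (a : ℂ) - phase h ξ + a * r := by
    refine IsPositiveMultiplier.of_tendsto (fun N => IsPositiveMultiplier.sum hfp N)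
      (C := (1 - r) ^ a - 1 + a * r) (fun N ξ => ?_) (fun ξ => (hf ξ).tendsto_sum_nat)
    refine (norm_sum_le _ _).trans ?_
    simp only [hfn]
    exact sum_le_hasSum _ (fun k _ => hb0 k) hreal
  have hgn : ∀ ξ, ‖phase h ξ * (1 - r * phase (-h) ξ) ^ (a : ℂ) - phase h ξ + a * r‖ ≤
      (1 - r) ^ a - 1 + a * r := fun ξ => by
    rw [← (hf ξ).tsum_eq, ← hreal.tsum_eq]
    simp only [← fun k => hfn k ξ]
    exact norm_tsum_le_tsum_norm (by simpa only [hfn] using hreal.summable)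
  constructor
  -- The constant `-a r` is split off as the positive factor `exp(-s a r)`; what remains in the
  -- exponent is a positive multiplier.
  · have h4 := (IsPositiveMultiplier.const (Real.exp_pos (-(s * (a * r)))).le).mul
      (((IsPositiveMultiplier.const hs).mul (hg.add (IsPositiveMultiplier.phase h))).exp)
    convert h4 using 2 with ξ
    push_cast
    rw [← Complex.exp_add]
    congr 1; ring
  · intro ξ
    rw [Complex.norm_exp, Complex.re_ofReal_mul]
    refine Real.exp_le_exp.mpr (mul_le_mul_of_nonneg_left ?_ hs)
    -- The tail has real part at most `(1-r)^a - 1 + a r` and the phase at most `1`; after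
    -- subtracting `a r` exactly `(1-r)^a` is left.
    have h5 := (Complex.re_le_norm _).trans (hgn ξ)
    have h6 := (Complex.re_le_norm _).trans (norm_phase h ξ).le
    rw [Complex.add_re, Complex.sub_re, ← Complex.ofReal_mul, Complex.ofReal_re] at h5
    linarith

/-- The quotient is the backward difference quotient of the phase plus a correction of size `h`
caused by the factor `1 - h²`. -/
lemma tendsto_difference_symbol (ξ : ℝ) {h : ℕ → ℝ} (hh : ∀ n, 0 < h n)
    (hlim : Tendsto h atTop (𝓝 0)) :
    Tendsto (fun n => (1 - ((1 - h n ^ 2 : ℝ) : ℂ) * phase (-h n) ξ) / h n) atTop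
      (𝓝 (Complex.I * ξ)) := by
  have h1 : HasDerivAt (fun y => phase y ξ) (Complex.I * ξ) 0 := by
    simpa [phase] using hasDerivAt_phase_left 0 ξ
  have h2 : Tendsto (fun n => -h n) atTop (𝓝[≠] 0) :=
    tendsto_nhdsWithin_iff.mpr ⟨by simpa using hlim.neg,
      .of_forall fun n => by simpa using (hh n).ne'⟩
  have h3 := (hasDerivAt_iff_tendsto_slope.mp h1).comp h2
  have hc : Continuous fun y : ℝ => (y : ℂ) * phase (-y) ξ := by unfold phase; fun_prop
  have h4 : Tendsto (fun n => (h n : ℂ) * phase (-h n) ξ) atTop (𝓝 0) := by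
    simpa [Function.comp_def] using (hc.tendsto 0).comp hlim
  have h5 := h3.add h4
  rw [add_zero] at h5
  refine h5.congr fun n => ?_
  have hn : (h n : ℂ) ≠ 0 := by exact_mod_cast (hh n).ne'
  have hp0 : phase 0 ξ = 1 := by simp [phase]
  simp only [Function.comp, slope, vsub_eq_sub, sub_zero, hp0, Complex.real_smul]
  push_cast
  field_simp
  ring

lemma cpow_ofReal_mul {r : ℝ} (hr : 0 < r) {z : ℂ} (hz : z ≠ 0) (a : ℝ) :
    ((r : ℂ) * z) ^ (a : ℂ) = ((r ^ a : ℝ) : ℂ) * z ^ (a : ℂ) := by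
  have hr' : (r : ℂ) ≠ 0 := by exact_mod_cast hr.ne'
  rw [Complex.cpow_def_of_ne_zero (mul_ne_zero hr' hz), Complex.log_ofReal_mul hr hz, add_mul,
    Complex.exp_add, ← Complex.cpow_def_of_ne_zero hz, Complex.ofReal_log hr.le,
    ← Complex.cpow_def_of_ne_zero hr', Complex.ofReal_cpow hr.le]

/-- The symbol is the limit of `phase h * ((1 - r phase(-h))/h)^(α+1)` with `r = 1 - h²`. Taking `r
< 1` keeps the base of the power off zero and inside the disc of convergence. -/
lemma isPositiveMultiplier_multiplier {α : ℝ} (hα : 0 < α) (hα' : α < 1) {t : ℝ} (ht : 0 < t) :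
    IsPositiveMultiplier (multiplier α t) := by
  set a := α + 1 with ha
  set h : ℕ → ℝ := fun n => 1 / ((n : ℝ) + 2) with hh
  have h0 : ∀ n, 0 < h n := fun n => by simp only [hh]; positivity
  have h1 : ∀ n, h n < 1 := fun n => by
    simp only [hh]; rw [div_lt_one (by positivity)]
    have : (0 : ℝ) ≤ n := n.cast_nonneg
    linarith
  have hlim : Tendsto h atTop (𝓝 0) := by
    have := (tendsto_one_div_add_atTop_nhds_zero_nat (𝕜 := ℝ)).comp (tendsto_add_atTop_nat 1)
    refine this.congr fun n => ?_
    simp only [hh, Function.comp]; push_cast; ring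
  have hr : ∀ n, 0 < 1 - h n ^ 2 := fun n => by nlinarith [h0 n, h1 n]
  have hr' : ∀ n, 1 - h n ^ 2 < 1 := fun n => by nlinarith [h0 n, h1 n]
  have hs : ∀ n, 0 ≤ t * (h n)⁻¹ ^ a := fun n =>
    mul_nonneg ht.le (Real.rpow_nonneg (inv_pos.mpr (h0 n)).le _)
  have key := fun n => isPositiveMultiplier_exp_one_sub_cpow (a := a) (by linarith) (by linarith)
    (hs n) (hr n) (hr' n) (h n)
  refine IsPositiveMultiplier.of_tendsto (fun n => (key n).1) (C := Real.exp t)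
    (fun n ξ => ((key n).2 ξ).trans (Real.exp_le_exp.mpr ?_)) (fun ξ => ?_)
  -- With `1 - r = h²` the bound on the exponent is `t (h²/h)^a = t h^a ≤ t`, uniform in `n`.
  · rw [mul_assoc, ← Real.mul_rpow (inv_pos.mpr (h0 n)).le (by linarith [hr' n])]
    have h3 : (h n)⁻¹ * (1 - (1 - h n ^ 2)) = h n := by
      have := (h0 n).ne'
      field_simp; ring
    rw [h3]
    exact mul_le_of_le_one_right ht.le (Real.rpow_le_one (h0 n).le (h1 n).le (by linarith))
  · have h3 : ∀ n, (((t * (h n)⁻¹ ^ a : ℝ)) : ℂ) * (phase (h n) ξ *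
        (1 - ((1 - h n ^ 2 : ℝ) : ℂ) * phase (-h n) ξ) ^ (a : ℂ)) = t * (phase (h n) ξ *
        ((1 - ((1 - h n ^ 2 : ℝ) : ℂ) * phase (-h n) ξ) / h n) ^ (a : ℂ)) := fun n => by
      have hz : (1 - ((1 - h n ^ 2 : ℝ) : ℂ) * phase (-h n) ξ) ≠ 0 := by
        intro h4
        have h5 : ‖((1 - h n ^ 2 : ℝ) : ℂ) * phase (-h n) ξ‖ = 1 := by
          rw [← sub_eq_zero.mp h4, norm_one]
        rw [norm_mul, norm_phase, mul_one, Complex.norm_real, Real.norm_of_nonneg (hr n).le] at h5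
        linarith [hr' n]
      rw [div_eq_inv_mul, ← Complex.ofReal_inv, cpow_ofReal_mul (inv_pos.mpr (h0 n)) hz]
      push_cast; ring
    simp only [h3]
    have h4 := tendsto_difference_symbol ξ h0 hlim
    -- The power is continuous on the closed right half plane including `0`, so `ξ = 0` needs no
    -- separate treatment.
    have h5 : ContinuousAt (fun z : ℂ => z ^ (a : ℂ)) (Complex.I * ξ) :=
      Complex.continuousAt_cpow_const_of_re_pos (by simp) (by simp [ha]; linarith)
    have hc : Continuous fun y : ℝ => phase y ξ := by unfold phase; fun_prop
    have h6 : Tendsto (fun n => phase (h n) ξ) atTop (𝓝 1) := by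
      have := (hc.tendsto 0).comp hlim
      simpa [phase, Function.comp_def] using this
    have h7 := (h6.mul (h5.tendsto.comp h4)).const_mul (t : ℂ)
    have h8 := (Complex.continuous_exp.tendsto _).comp h7
    rw [multiplier, symbol_eq]
    simpa [Function.comp_def, ha] using h8

lemma hasNonnegTransform_gaussian {δ : ℝ} (hδ : 0 < δ) :
    HasNonnegTransform fun ξ => Complex.exp (-(δ : ℂ) * (ξ : ℂ) ^ 2) := by
  have hδ' : 0 < (δ : ℂ).re := by simpa using hδ
  refine ⟨integrable_cexp_neg_mul_sq hδ', fun x => ?_⟩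
  have h := fourierIntegral_gaussian hδ' (x : ℂ)
  have h1 : ∫ ξ : ℝ, Complex.exp (-(δ : ℂ) * (ξ : ℂ) ^ 2) * phase x ξ =
      (((Real.pi / δ) ^ (1 / 2 : ℝ) * Real.exp (-x ^ 2 / (4 * δ)) : ℝ) : ℂ) := by
    rw [Complex.ofReal_mul, Complex.ofReal_cpow (by positivity)]
    push_cast
    rw [← h]
    refine integral_congr_ae (ae_of_all _ fun ξ => ?_)
    simp only [phase]; rw [mul_comm]
  rw [h1, Complex.ofReal_re]
  positivity

/-- Gaussians have positive transforms, hence so do their products with the multiplier; letting the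
Gaussians tend to `1` recovers the kernel. -/
lemma kernel_nonneg {α : ℝ} (hα : 0 < α) (hα' : α < 1) {t : ℝ} (ht : 0 < t) (x : ℝ) :
    0 ≤ kernel α t x := by
  have hM := isPositiveMultiplier_multiplier hα hα' ht
  have hi := integrable_multiplier hα hα' ht
  have hlim : Tendsto (fun n : ℕ => ∫ ξ : ℝ, multiplier α t ξ *
      Complex.exp (-((1 / ((n : ℝ) + 1) : ℝ) : ℂ) * (ξ : ℂ) ^ 2) * phase x ξ) atTop
      (𝓝 (∫ ξ, multiplier α t ξ * phase x ξ)) := by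
    have hG := fun n : ℕ => hasNonnegTransform_gaussian (δ := 1 / ((n : ℝ) + 1)) (by positivity)
    refine tendsto_integral_of_dominated_convergence (fun ξ => ‖multiplier α t ξ‖)
      (fun n => (integrable_mul_phase (hM.2.2 _ (hG n)).1 x).aestronglyMeasurable) hi.norm
      (fun n => ae_of_all _ fun ξ => ?_) (ae_of_all _ fun ξ => ?_)
    · rw [norm_mul, norm_mul, norm_phase, mul_one]
      refine mul_le_of_le_one_right (norm_nonneg _) ?_
      rw [Complex.norm_exp, ← Complex.ofReal_pow, ← Complex.ofReal_neg, ← Complex.ofReal_mul,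
        Complex.ofReal_re]
      refine Real.exp_le_one_iff.mpr (mul_nonpos_of_nonpos_of_nonneg ?_ (sq_nonneg ξ))
      exact neg_nonpos.mpr (by positivity)
    · have h1 := tendsto_one_div_add_atTop_nhds_zero_nat (𝕜 := ℝ)
      have hc : Continuous fun y : ℝ => multiplier α t ξ * Complex.exp (-(y : ℂ) * (ξ : ℂ) ^ 2) *
        phase x ξ := by fun_prop
      simpa [Function.comp_def] using (hc.tendsto 0).comp h1
  rw [kernel_eq]
  refine mul_nonneg (by positivity) (ge_of_tendsto ((Complex.continuous_re.tendsto _).comp hlim)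
    (.of_forall fun n => ?_))
  exact (hM.2.2 _ (hasNonnegTransform_gaussian (by positivity))).2 x

/-! ### Smoothing kernels -/

/-- A Markovian convolution semigroup with densities `K t`, `t > 0`, whose spatial derivatives `D t`
have `L¹` norm at most `C t^(-b)` with `b < 1`. Both are extended by `0` to `t ≤ 0`. -/
structure IsSmoothingKernel (b C : ℝ) (K D : ℝ → ℝ → ℝ) : Prop where
  exponent_pos : 0 < b
  exponent_lt_one : b < 1
  measurable : Measurable (Function.uncurry K)
  measurable_deriv : Measurable (Function.uncurry D)
  eq_zero : ∀ t x, t ≤ 0 → K t x = 0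
  deriv_eq_zero : ∀ t x, t ≤ 0 → D t x = 0
  nonneg : ∀ t x, 0 ≤ K t x
  integrable : ∀ t, Integrable (K t)
  integral_eq_one : ∀ t, 0 < t → ∫ x, K t x = 1
  integrable_deriv : ∀ t, Integrable (D t)
  integral_abs_deriv_le : ∀ t, 0 < t → ∫ x, |D t x| ≤ C * t ^ (-b)
  hasDerivAt : ∀ t x, HasDerivAt (K t) (D t x) x
  continuous_deriv : ∀ t, Continuous (D t)
  semigroup : ∀ s t x, 0 < s → 0 < t → ∫ y, K s y * K t (x - y) = K (s + t) x
  semigroup_deriv : ∀ s t x, 0 < s → 0 < t → ∫ y, K s y * D t (x - y) = D (s + t) x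
  tendsto_integral_abs_sub : ∀ t, 0 < t →
    Tendsto (fun s => ∫ x, |K s x - K t x|) (𝓝 t) (𝓝 0)
  tendsto_integral_abs_deriv_sub : ∀ t, 0 < t →
    Tendsto (fun s => ∫ x, |D s x - D t x|) (𝓝 t) (𝓝 0)
  tendsto_integral_mul : ∀ w : ℝ → ℝ, Continuous w → (∃ B, ∀ x, |w x| ≤ B) →
    Tendsto (fun t => ∫ x, K t x * w x) (𝓝[>] 0) (𝓝 (w 0))

/-- Dominated convergence with `r` confined to `(r₀/2, 2 r₀)`. The exponent `j` is `1` for the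
kernel and `2` for its derivative. -/
lemma tendsto_integral_abs_dilation_sub {k : ℝ → ℝ} (hk : Continuous k) {C : ℝ}
    (hC : ∀ x, |k x| ≤ C * (1 + x ^ 2)⁻¹) (j : ℕ) {r₀ : ℝ} (hr₀ : 0 < r₀) :
    Tendsto (fun r => ∫ x, |r ^ j * k (r * x) - r₀ ^ j * k (r₀ * x)|) (𝓝 r₀) (𝓝 0) := by
  have hC0 : 0 ≤ C := by simpa using (abs_nonneg _).trans (hC 0)
  have hb : ∀ r, r₀ / 2 < r → r < 2 * r₀ → ∀ x,
      |r ^ j * k (r * x)| ≤ (2 * r₀) ^ j * C * (1 + (r₀ / 2 * x) ^ 2)⁻¹ := by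
    intro r h1 h2 x
    have hr : 0 < r := by linarith
    rw [abs_mul, abs_of_pos (pow_pos hr j), mul_assoc]
    refine mul_le_mul (pow_le_pow_left₀ hr.le h2.le j) ((hC _).trans ?_) (abs_nonneg _)
      (by positivity)
    have h3 : (r₀ / 2 * x) ^ 2 ≤ (r * x) ^ 2 := by
      rw [mul_pow, mul_pow]; gcongr
    gcongr
  have hi : Integrable fun x : ℝ => (2 * r₀) ^ j * C * (1 + (r₀ / 2 * x) ^ 2)⁻¹ :=
    (integrable_inv_one_add_sq.comp_mul_left' (by positivity)).const_mul _
  have h := tendsto_integral_filter_of_dominated_convergence (μ := volume) (l := 𝓝 r₀)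
    (F := fun r x => |r ^ j * k (r * x) - r₀ ^ j * k (r₀ * x)|) (f := fun _ => (0 : ℝ))
    (fun x => 2 * ((2 * r₀) ^ j * C * (1 + (r₀ / 2 * x) ^ 2)⁻¹))
    (.of_forall fun r => by fun_prop) ?_ (hi.const_mul 2) (ae_of_all _ fun x => ?_)
  · simpa using h
  · filter_upwards [eventually_gt_nhds (show r₀ / 2 < r₀ by linarith),
      eventually_lt_nhds (show r₀ < 2 * r₀ by linarith)] with r h1 h2
    refine ae_of_all _ fun x => ?_
    rw [Real.norm_eq_abs, abs_abs, two_mul]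
    exact (abs_sub _ _).trans (add_le_add (hb r h1 h2 x) (hb r₀ (by linarith) (by linarith) x))
  · have hc : Continuous fun r => |r ^ j * k (r * x) - r₀ ^ j * k (r₀ * x)| := by fun_prop
    simpa using hc.tendsto r₀

/-- The kernel, extended by `0` to `t ≤ 0`. -/
def heatKernel (α t x : ℝ) : ℝ := if 0 < t then kernel α t x else 0

/-- The spatial derivative of the kernel, extended by `0` to `t ≤ 0`. -/
def heatKernelDx (α t x : ℝ) : ℝ := if 0 < t then kernelDx α t x else 0

lemma heatKernel_of_pos (α : ℝ) {t : ℝ} (ht : 0 < t) : heatKernel α t = kernel α t := by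
  funext x; simp [heatKernel, ht]

lemma heatKernelDx_of_pos (α : ℝ) {t : ℝ} (ht : 0 < t) : heatKernelDx α t = kernelDx α t := by
  funext x; simp [heatKernelDx, ht]

lemma heatKernel_of_nonpos (α : ℝ) {t : ℝ} (ht : t ≤ 0) : heatKernel α t = fun _ => 0 := by
  funext x; simp [heatKernel, not_lt.mpr ht]

lemma heatKernelDx_of_nonpos (α : ℝ) {t : ℝ} (ht : t ≤ 0) : heatKernelDx α t = fun _ => 0 := by
  funext x; simp [heatKernelDx, not_lt.mpr ht]

lemma continuousAt_rpow_neg (b : ℝ) {t : ℝ} (ht : 0 < t) : ContinuousAt (fun s : ℝ => s ^ (-b)) t :=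
  Real.continuousAt_rpow_const _ _ (Or.inl ht.ne')

/-- Scaling reduces every quantitative field to time one. The exponent `1/(α+1)` is below one
precisely because `α > 0`. -/
lemma isSmoothingKernel {α : ℝ} (hα : 0 < α) (hα' : α < 1) :
    IsSmoothingKernel (1 / (α + 1)) (∫ x, |kernelDx α 1 x|) (heatKernel α) (heatKernelDx α) where
  exponent_pos := by positivity
  exponent_lt_one := by rw [div_lt_one (by positivity)]; linarith
  measurable := by
    have h : Measurable fun p : ℝ × ℝ => p.1 ^ (-(1 / (α + 1))) *
        kernel α 1 (p.1 ^ (-(1 / (α + 1))) * p.2) := by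
      have h0 : Measurable fun p : ℝ × ℝ => p.1 ^ (-(1 / (α + 1))) := by fun_prop
      exact h0.mul ((continuous_kernel hα hα' one_pos).measurable.comp (h0.mul measurable_snd))
    convert h.indicator (measurableSet_lt measurable_const measurable_fst :
      MeasurableSet {p : ℝ × ℝ | 0 < p.1}) using 1
    funext p
    simp only [Function.uncurry, heatKernel, Set.indicator, Set.mem_ofPred_eq]
    split_ifs with h
    · exact kernel_scaling hα h _
    · rfl
  measurable_deriv := by
    have h : Measurable fun p : ℝ × ℝ => p.1 ^ (-(1 / (α + 1))) * (p.1 ^ (-(1 / (α + 1))) *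
        kernelDx α 1 (p.1 ^ (-(1 / (α + 1))) * p.2)) := by
      have h0 : Measurable fun p : ℝ × ℝ => p.1 ^ (-(1 / (α + 1))) := by fun_prop
      exact h0.mul (h0.mul
        ((continuous_kernelDx hα hα' one_pos).measurable.comp (h0.mul measurable_snd)))
    convert h.indicator (measurableSet_lt measurable_const measurable_fst :
      MeasurableSet {p : ℝ × ℝ | 0 < p.1}) using 1
    funext p
    simp only [Function.uncurry, heatKernelDx, Set.indicator, Set.mem_ofPred_eq]
    split_ifs with h
    · exact kernelDx_scaling hα h _
    · rfl
  eq_zero t x ht := by rw [heatKernel_of_nonpos α ht]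
  deriv_eq_zero t x ht := by rw [heatKernelDx_of_nonpos α ht]
  nonneg t x := by
    by_cases h : 0 < t
    · rw [heatKernel_of_pos α h]; exact kernel_nonneg hα hα' h x
    · rw [heatKernel_of_nonpos α (not_lt.mp h)]
  integrable t := by
    by_cases h : 0 < t
    · rw [heatKernel_of_pos α h]; exact integrable_kernel hα hα' h
    · rw [heatKernel_of_nonpos α (not_lt.mp h)]; exact integrable_zero _ _ _
  integral_eq_one t ht := by rw [heatKernel_of_pos α ht]; exact integral_kernel hα hα' ht
  integrable_deriv t := by
    by_cases h : 0 < t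
    · rw [heatKernelDx_of_pos α h]; exact integrable_kernelDx hα hα' h
    · rw [heatKernelDx_of_nonpos α (not_lt.mp h)]; exact integrable_zero _ _ _
  integral_abs_deriv_le t ht := by
    rw [heatKernelDx_of_pos α ht]
    have hr : 0 < t ^ (-(1 / (α + 1))) := Real.rpow_pos_of_pos ht _
    simp only [kernelDx_scaling hα ht, abs_mul, abs_of_pos hr]
    rw [integral_const_mul, integral_const_mul,
      Measure.integral_comp_mul_left (fun x => |kernelDx α 1 x|), abs_of_pos (inv_pos.mpr hr),
      smul_eq_mul, ← mul_assoc (t ^ _) (t ^ _)⁻¹, mul_inv_cancel₀ hr.ne', one_mul, mul_comm]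
  hasDerivAt t x := by
    by_cases h : 0 < t
    · rw [heatKernel_of_pos α h, heatKernelDx_of_pos α h]; exact hasDerivAt_kernel' hα hα' h x
    · rw [heatKernel_of_nonpos α (not_lt.mp h), heatKernelDx_of_nonpos α (not_lt.mp h)]
      exact hasDerivAt_const x 0
  continuous_deriv t := by
    by_cases h : 0 < t
    · rw [heatKernelDx_of_pos α h]; exact continuous_kernelDx hα hα' h
    · rw [heatKernelDx_of_nonpos α (not_lt.mp h)]; exact continuous_const
  semigroup s t x hs ht := by
    rw [heatKernel_of_pos α hs, heatKernel_of_pos α ht, heatKernel_of_pos α (add_pos hs ht)]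
    exact kernel_semigroup hα hα' hs ht x
  semigroup_deriv s t x hs ht := by
    rw [heatKernel_of_pos α hs, heatKernelDx_of_pos α ht, heatKernelDx_of_pos α (add_pos hs ht)]
    exact kernelDx_semigroup hα hα' hs ht x
  tendsto_integral_abs_sub t ht := by
    obtain ⟨C, -, hC⟩ := abs_kernel_one_le hα hα'
    have h := (tendsto_integral_abs_dilation_sub (continuous_kernel hα hα' one_pos) hC 1
      (Real.rpow_pos_of_pos ht (-(1 / (α + 1))))).comp (continuousAt_rpow_neg _ ht)
    refine h.congr' ?_
    filter_upwards [eventually_gt_nhds ht] with s hs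
    rw [heatKernel_of_pos α hs, heatKernel_of_pos α ht]
    simp only [Function.comp, pow_one, ← kernel_scaling hα hs, ← kernel_scaling hα ht]
  tendsto_integral_abs_deriv_sub t ht := by
    obtain ⟨C, -, hC⟩ := abs_kernelDx_one_le hα hα'
    have h := (tendsto_integral_abs_dilation_sub (continuous_kernelDx hα hα' one_pos) hC 2
      (Real.rpow_pos_of_pos ht (-(1 / (α + 1))))).comp (continuousAt_rpow_neg _ ht)
    refine h.congr' ?_
    filter_upwards [eventually_gt_nhds ht] with s hs
    rw [heatKernelDx_of_pos α hs, heatKernelDx_of_pos α ht]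
    simp only [Function.comp, pow_two, mul_assoc, ← kernelDx_scaling hα hs,
      ← kernelDx_scaling hα ht]
  tendsto_integral_mul w hw := by
    rintro ⟨B, hB⟩
    have hi := integrable_kernel hα hα' one_pos
    have h1 : Tendsto (fun t : ℝ => (t ^ (-(1 / (α + 1))))⁻¹) (𝓝[>] 0) (𝓝 0) := by
      have hc : Continuous fun t : ℝ => t ^ (1 / (α + 1)) :=
        Real.continuous_rpow_const (by positivity)
      have h2 : Tendsto (fun t : ℝ => t ^ (1 / (α + 1))) (𝓝[>] 0) (𝓝 0) := by
        have := (hc.tendsto 0).mono_left (nhdsWithin_le_nhds (s := Set.Ioi 0))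
        rwa [Real.zero_rpow (by positivity)] at this
      refine h2.congr' ?_
      filter_upwards [self_mem_nhdsWithin] with t ht
      rw [Real.rpow_neg (le_of_lt ht), inv_inv]
    -- In the rescaled variable the density is fixed and only the test function is contracted
    -- towards its value at `0`.
    have h3 : Tendsto (fun t : ℝ => ∫ y, kernel α 1 y * w ((t ^ (-(1 / (α + 1))))⁻¹ * y)) (𝓝[>] 0)
        (𝓝 (∫ y, kernel α 1 y * w 0)) := by
      refine tendsto_integral_filter_of_dominated_convergence (fun y => |kernel α 1 y| * B)
        (.of_forall fun t => hi.aestronglyMeasurable.mul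
          (hw.comp (continuous_const.mul continuous_id)).aestronglyMeasurable)
        (.of_forall fun t => ae_of_all _ fun y => ?_) (hi.abs.mul_const B)
        (ae_of_all _ fun y => ?_)
      · rw [norm_mul]
        exact mul_le_mul_of_nonneg_left (hB _) (norm_nonneg _)
      · have h4 := (hw.tendsto _).comp (h1.mul_const y)
        rw [zero_mul] at h4
        exact h4.const_mul _
    rw [integral_mul_const, integral_kernel hα hα' one_pos, one_mul] at h3
    refine h3.congr' ?_
    filter_upwards [self_mem_nhdsWithin] with t ht
    have ht : 0 < t := ht
    rw [heatKernel_of_pos α ht]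
    have hr : 0 < t ^ (-(1 / (α + 1))) := Real.rpow_pos_of_pos ht _
    have h5 := Measure.integral_comp_mul_left
      (fun y => kernel α 1 y * w ((t ^ (-(1 / (α + 1))))⁻¹ * y)) (t ^ (-(1 / (α + 1))))
    rw [abs_of_pos (inv_pos.mpr hr), smul_eq_mul, eq_inv_mul_iff_mul_eq₀ hr.ne',
      ← integral_const_mul] at h5
    rw [← h5]
    refine integral_congr_ae (ae_of_all _ fun x => ?_)
    simp only
    rw [← mul_assoc, ← kernel_scaling hα ht, inv_mul_cancel_left₀ hr.ne']

/-! ### Translations in `L¹` -/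

/-- Translations act continuously on `L¹`. The space is kept general because both the line and
space-time are needed. -/
lemma tendsto_integral_abs_translate_sub {V : Type*} [NormedAddCommGroup V] [NormedSpace ℝ V]
    [FiniteDimensional ℝ V] [MeasurableSpace V] [BorelSpace V] (μ : Measure V) [μ.IsAddHaarMeasure]
    {F : V → ℝ} (hF : Integrable F μ) :
    Tendsto (fun r => ∫ q, |F (r + q) - F q| ∂μ) (𝓝 0) (𝓝 0) := by
  have hF1 : MemLp F 1 μ := memLp_one_iff_integrable.mpr hF
  have : Fact ((1 : ENNReal) ≠ ⊤) := ⟨ENNReal.one_ne_top⟩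
  have hc : Continuous fun r : V => ‖(DomAddAct.mk r +ᵥ hF1.toLp F) - hF1.toLp F‖ := by
    have : Continuous fun r : V => (DomAddAct.mk r +ᵥ hF1.toLp F) :=
      (DomAddAct.continuous_mk).vadd continuous_const
    fun_prop
  have h0 := hc.tendsto 0
  simp only [DomAddAct.mk_zero, zero_vadd, sub_self, norm_zero] at h0
  refine h0.congr fun r => ?_
  rw [DomAddAct.mk_vadd_toLp, L1.norm_eq_integral_norm]
  refine integral_congr_ae ?_
  have h1 := (hF1.comp_measurePreserving (measurePreserving_vadd r μ)).coeFn_toLp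
  filter_upwards [h1, hF1.coeFn_toLp, Lp.coeFn_sub
    ((hF1.comp_measurePreserving (measurePreserving_vadd r μ)).toLp _) (hF1.toLp F)]
    with q h2 h3 h4
  rw [Pi.sub_apply, h2, h3] at h4
  exact congrArg norm h4

/-! ### Space-time convolutions with exponential weights -/

/-- The convolution of two functions on space-time. -/
def stConv (A g : ℝ × ℝ → ℝ) (p : ℝ × ℝ) : ℝ := ∫ q, A (p - q) * g q

/-- The weighted norm `∫ exp (-l t) |A (t, x)|`. -/
def weightedNorm (l : ℝ) (A : ℝ × ℝ → ℝ) : ℝ := ∫ q, Real.exp (-(l * q.1)) * |A q|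

/-- Integrability with respect to the weight `exp (-l t)`. -/
def WeightedIntegrable (l : ℝ) (A : ℝ × ℝ → ℝ) : Prop :=
  Integrable fun q : ℝ × ℝ => Real.exp (-(l * q.1)) * A q

lemma weightedNorm_nonneg (l : ℝ) (A : ℝ × ℝ → ℝ) : 0 ≤ weightedNorm l A :=
  integral_nonneg fun q => by positivity

lemma WeightedIntegrable.abs {l : ℝ} {A : ℝ × ℝ → ℝ} (hA : WeightedIntegrable l A) :
    Integrable fun q : ℝ × ℝ => Real.exp (-(l * q.1)) * |A q| :=
  (Integrable.abs hA).congr (ae_of_all _ fun q => by simp [abs_mul])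

lemma WeightedIntegrable.sub {l : ℝ} {A A' : ℝ × ℝ → ℝ} (hA : WeightedIntegrable l A)
    (hA' : WeightedIntegrable l A') : WeightedIntegrable l fun q => A q - A' q :=
  (Integrable.sub hA hA').congr (ae_of_all _ fun q => by simp [mul_sub])

section Weighted

variable {l : ℝ} {A g : ℝ × ℝ → ℝ} {B : ℝ}

/-- The weight is multiplicative along `p = (p - q) + q`, so weighting both factors weights the
convolution. -/
lemma weighted_split (l : ℝ) (A g : ℝ × ℝ → ℝ) (p q : ℝ × ℝ) :
    A (p - q) * g q = Real.exp (l * p.1) * ((Real.exp (-(l * (p - q).1)) * A (p - q)) *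
      (Real.exp (-(l * q.1)) * g q)) := by
  have h : Real.exp (l * p.1) * Real.exp (-(l * (p - q).1)) * Real.exp (-(l * q.1)) = 1 := by
    rw [← Real.exp_add, ← Real.exp_add, ← Real.exp_zero]
    congr 1
    rw [Prod.fst_sub]; ring
  linear_combination (-(A (p - q) * g q)) * h

lemma abs_weighted_le (hB : ∀ q, |g q| ≤ B * Real.exp (l * q.1)) (q : ℝ × ℝ) :
    |Real.exp (-(l * q.1)) * g q| ≤ B := by
  rw [abs_mul, abs_of_pos (Real.exp_pos _), Real.exp_neg, inv_mul_le_iff₀ (Real.exp_pos _),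
    mul_comm]
  exact hB q

lemma measurable_weighted (hg : Measurable g) :
    Measurable fun q : ℝ × ℝ => Real.exp (-(l * q.1)) * g q :=
  (by fun_prop : Measurable fun q : ℝ × ℝ => Real.exp (-(l * q.1))).mul hg

lemma integrable_stConv_weighted (hA : WeightedIntegrable l A) (hg : Measurable g)
    (hB : ∀ q, |g q| ≤ B * Real.exp (l * q.1)) (p : ℝ × ℝ) :
    Integrable fun q => (Real.exp (-(l * (p - q).1)) * A (p - q)) *
      (Real.exp (-(l * q.1)) * g q) :=
  (Integrable.comp_sub_left hA p).mul_bdd (c := B) (measurable_weighted hg).aestronglyMeasurable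
    (ae_of_all _ (abs_weighted_le hB))

lemma integrable_stConv (hA : WeightedIntegrable l A) (hg : Measurable g)
    (hB : ∀ q, |g q| ≤ B * Real.exp (l * q.1)) (p : ℝ × ℝ) :
    Integrable fun q => A (p - q) * g q := by
  rw [funext (weighted_split l A g p)]
  exact (integrable_stConv_weighted hA hg hB p).const_mul _

lemma stConv_eq_weighted (l : ℝ) (A g : ℝ × ℝ → ℝ) (p : ℝ × ℝ) :
    Real.exp (-(l * p.1)) * stConv A g p = ∫ q, (Real.exp (-(l * (p - q).1)) * A (p - q)) *
      (Real.exp (-(l * q.1)) * g q) := by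
  rw [stConv, funext (weighted_split l A g p), integral_const_mul, ← mul_assoc, ← Real.exp_add]
  simp

/-- Young's inequality between `L¹` and `L^∞` in the weighted norms: growth `exp(l t)` is preserved,
with the weighted norm of `A` as factor. -/
lemma abs_stConv_le (hA : WeightedIntegrable l A) (hB : ∀ q, |g q| ≤ B * Real.exp (l * q.1))
    (p : ℝ × ℝ) : |stConv A g p| ≤ weightedNorm l A * B * Real.exp (l * p.1) := by
  have h1 : |Real.exp (-(l * p.1)) * stConv A g p| ≤ weightedNorm l A * B := by
    rw [stConv_eq_weighted, weightedNorm,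
      ← integral_sub_left_eq_self (fun q : ℝ × ℝ => Real.exp (-(l * q.1)) * |A q|) volume p,
      ← integral_mul_const, ← Real.norm_eq_abs]
    refine (norm_integral_le_integral_norm _).trans ?_
    refine integral_mono_of_nonneg (ae_of_all _ fun q => norm_nonneg _)
      ((Integrable.comp_sub_left hA.abs p).mul_const B) (ae_of_all _ fun q => ?_)
    simp only [Real.norm_eq_abs]
    rw [abs_mul, abs_mul (Real.exp _) (A _), abs_of_pos (Real.exp_pos _)]
    exact mul_le_mul_of_nonneg_left (abs_weighted_le hB q) (by positivity)
  rw [abs_mul, abs_of_pos (Real.exp_pos _), Real.exp_neg, inv_mul_le_iff₀ (Real.exp_pos _)] at h1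
  linarith

/-- All the regularity comes from continuity of translations of the weighted `A` in `L¹`; `g` need
only be measurable with the growth bound. -/
lemma uniformContinuous_weighted_stConv (hA : WeightedIntegrable l A) (hg : Measurable g)
    (hB : ∀ q, |g q| ≤ B * Real.exp (l * q.1)) :
    UniformContinuous fun p : ℝ × ℝ => Real.exp (-(l * p.1)) * stConv A g p := by
  have hB0 : 0 ≤ B := by
    have := (abs_nonneg _).trans (hB 0)
    simpa using this
  set F : ℝ × ℝ → ℝ := fun q => Real.exp (-(l * q.1)) * A q with hF
  have ht := (tendsto_integral_abs_translate_sub volume hA).mul_const B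
  rw [zero_mul] at ht
  rw [Metric.uniformContinuous_iff]
  intro ε hε
  obtain ⟨δ, hδ, h⟩ := Metric.eventually_nhds_iff.mp (ht.eventually (eventually_lt_nhds hε))
  refine ⟨δ, hδ, fun p p' hp => ?_⟩
  refine lt_of_le_of_lt ?_ (h (y := p - p') (by rwa [dist_eq_norm, sub_zero, ← dist_eq_norm]))
  rw [stConv_eq_weighted, stConv_eq_weighted, dist_eq_norm,
    ← integral_sub (integrable_stConv_weighted hA hg hB p) (integrable_stConv_weighted hA hg hB p'),
    ← integral_sub_left_eq_self (fun q => |F (p - p' + q) - F q|) volume p', ← integral_mul_const]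
  refine (norm_integral_le_integral_norm _).trans ?_
  have hFi : Integrable F := hA
  refine integral_mono_of_nonneg (ae_of_all _ fun q => norm_nonneg _)
    ((((hFi.comp_add_left (p - p')).sub hFi).abs.comp_sub_left p').mul_const B)
    (ae_of_all _ fun q => ?_)
  have e : p - p' + (p' - q) = p - q := by abel
  simp only [e, ← sub_mul, Real.norm_eq_abs, hF]
  rw [abs_mul]
  exact mul_le_mul_of_nonneg_left (abs_weighted_le hB q) (abs_nonneg _)

lemma continuous_stConv (hA : WeightedIntegrable l A) (hg : Measurable g)
    (hB : ∀ q, |g q| ≤ B * Real.exp (l * q.1)) : Continuous (stConv A g) := by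
  have h := (uniformContinuous_weighted_stConv hA hg hB).continuous
  have h1 : Continuous fun p : ℝ × ℝ => Real.exp (l * p.1) *
    (Real.exp (-(l * p.1)) * stConv A g p) := by fun_prop
  convert h1 using 1
  funext p
  rw [← mul_assoc, ← Real.exp_add]; simp

lemma tendstoUniformly_stConv (hA : WeightedIntegrable l A) (hg : Measurable g)
    (hB : ∀ q, |g q| ≤ B * Real.exp (l * q.1)) (t : ℝ) :
    TendstoUniformly (fun s x => stConv A g (s, x)) (fun x => stConv A g (t, x)) (𝓝 t) := by
  have hu := uniformContinuous_weighted_stConv hA hg hB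
  rw [Metric.tendstoUniformly_iff]
  intro ε hε
  set W : ℝ × ℝ → ℝ := fun p => Real.exp (-(l * p.1)) * stConv A g p with hW
  have hWe : ∀ p : ℝ × ℝ, stConv A g p = Real.exp (l * p.1) * W p := fun p => by
    rw [hW, ← mul_assoc, ← Real.exp_add]; simp
  set M := weightedNorm l A * B with hM
  have hWb : ∀ p, |W p| ≤ M := fun p => abs_weighted_le (fun q => abs_stConv_le hA hB q) p
  have hM0 : 0 ≤ M := (abs_nonneg _).trans (hWb 0)
  obtain ⟨δ, hδ, h⟩ := Metric.uniformContinuous_iff.mp hu (ε / (2 * Real.exp (l * t)))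
    (by positivity)
  have he : Tendsto (fun s => |Real.exp (l * t) - Real.exp (l * s)| * M) (𝓝 t) (𝓝 0) := by
    have hc : Continuous fun s => |Real.exp (l * t) - Real.exp (l * s)| * M := by fun_prop
    simpa using hc.tendsto t
  filter_upwards [Metric.ball_mem_nhds t hδ, he.eventually (eventually_lt_nhds (half_pos hε))]
    with s hs hs2 x
  have h1 := h (a := (t, x)) (b := (s, x)) (by
    rw [Prod.dist_eq]; simpa [dist_comm] using hs)
  rw [Real.dist_eq] at h1 ⊢
  rw [hWe, hWe]
  have h1' : |W (t, x) - W (s, x)| < ε / (2 * Real.exp (l * t)) := h1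
  have h2 : Real.exp (l * t) * |W (t, x) - W (s, x)| < ε / 2 := by
    rw [lt_div_iff₀ (by positivity)] at h1'
    linarith
  have h3 : Real.exp (l * (t, x).1) * W (t, x) - Real.exp (l * (s, x).1) * W (s, x) =
      Real.exp (l * t) * (W (t, x) - W (s, x)) +
        (Real.exp (l * t) - Real.exp (l * s)) * W (s, x) := by simp only; ring
  rw [h3]
  refine (abs_add_le _ _).trans_lt ?_
  rw [abs_mul, abs_mul, abs_of_pos (Real.exp_pos _)]
  have h4 := mul_le_mul_of_nonneg_left (hWb (s, x))
    (abs_nonneg (Real.exp (l * t) - Real.exp (l * s)))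
  linarith

end Weighted

/-! ### Averages over short segments -/

/-- Fubini exchanges the average over the segment with the `L¹` norm, and each translation by at
most `‖e‖` is `ε`-close. `G` is given through an equation so that difference quotients can be
substituted for it. -/
lemma integral_abs_average_sub_le {V : Type*} [NormedAddCommGroup V] [NormedSpace ℝ V]
    [FiniteDimensional ℝ V] [MeasurableSpace V] [BorelSpace V] (μ : Measure V) [μ.IsAddHaarMeasure]
    {F : V → ℝ} (hF : Integrable F μ) (hFm : Measurable F) {ε : ℝ} (hε : 0 < ε) :
    ∃ δ > 0, ∀ e : V, ‖e‖ < δ → ∀ G : V → ℝ,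
      (∀ q, G q = ∫ θ in (0 : ℝ)..1, (F (q - θ • e) - F q)) → ∫ q, |G q| ∂μ ≤ ε := by
  obtain ⟨δ, hδ, h⟩ := Metric.eventually_nhds_iff.mp
    ((tendsto_integral_abs_translate_sub μ hF).eventually (eventually_lt_nhds hε))
  refine ⟨δ, hδ, fun e he G hG => ?_⟩
  have hs : SecondCountableTopology V := inferInstance
  have hθ : ∀ θ ∈ Set.Ioc (0 : ℝ) 1, ∫⁻ q, ‖F (q - θ • e) - F q‖ₑ ∂μ ≤ ENNReal.ofReal ε := by
    intro θ hθ
    have h1 := h (y := -(θ • e)) (by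
      rw [dist_zero_right, norm_neg, norm_smul, Real.norm_of_nonneg hθ.1.le]
      exact (mul_le_of_le_one_left (norm_nonneg _) hθ.2).trans_lt he)
    have h2 : ∫⁻ q, ‖F (q - θ • e) - F q‖ₑ ∂μ = ENNReal.ofReal (∫ q, |F (-(θ • e) + q) - F q| ∂μ) := by
      have hi : Integrable (fun q => F (-(θ • e) + q) - F q) μ :=
        (hF.comp_add_left (-(θ • e))).sub hF
      have := ofReal_integral_norm_eq_lintegral_enorm hi
      simp only [Real.norm_eq_abs] at this
      rw [this]
      refine lintegral_congr fun q => ?_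
      rw [neg_add_eq_sub]
    rw [h2]
    exact ENNReal.ofReal_le_ofReal h1.le
  have hm : Measurable fun z : V × ℝ => F (z.1 - z.2 • e) - F z.1 := by fun_prop
  have key : ∫⁻ q, ‖G q‖ₑ ∂μ ≤ ENNReal.ofReal ε := calc
    ∫⁻ q, ‖G q‖ₑ ∂μ ≤ ∫⁻ q, (∫⁻ θ in Set.Ioc (0 : ℝ) 1, ‖F (q - θ • e) - F q‖ₑ) ∂μ := by
        refine lintegral_mono fun q => ?_
        rw [hG, intervalIntegral.integral_of_le zero_le_one]
        exact enorm_integral_le_lintegral_enorm _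
    _ = ∫⁻ θ in Set.Ioc (0 : ℝ) 1, (∫⁻ q, ‖F (q - θ • e) - F q‖ₑ ∂μ) :=
        lintegral_lintegral_swap hm.enorm.aemeasurable
    _ ≤ ∫⁻ θ in Set.Ioc (0 : ℝ) 1, ENNReal.ofReal ε :=
        setLIntegral_mono measurable_const hθ
    _ = ENNReal.ofReal ε := by simp
  by_cases hGm : AEStronglyMeasurable G μ
  · have := integral_norm_eq_lintegral_enorm hGm
    simp only [Real.norm_eq_abs] at this
    rw [this]
    exact ENNReal.toReal_le_of_le_ofReal hε.le key
  · rw [integral_undef]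
    · exact hε.le
    · intro hi
      apply hGm
      have hG2 : G = fun q => ∫ θ in Set.Ioc (0 : ℝ) 1, (F (q - θ • e) - F q) := by
        funext q; rw [hG, intervalIntegral.integral_of_le zero_le_one]
      rw [hG2]
      exact (hm.stronglyMeasurable.integral_prod_right' (ν := volume.restrict (Set.Ioc (0 : ℝ) 1)))
        |>.aestronglyMeasurable

/-! ### Weighted norms of smoothing kernels -/

open Function (uncurry)

lemma weightedIntegrable_of_slices {l : ℝ} {A : ℝ → ℝ → ℝ} {a : ℝ → ℝ}
    (hm : Measurable (uncurry A)) (h0 : ∀ t, t ≤ 0 → A t = fun _ => 0)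
    (hA : ∀ t, Integrable (A t)) (ha : ∀ t, 0 < t → ∫ x, |A t x| ≤ a t)
    (hi : IntegrableOn (fun t => Real.exp (-(l * t)) * a t) (Set.Ioi 0)) :
    WeightedIntegrable l (uncurry A) ∧
      weightedNorm l (uncurry A) ≤ ∫ t in Set.Ioi 0, Real.exp (-(l * t)) * a t := by
  have hm1 : Measurable fun q : ℝ × ℝ => Real.exp (-(l * q.1)) * uncurry A q :=
    (by fun_prop : Measurable fun q : ℝ × ℝ => Real.exp (-(l * q.1))).mul hm
  have hi1 := hi.integrable_indicator measurableSet_Ioi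
  have hle : ∀ t, ∫ x, Real.exp (-(l * t)) * |A t x| ≤
      (Set.Ioi (0 : ℝ)).indicator (fun t => Real.exp (-(l * t)) * a t) t := fun t => by
    by_cases ht : 0 < t
    · rw [Set.indicator_of_mem (Set.mem_Ioi.mpr ht), integral_const_mul]
      exact mul_le_mul_of_nonneg_left (ha t ht) (Real.exp_pos _).le
    · rw [Set.indicator_of_notMem (by simpa using ht), h0 t (not_lt.mp ht)]
      simp
  have hW : WeightedIntegrable l (uncurry A) := by
    rw [WeightedIntegrable, Measure.volume_eq_prod, integrable_prod_iff hm1.aestronglyMeasurable]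
    refine ⟨ae_of_all _ fun t => (hA t).const_mul (Real.exp (-(l * t))), ?_⟩
    refine hi1.mono' hm1.norm.stronglyMeasurable.integral_prod_right'.aestronglyMeasurable
      (ae_of_all _ fun t => ?_)
    rw [Real.norm_of_nonneg (integral_nonneg fun _ => norm_nonneg _)]
    refine le_trans (le_of_eq ?_) (hle t)
    refine integral_congr_ae (ae_of_all _ fun x => ?_)
    simp
  refine ⟨hW, ?_⟩
  have h1 := hW.abs
  rw [Measure.volume_eq_prod] at h1
  rw [weightedNorm, Measure.volume_eq_prod, integral_prod _ h1, ← integral_indicator measurableSet_Ioi]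
  exact integral_mono h1.integral_prod_left hi1 hle

namespace IsSmoothingKernel

variable {b C : ℝ} {K D : ℝ → ℝ → ℝ} (hK : IsSmoothingKernel b C K D)
include hK

lemma const_nonneg : 0 ≤ C := by
  have h := hK.integral_abs_deriv_le 1 one_pos
  rw [Real.one_rpow, mul_one] at h
  exact (integral_nonneg fun _ => abs_nonneg _).trans h

lemma weightedIntegrable_deriv_aux {l : ℝ} (hl : 0 < l) : WeightedIntegrable l (uncurry D) ∧
    weightedNorm l (uncurry D) ≤ C * ((1 / l) ^ (1 - b) * Real.Gamma (1 - b)) := by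
  have h1 := integrableOn_rpow_mul_exp_neg_mul_rpow (s := -b) (p := 1) (b := l)
    (by linarith [hK.exponent_lt_one]) one_pos hl
  have h2 : ∀ t, Real.exp (-(l * t)) * (C * t ^ (-b)) =
      C * (t ^ (-b) * Real.exp (-l * t ^ (1 : ℝ))) := fun t => by
    rw [Real.rpow_one, neg_mul]; ring
  have h3 := weightedIntegrable_of_slices (l := l) (a := fun t => C * t ^ (-b)) hK.measurable_deriv
    (fun t ht => funext fun x => hK.deriv_eq_zero t x ht) hK.integrable_deriv
    hK.integral_abs_deriv_le (by simp only [h2]; exact h1.const_mul C)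
  refine ⟨h3.1, h3.2.trans_eq ?_⟩
  simp only [h2]
  rw [integral_const_mul, ← Real.integral_rpow_mul_exp_neg_mul_Ioi
    (by linarith [hK.exponent_lt_one]) hl]
  congr 1
  refine setIntegral_congr_fun measurableSet_Ioi fun t _ => ?_
  simp only [Real.rpow_one, neg_mul]
  congr 2
  ring

lemma weightedIntegrable_deriv {l : ℝ} (hl : 0 < l) : WeightedIntegrable l (uncurry D) :=
  (hK.weightedIntegrable_deriv_aux hl).1

/-- The bound `C Γ(1-b) l^(b-1)` tends to `0` as `l → ∞` because `b < 1`. This smallness yields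
every contraction for Duhamel's formula, with no restriction on time. -/
lemma exists_weightedNorm_deriv_le {ε : ℝ} (hε : 0 < ε) :
    ∃ l > 0, weightedNorm l (uncurry D) ≤ ε := by
  have hb : 0 < 1 - b := by linarith [hK.exponent_lt_one]
  have h1 : Tendsto (fun l : ℝ => C * ((1 / l) ^ (1 - b) * Real.Gamma (1 - b))) atTop (𝓝 0) := by
    have h2 := (tendsto_rpow_neg_atTop hb).mul_const (Real.Gamma (1 - b)) |>.const_mul C
    rw [zero_mul, mul_zero] at h2
    refine h2.congr' ?_
    filter_upwards [eventually_gt_atTop 0] with l hl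
    rw [one_div, Real.inv_rpow hl.le, Real.rpow_neg hl.le]
  obtain ⟨l, h3, h4⟩ := ((h1.eventually (eventually_lt_nhds hε)).and (eventually_gt_atTop 0)).exists
  exact ⟨l, h4, (hK.weightedIntegrable_deriv_aux h4).2.trans h3.le⟩

lemma integral_abs_le_one (t : ℝ) : ∫ x, |K t x| ≤ 1 := by
  simp only [abs_of_nonneg (hK.nonneg t _)]
  by_cases ht : 0 < t
  · rw [hK.integral_eq_one t ht]
  · simp [hK.eq_zero t _ (not_lt.mp ht)]

lemma weightedIntegrable_aux {l : ℝ} (hl : 0 < l) : WeightedIntegrable l (uncurry K) ∧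
    weightedNorm l (uncurry K) ≤ 1 / l := by
  have h1 := integrableOn_rpow_mul_exp_neg_mul_rpow (s := 0) (p := 1) (b := l)
    (by linarith) one_pos hl
  have h2 : ∀ t, Real.exp (-(l * t)) * 1 = t ^ (0 : ℝ) * Real.exp (-l * t ^ (1 : ℝ)) := fun t => by
    rw [Real.rpow_one, neg_mul, Real.rpow_zero]; ring
  have h3 := weightedIntegrable_of_slices (l := l) (a := fun t => 1) hK.measurable
    (fun t ht => funext fun x => hK.eq_zero t x ht) hK.integrable
    (fun t _ => hK.integral_abs_le_one t) (by simp only [h2]; exact h1)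
  refine ⟨h3.1, h3.2.trans_eq ?_⟩
  have h4 := integral_exp_mul_Ioi (a := -l) (by linarith) 0
  simp only [mul_one, ← neg_mul]
  rw [h4]; simp

lemma weightedIntegrable {l : ℝ} (hl : 0 < l) : WeightedIntegrable l (uncurry K) :=
  (hK.weightedIntegrable_aux hl).1

end IsSmoothingKernel

/-- The backward difference quotient in space. -/
def diffQuot (K : ℝ → ℝ → ℝ) (h : ℝ) (q : ℝ × ℝ) : ℝ := (K q.1 q.2 - K q.1 (q.2 - h)) / h

namespace IsSmoothingKernel

variable {b C : ℝ} {K D : ℝ → ℝ → ℝ} (hK : IsSmoothingKernel b C K D)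
include hK

lemma weightedIntegrable_diffQuot {l : ℝ} (hl : 0 < l) (h : ℝ) :
    WeightedIntegrable l (diffQuot K h) := by
  have h1 : Integrable fun q : ℝ × ℝ => Real.exp (-(l * q.1)) * uncurry K q :=
    hK.weightedIntegrable hl
  have h2 := h1.comp_sub_right ((0, h) : ℝ × ℝ)
  refine ((h1.sub h2).div_const h).congr (ae_of_all _ fun q => ?_)
  simp only [Pi.sub_apply, diffQuot, uncurry, Prod.fst_sub, Prod.snd_sub, sub_zero]
  ring

lemma integral_deriv_segment (t x h : ℝ) :
    h * ∫ θ in (0 : ℝ)..1, D t (x - θ * h) = K t x - K t (x - h) := by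
  have h1 : ∀ θ ∈ Set.uIcc (0 : ℝ) 1, HasDerivAt (fun θ => -K t (x - θ * h))
      (h * D t (x - θ * h)) θ := fun θ _ => by
    have h2 : HasDerivAt (fun θ : ℝ => x - θ * h) (-h) θ := by
      simpa using ((hasDerivAt_id θ).mul_const h).const_sub x
    have h3 := ((hK.hasDerivAt t (x - θ * h)).comp θ h2).neg
    refine h3.congr_deriv ?_
    ring
  have hc : Continuous fun θ => h * D t (x - θ * h) := by
    have := hK.continuous_deriv t
    fun_prop
  rw [← intervalIntegral.integral_const_mul,
    intervalIntegral.integral_eq_sub_of_hasDerivAt h1 (hc.intervalIntegrable _ _)]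
  simp; ring

/-- The difference quotient is the mean of `D` over a segment of length `h`, so its distance to `D`
is controlled by `integral_abs_average_sub_le`. This is the consistency of the upwind scheme. -/
lemma exists_weightedNorm_diffQuot_sub_le {l : ℝ} (hl : 0 < l) {ε : ℝ} (hε : 0 < ε) :
    ∃ δ > 0, ∀ h, 0 < h → h < δ →
      weightedNorm l (fun q => diffQuot K h q - uncurry D q) ≤ ε := by
  have hm : Measurable fun q : ℝ × ℝ => Real.exp (-(l * q.1)) * uncurry D q :=
    measurable_weighted hK.measurable_deriv
  obtain ⟨δ, hδ, H⟩ := integral_abs_average_sub_le volume (hK.weightedIntegrable_deriv hl) hm hε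
  refine ⟨δ, hδ, fun h h0 hh => ?_⟩
  have h1 := H ((0, h) : ℝ × ℝ) (by simpa [Prod.norm_def, abs_of_pos h0] using ⟨hδ, hh⟩)
    (fun q => Real.exp (-(l * q.1)) * (diffQuot K h q - uncurry D q)) (fun q => ?_)
  · refine le_trans (le_of_eq ?_) h1
    refine integral_congr_ae (ae_of_all _ fun q => ?_)
    simp [abs_mul]
  · have hc : Continuous fun θ : ℝ => D q.1 (q.2 - θ * h) := by
      have := hK.continuous_deriv q.1
      fun_prop
    have h2 := hK.integral_deriv_segment q.1 q.2 h
    simp only [Prod.fst_sub, Prod.smul_fst, smul_eq_mul, mul_zero, sub_zero, uncurry, Prod.snd_sub,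
      Prod.smul_snd, ← mul_sub]
    rw [intervalIntegral.integral_const_mul, intervalIntegral.integral_sub
      (hc.intervalIntegrable _ _) intervalIntegrable_const, diffQuot, ← h2]
    simp [mul_div_cancel_left₀ _ h0.ne']

end IsSmoothingKernel

/-! ### Convolution in space -/

/-- The convolution of two functions on the line. -/
def xConv (k u₀ : ℝ → ℝ) (x : ℝ) : ℝ := ∫ y, k (x - y) * u₀ y

section XConv

variable {k k' u₀ : ℝ → ℝ} {R : ℝ}

lemma integrable_xConv (hk : Integrable k) (hu : AEStronglyMeasurable u₀ volume)
    (hR : ∀ᵐ y, |u₀ y| ≤ R) (x : ℝ) : Integrable fun y => k (x - y) * u₀ y :=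
  (hk.comp_sub_left x).mul_bdd hu hR

lemma abs_xConv_le (hk : Integrable k) (hR : ∀ᵐ y, |u₀ y| ≤ R) (x : ℝ) :
    |xConv k u₀ x| ≤ (∫ y, |k y|) * R := by
  rw [xConv, ← integral_sub_left_eq_self (fun y => |k y|) volume x, ← integral_mul_const,
    ← Real.norm_eq_abs]
  refine (norm_integral_le_integral_norm _).trans ?_
  refine integral_mono_of_nonneg (ae_of_all _ fun y => norm_nonneg _)
    ((hk.abs.comp_sub_left x).mul_const R) ?_
  filter_upwards [hR] with y hy
  rw [Real.norm_eq_abs, abs_mul]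
  exact mul_le_mul_of_nonneg_left hy (abs_nonneg _)

lemma xConv_sub (hk : Integrable k) (hk' : Integrable k') (hu : AEStronglyMeasurable u₀ volume)
    (hR : ∀ᵐ y, |u₀ y| ≤ R) (x : ℝ) :
    xConv (fun y => k y - k' y) u₀ x = xConv k u₀ x - xConv k' u₀ x := by
  rw [xConv, xConv, xConv,
    ← integral_sub (integrable_xConv hk hu hR x) (integrable_xConv hk' hu hR x)]
  simp only [sub_mul]

lemma xConv_comp_add (k u₀ : ℝ → ℝ) (r x : ℝ) : xConv k u₀ (x + r) = xConv (fun y => k (r + y)) u₀ x := by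
  simp only [xConv]
  refine integral_congr_ae (ae_of_all _ fun y => ?_)
  simp only
  rw [show x + r - y = r + (x - y) by ring]

lemma uniformContinuous_xConv (hk : Integrable k) (hu : AEStronglyMeasurable u₀ volume)
    (hR : ∀ᵐ y, |u₀ y| ≤ R) : UniformContinuous (xConv k u₀) := by
  have h0 := (tendsto_integral_abs_translate_sub volume hk).mul_const R
  rw [zero_mul] at h0
  rw [Metric.uniformContinuous_iff]
  intro ε hε
  obtain ⟨δ, hδ, h⟩ := Metric.eventually_nhds_iff.mp (h0.eventually (eventually_lt_nhds hε))
  refine ⟨δ, hδ, fun x y hxy => ?_⟩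
  have h1 := h (y := x - y) (by simpa [Real.dist_eq] using hxy)
  refine lt_of_le_of_lt ?_ h1
  have e : xConv k u₀ x = xConv (fun z => k (x - y + z)) u₀ y := by
    rw [← xConv_comp_add, add_sub_cancel]
  rw [Real.dist_eq, e, ← xConv_sub (hk.comp_add_left _) hk hu hR]
  exact abs_xConv_le ((hk.comp_add_left _).sub hk) hR y

/-- Convolution with a probability density preserves bounds. -/
lemma xConv_mem_Icc (hk : Integrable k) (hk0 : ∀ x, 0 ≤ k x) (hk1 : ∫ x, k x = 1)
    (hu : AEStronglyMeasurable u₀ volume) (hR : ∀ᵐ y, |u₀ y| ≤ R) {m M : ℝ}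
    (hm : ∀ᵐ y, m ≤ u₀ y) (hM : ∀ᵐ y, u₀ y ≤ M) (x : ℝ) :
    m ≤ xConv k u₀ x ∧ xConv k u₀ x ≤ M := by
  have hc : ∀ c : ℝ, ∫ y, k (x - y) * c = c := fun c => by
    rw [integral_mul_const, integral_sub_left_eq_self k volume x, hk1, one_mul]
  have hi : ∀ c : ℝ, Integrable fun y => k (x - y) * c := fun c => (hk.comp_sub_left x).mul_const c
  constructor
  · conv_lhs => rw [← hc m]
    refine integral_mono_ae (hi m) (integrable_xConv hk hu hR x) ?_
    filter_upwards [hm] with y hy using mul_le_mul_of_nonneg_left hy (hk0 _)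
  · conv_rhs => rw [← hc M]
    refine integral_mono_ae (integrable_xConv hk hu hR x) (hi M) ?_
    filter_upwards [hM] with y hy using mul_le_mul_of_nonneg_left hy (hk0 _)

lemma lintegral_enorm_sub_left (k : ℝ → ℝ) (y : ℝ) : ∫⁻ x, ‖k (x - y)‖ₑ = ∫⁻ x, ‖k x‖ₑ :=
  lintegral_sub_right_eq_self (fun x => ‖k x‖ₑ) y

/-- Young's inequality in `L¹`, in extended nonnegative form so that data of infinite `L¹` norm need
no separate case. -/
lemma lintegral_enorm_xConv_le (hk : AEStronglyMeasurable k volume)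
    (hu : AEStronglyMeasurable u₀ volume) :
    ∫⁻ x, ‖xConv k u₀ x‖ₑ ≤ (∫⁻ x, ‖k x‖ₑ) * ∫⁻ y, ‖u₀ y‖ₑ := by
  have hm : AEMeasurable (fun z : ℝ × ℝ => ‖k (z.1 - z.2)‖ₑ * ‖u₀ z.2‖ₑ) (volume.prod volume) := by
    have h1 : AEStronglyMeasurable (fun z : ℝ × ℝ => k (z.1 - z.2)) (volume.prod volume) :=
      hk.comp_quasiMeasurePreserving (quasiMeasurePreserving_sub volume volume)
    exact h1.enorm.mul hu.comp_snd.enorm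
  calc ∫⁻ x, ‖xConv k u₀ x‖ₑ ≤ ∫⁻ x, ∫⁻ y, ‖k (x - y)‖ₑ * ‖u₀ y‖ₑ := by
        refine lintegral_mono fun x => (enorm_integral_le_lintegral_enorm _).trans_eq ?_
        simp only [enorm_mul]
    _ = ∫⁻ y, ∫⁻ x, ‖k (x - y)‖ₑ * ‖u₀ y‖ₑ := lintegral_lintegral_swap hm
    _ = ∫⁻ y, (∫⁻ x, ‖k x‖ₑ) * ‖u₀ y‖ₑ := by
        refine lintegral_congr fun y => ?_
        rw [lintegral_mul_const' _ _ enorm_ne_top, lintegral_enorm_sub_left]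
    _ = _ := lintegral_const_mul'' _ hu.enorm

/-- Associativity of the convolution in space. -/
lemma xConv_xConv (hk : Integrable k) (hk' : Integrable k') (hu : AEStronglyMeasurable u₀ volume)
    (hR : ∀ᵐ y, |u₀ y| ≤ R) (x : ℝ) :
    xConv k (xConv k' u₀) x = xConv (xConv k k') u₀ x := by
  have hm1 : AEStronglyMeasurable (fun z : ℝ × ℝ => k' (z.1 - z.2)) (volume.prod volume) :=
    hk'.aestronglyMeasurable.comp_quasiMeasurePreserving (quasiMeasurePreserving_sub volume volume)
  have hm : AEStronglyMeasurable (fun z : ℝ × ℝ => k (x - z.1) * (k' (z.1 - z.2) * u₀ z.2))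
      (volume.prod volume) :=
    ((hk.comp_sub_left x).aestronglyMeasurable.comp_fst).mul (hm1.mul hu.comp_snd)
  have hint : Integrable (uncurry fun y z => k (x - y) * (k' (y - z) * u₀ z))
      (volume.prod volume) := by
    refine (integrable_prod_iff hm).mpr ⟨ae_of_all _ fun y => ?_, ?_⟩
    · exact (integrable_xConv hk' hu hR y).const_mul (k (x - y))
    · refine ((hk.comp_sub_left x).abs.mul_const ((∫ z, |k' z|) * R)).mono'
        hm.norm.integral_prod_right' (ae_of_all _ fun y => ?_)
      rw [Real.norm_of_nonneg (integral_nonneg fun _ => norm_nonneg _)]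
      simp only [norm_mul]
      rw [integral_const_mul]
      refine mul_le_mul_of_nonneg_left ?_ (abs_nonneg _)
      rw [← integral_sub_left_eq_self (fun y => |k' y|) volume y, ← integral_mul_const]
      refine integral_mono_of_nonneg (ae_of_all _ fun _ => by positivity)
        ((hk'.abs.comp_sub_left y).mul_const R) ?_
      filter_upwards [hR] with z hz
      exact mul_le_mul_of_nonneg_left hz (abs_nonneg _)
  have h1 : xConv k (xConv k' u₀) x = ∫ y, ∫ z, k (x - y) * (k' (y - z) * u₀ z) := by
    simp only [xConv, integral_const_mul]
  rw [h1, integral_integral_swap hint]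
  simp only [xConv]
  refine integral_congr_ae (ae_of_all _ fun z => ?_)
  simp only [← mul_assoc]
  rw [integral_mul_const]
  congr 1
  rw [← integral_sub_right_eq_self (fun y => k (x - z - y) * k' y) z]
  refine integral_congr_ae (ae_of_all _ fun y => ?_)
  simp only
  congr 2; ring

end XConv

lemma xConv_comm (k k' : ℝ → ℝ) (x : ℝ) : xConv k k' x = ∫ y, k y * k' (x - y) := by
  rw [xConv, ← integral_sub_left_eq_self (fun y => k y * k' (x - y)) volume x]
  simp only [sub_sub_cancel]

namespace IsSmoothingKernel

variable {b C : ℝ} {K D : ℝ → ℝ → ℝ} (hK : IsSmoothingKernel b C K D)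
include hK

lemma xConv_eq {s t : ℝ} (hs : 0 < s) (ht : 0 < t) : xConv (K s) (K t) = K (s + t) :=
  funext fun x => by rw [xConv_comm, hK.semigroup s t x hs ht]

lemma xConv_deriv_eq {s t : ℝ} (hs : 0 < s) (ht : 0 < t) : xConv (K s) (D t) = D (s + t) :=
  funext fun x => by rw [xConv_comm, hK.semigroup_deriv s t x hs ht]

variable {u₀ : ℝ → ℝ} {R : ℝ} (hu : AEStronglyMeasurable u₀ volume) (hR : ∀ᵐ y, |u₀ y| ≤ R)
include hu hR

/-- No regularity of `u₀` is available, so the derivative falls on the kernel: its difference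
quotients converge to `D t` in `L¹`. -/
lemma hasDerivAt_xConv (t x : ℝ) : HasDerivAt (xConv (K t) u₀) (xConv (D t) u₀ x) x := by
  have hR0 : 0 ≤ R := by
    obtain ⟨y, hy⟩ := hR.exists
    exact (abs_nonneg _).trans hy
  rw [hasDerivAt_iff_isLittleO_nhds_zero, Asymptotics.isLittleO_iff]
  intro c hc
  -- Dividing by `R + 1` rather than `R` covers `R = 0`.
  obtain ⟨δ, hδ, H⟩ := integral_abs_average_sub_le volume (hK.integrable_deriv t)
    (hK.continuous_deriv t).measurable (ε := c / (R + 1)) (by positivity)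
  filter_upwards [Metric.ball_mem_nhds (0 : ℝ) hδ] with h hh
  rw [Metric.mem_ball, dist_zero_right] at hh
  set G : ℝ → ℝ := fun q => ∫ θ in (0 : ℝ)..1, (D t (q - θ • (-h)) - D t q) with hG
  have h1 := H (-h) (by rwa [norm_neg]) G (fun q => rfl)
  have h2 : ∀ q, h * G q = K t (h + q) - K t q - h * D t q := fun q => by
    have hcont : Continuous fun θ : ℝ => D t (q - θ • (-h)) := by
      have := hK.continuous_deriv t
      fun_prop
    have h3 := hK.integral_deriv_segment t q (-h)
    simp only [hG]
    rw [intervalIntegral.integral_sub (hcont.intervalIntegrable _ _) intervalIntegrable_const]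
    simp only [smul_eq_mul, intervalIntegral.integral_const, sub_zero, one_mul]
    rw [sub_neg_eq_add, add_comm q h] at h3
    linear_combination -h3
  have hKi := hK.integrable t
  have hDi := hK.integrable_deriv t
  have e : xConv (K t) u₀ (x + h) - xConv (K t) u₀ x - h • xConv (D t) u₀ x =
      xConv (fun q => h * G q) u₀ x := by
    simp only [h2]
    have h4 : h • xConv (D t) u₀ x = xConv (fun q => h * D t q) u₀ x := by
      simp only [xConv, mul_assoc]
      rw [integral_const_mul, smul_eq_mul]
    have hKi2 : Integrable fun q => K t (h + q) - K t q := (hKi.comp_add_left h).sub hKi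
    rw [xConv_sub hKi2 (hDi.const_mul h) hu hR,
      xConv_sub (hKi.comp_add_left h) hKi hu hR, xConv_comp_add, h4]
  have hi : Integrable fun q => h * G q := by
    simp only [h2]
    exact ((hKi.comp_add_left h).sub hKi).sub (hDi.const_mul h)
  rw [e, Real.norm_eq_abs]
  refine (abs_xConv_le hi hR x).trans ?_
  simp only [abs_mul]
  rw [integral_const_mul, Real.norm_eq_abs]
  have h5 : (∫ q, |G q|) * R ≤ c := by
    calc (∫ q, |G q|) * R ≤ c / (R + 1) * R := mul_le_mul_of_nonneg_right h1 hR0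
      _ ≤ c / (R + 1) * (R + 1) := by gcongr; linarith
      _ = c := div_mul_cancel₀ _ (by positivity)
  nlinarith [abs_nonneg h]

lemma tendstoUniformly_xConv {t : ℝ} (ht : 0 < t) :
    TendstoUniformly (fun s => xConv (K s) u₀) (xConv (K t) u₀) (𝓝 t) := by
  have h := (hK.tendsto_integral_abs_sub t ht).mul_const R
  rw [zero_mul] at h
  rw [Metric.tendstoUniformly_iff]
  intro ε hε
  filter_upwards [h.eventually (eventually_lt_nhds hε)] with s hs x
  rw [dist_comm, Real.dist_eq, ← xConv_sub (hK.integrable s) (hK.integrable t) hu hR]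
  exact (abs_xConv_le ((hK.integrable s).sub (hK.integrable t)) hR x).trans_lt hs

lemma tendstoUniformly_xConv_deriv {t : ℝ} (ht : 0 < t) :
    TendstoUniformly (fun s => xConv (D s) u₀) (xConv (D t) u₀) (𝓝 t) := by
  have h := (hK.tendsto_integral_abs_deriv_sub t ht).mul_const R
  rw [zero_mul] at h
  rw [Metric.tendstoUniformly_iff]
  intro ε hε
  filter_upwards [h.eventually (eventually_lt_nhds hε)] with s hs x
  rw [dist_comm, Real.dist_eq, ← xConv_sub (hK.integrable_deriv s) (hK.integrable_deriv t) hu hR]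
  exact (abs_xConv_le ((hK.integrable_deriv s).sub (hK.integrable_deriv t)) hR x).trans_lt hs

lemma xConv_semigroup {s t : ℝ} (hs : 0 < s) (ht : 0 < t) (x : ℝ) :
    xConv (K s) (xConv (K t) u₀) x = xConv (K (s + t)) u₀ x := by
  rw [xConv_xConv (hK.integrable s) (hK.integrable t) hu hR, hK.xConv_eq hs ht]

end IsSmoothingKernel

lemma continuousAt_of_tendstoUniformly {u : ℝ → ℝ → ℝ} {t : ℝ}
    (h : TendstoUniformly u (u t) (𝓝 t)) (hc : Continuous (u t)) (x : ℝ) :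
    ContinuousAt (fun p : ℝ × ℝ => u p.1 p.2) (t, x) := by
  rw [Metric.continuousAt_iff']
  intro ε hε
  have h1 := (Metric.tendstoUniformly_iff.mp h) (ε / 2) (half_pos hε)
  have h2 := (Metric.continuousAt_iff'.mp (hc.continuousAt (x := x))) (ε / 2) (half_pos hε)
  rw [nhds_prod_eq]
  filter_upwards [h1.prod_mk h2] with p hp
  have := dist_triangle (u p.1 p.2) (u t p.2) (u t x)
  have h3 := hp.1 p.2
  have h4 := hp.2
  rw [dist_comm (u t p.2) (u p.1 p.2)] at h3
  exact this.trans_lt (by linarith)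

/-! ### Time slices of space-time convolutions -/

lemma stConv_eq_integral {A : ℝ → ℝ → ℝ} {g : ℝ × ℝ → ℝ} {t x : ℝ}
    (hi : Integrable fun q => uncurry A ((t, x) - q) * g q) :
    stConv (uncurry A) g (t, x) = ∫ s, ∫ y, A (t - s) (x - y) * g (s, y) := by
  rw [stConv, Measure.volume_eq_prod, integral_prod _ hi]
  rfl

/-- Both factors vanish for nonpositive times, so only `0 < s < t` contributes and the convolution
over the plane is the Duhamel integral. -/
lemma stConv_eq_intervalIntegral {A : ℝ → ℝ → ℝ} {g : ℝ × ℝ → ℝ} {t x : ℝ} (ht : 0 ≤ t)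
    (hA : ∀ s x, s ≤ 0 → A s x = 0) (hg : ∀ q : ℝ × ℝ, q.1 ≤ 0 → g q = 0)
    (hi : Integrable fun q => uncurry A ((t, x) - q) * g q) :
    stConv (uncurry A) g (t, x) = ∫ s in (0 : ℝ)..t, ∫ y, A (t - s) (x - y) * g (s, y) := by
  rw [stConv_eq_integral hi, intervalIntegral.integral_of_le ht,
    ← integral_indicator measurableSet_Ioc]
  refine integral_congr_ae (ae_of_all _ fun s => ?_)
  by_cases hs : s ∈ Set.Ioc 0 t
  · rw [Set.indicator_of_mem hs]
  · rw [Set.indicator_of_notMem hs]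
    rw [Set.mem_Ioc, not_and_or, not_lt, not_le] at hs
    rcases hs with hs | hs
    · simp [hg (s, _) hs]
    · simp [hA (t - s) _ (by linarith)]

lemma stConv_eq_zero {A : ℝ → ℝ → ℝ} {g : ℝ × ℝ → ℝ} {p : ℝ × ℝ} (hp : p.1 ≤ 0)
    (hA : ∀ s x, s ≤ 0 → A s x = 0) (hg : ∀ q : ℝ × ℝ, q.1 ≤ 0 → g q = 0) :
    stConv (uncurry A) g p = 0 := by
  rw [stConv]
  refine integral_eq_zero_of_ae (ae_of_all _ fun q => ?_)
  simp only [Pi.zero_apply]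
  rcases le_or_gt q.1 0 with h | h
  · rw [hg q h, mul_zero]
  · rw [uncurry, hA _ _ (by rw [Prod.fst_sub]; linarith), zero_mul]

lemma lintegral_enorm_stConv_le {A : ℝ → ℝ → ℝ} {g : ℝ × ℝ → ℝ} (hA : Measurable (uncurry A))
    (hg : Measurable g) (t : ℝ) :
    ∫⁻ x, ‖stConv (uncurry A) g (t, x)‖ₑ ≤
      ∫⁻ s, (∫⁻ z, ‖A (t - s) z‖ₑ) * ∫⁻ y, ‖g (s, y)‖ₑ := by
  have hm : Measurable fun z : (ℝ × ℝ) × ℝ × ℝ => uncurry A (z.1 - z.2) * g z.2 :=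
    (hA.comp (measurable_fst.sub measurable_snd)).mul (hg.comp measurable_snd)
  have hm' : Measurable fun z : ℝ × ℝ × ℝ => uncurry A ((t, z.1) - z.2) * g z.2 :=
    hm.comp (by fun_prop : Measurable fun z : ℝ × ℝ × ℝ => (((t, z.1) : ℝ × ℝ), z.2))
  calc ∫⁻ x, ‖stConv (uncurry A) g (t, x)‖ₑ
      ≤ ∫⁻ x, ∫⁻ q : ℝ × ℝ, ‖uncurry A ((t, x) - q) * g q‖ₑ :=
        lintegral_mono fun x => enorm_integral_le_lintegral_enorm _
    _ = ∫⁻ q : ℝ × ℝ, ∫⁻ x, ‖uncurry A ((t, x) - q) * g q‖ₑ :=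
        lintegral_lintegral_swap hm'.enorm.aemeasurable
    _ = ∫⁻ q : ℝ × ℝ, (∫⁻ z, ‖A (t - q.1) z‖ₑ) * ‖g q‖ₑ := by
        refine lintegral_congr fun q => ?_
        simp only [enorm_mul]
        rw [lintegral_mul_const' _ _ enorm_ne_top]
        congr 1
        exact lintegral_enorm_sub_left (A (t - q.1)) q.2
    _ = ∫⁻ s, ∫⁻ y, (∫⁻ z, ‖A (t - s) z‖ₑ) * ‖g (s, y)‖ₑ := by
        rw [Measure.volume_eq_prod, lintegral_prod]
        have h1 : Measurable fun z : ℝ × ℝ => ‖uncurry A z‖ₑ := hA.enorm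
        have h2 : Measurable fun s : ℝ => ∫⁻ z, ‖A s z‖ₑ := h1.lintegral_prod_right'
        exact ((h2.comp (measurable_const.sub measurable_fst)).mul hg.enorm).aemeasurable
    _ = _ := by
        refine lintegral_congr fun s => ?_
        exact lintegral_const_mul _ (hg.comp (measurable_const.prodMk measurable_id)).enorm

/-- Associativity of space-time convolutions. -/
lemma stConv_stConv {A A' g : ℝ × ℝ → ℝ} {l B : ℝ} (hA : WeightedIntegrable l A)
    (hA' : WeightedIntegrable l A') (hAm : Measurable A) (hAm' : Measurable A') (hg : Measurable g)
    (hB : ∀ q, |g q| ≤ B * Real.exp (l * q.1)) (p : ℝ × ℝ) :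
    stConv A (stConv A' g) p = stConv (stConv A A') g p := by
  have hm : Measurable fun z : (ℝ × ℝ) × ℝ × ℝ => A (p - z.1) * (A' (z.1 - z.2) * g z.2) := by
    fun_prop
  have hint : Integrable (uncurry fun r q => A (p - r) * (A' (r - q) * g q))
      (volume.prod volume) := by
    refine (integrable_prod_iff hm.aestronglyMeasurable).mpr ⟨ae_of_all _ fun r => ?_, ?_⟩
    · exact (integrable_stConv hA' hg hB r).const_mul (A (p - r))
    · have h1 := (Integrable.comp_sub_left hA.abs p).mul_const
        (weightedNorm l A' * B * Real.exp (l * p.1))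
      refine h1.mono' hm.norm.aestronglyMeasurable.integral_prod_right' (ae_of_all _ fun r => ?_)
      rw [Real.norm_of_nonneg (integral_nonneg fun _ => norm_nonneg _)]
      simp only [norm_mul, Real.norm_eq_abs]
      rw [integral_const_mul]
      have h2 := abs_stConv_le (A := fun q => |A' q|) (g := fun q => |g q|) (B := B) (l := l)
        (by simpa [WeightedIntegrable] using hA'.abs) (by simpa using hB) r
      have h3 : weightedNorm l (fun q => |A' q|) = weightedNorm l A' := by simp [weightedNorm]
      rw [h3] at h2
      have h4 := mul_le_mul_of_nonneg_left ((le_abs_self _).trans h2) (abs_nonneg (A (p - r)))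
      refine h4.trans_eq ?_
      have h5 : Real.exp (l * r.1) = Real.exp (-(l * (p - r).1)) * Real.exp (l * p.1) := by
        rw [← Real.exp_add, Prod.fst_sub]; congr 1; ring
      rw [h5]; ring
  have h1 : stConv A (stConv A' g) p = ∫ r, ∫ q, A (p - r) * (A' (r - q) * g q) := by
    simp only [stConv, integral_const_mul]
  rw [h1, integral_integral_swap hint, stConv]
  refine integral_congr_ae (ae_of_all _ fun q => ?_)
  simp only [← mul_assoc]
  rw [integral_mul_const]
  congr 1
  rw [stConv, ← integral_sub_right_eq_self (fun r => A (p - q - r) * A' r) q]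
  refine integral_congr_ae (ae_of_all _ fun r => ?_)
  simp only
  congr 2; abel

/-- Lets a kernel act on a time slice of a Duhamel integral; needed to restart a solution at a
positive time. -/
lemma xConv_stConv {k : ℝ → ℝ} {A g : ℝ × ℝ → ℝ} {l B : ℝ} (hk : Integrable k)
    (hkm : Measurable k) (hA : WeightedIntegrable l A) (hAm : Measurable A) (hg : Measurable g)
    (hB : ∀ q, |g q| ≤ B * Real.exp (l * q.1)) (s x : ℝ) :
    xConv k (fun z => stConv A g (s, z)) x =
      ∫ q : ℝ × ℝ, xConv k (fun z => A (s - q.1, z)) (x - q.2) * g q := by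
  have hm : Measurable fun z : ℝ × ℝ × ℝ => k (x - z.1) * (A ((s, z.1) - z.2) * g z.2) := by
    have h1 : Measurable fun z : ℝ × ℝ × ℝ => (((s, z.1) : ℝ × ℝ) - z.2) := by fun_prop
    have h2 := hAm.comp h1
    have h3 : Measurable fun z : ℝ × ℝ × ℝ => k (x - z.1) := by fun_prop
    exact h3.mul (h2.mul (hg.comp measurable_snd))
  have hint : Integrable (uncurry fun (z : ℝ) (q : ℝ × ℝ) => k (x - z) * (A ((s, z) - q) * g q))
      (volume.prod volume) := by
    refine (integrable_prod_iff hm.aestronglyMeasurable).mpr ⟨ae_of_all _ fun z => ?_, ?_⟩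
    · exact (integrable_stConv hA hg hB (s, z)).const_mul (k (x - z))
    · refine ((hk.comp_sub_left x).abs.mul_const (weightedNorm l A * B * Real.exp (l * s))).mono'
        hm.norm.aestronglyMeasurable.integral_prod_right' (ae_of_all _ fun z => ?_)
      rw [Real.norm_of_nonneg (integral_nonneg fun _ => norm_nonneg _)]
      simp only [norm_mul, Real.norm_eq_abs]
      rw [integral_const_mul]
      have h2 := abs_stConv_le (A := fun q => |A q|) (g := fun q => |g q|) (B := B) (l := l)
        (by simpa [WeightedIntegrable] using hA.abs) (by simpa using hB) (s, z)
      have h3 : weightedNorm l (fun q => |A q|) = weightedNorm l A := by simp [weightedNorm]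
      rw [h3] at h2
      exact mul_le_mul_of_nonneg_left ((le_abs_self _).trans h2) (abs_nonneg _)
  have h1 : xConv k (fun z => stConv A g (s, z)) x =
      ∫ z, ∫ q : ℝ × ℝ, k (x - z) * (A ((s, z) - q) * g q) := by
    simp only [xConv, stConv, integral_const_mul]
  rw [h1, integral_integral_swap hint]
  refine integral_congr_ae (ae_of_all _ fun q => ?_)
  simp only [← mul_assoc]
  rw [integral_mul_const]
  congr 1
  rw [xConv, ← integral_sub_right_eq_self (fun z => k (x - q.2 - z) * A (s - q.1, z)) q.2]
  refine integral_congr_ae (ae_of_all _ fun z => ?_)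
  simp only
  congr 2
  ring

/-! ### Fixed points of weighted contractions -/

/-- Banach's iteration carried out pointwise with the weight `w`: closedness of `P` under pointwise
limits replaces completeness of a function space. -/
lemma exists_fixedPoint_of_weighted_contraction {X : Type*} {w : X → ℝ}
    {P : (X → ℝ) → Prop} {Φ : (X → ℝ) → X → ℝ}
    (hlim : ∀ (v : ℕ → X → ℝ) (u : X → ℝ), (∀ n, P (v n)) →
      (∀ p, Tendsto (fun n => v n p) atTop (𝓝 (u p))) → P u)
    (hΦ : ∀ u, P u → P (Φ u))
    (hc : ∀ u v B, P u → P v → (∀ p, |u p - v p| ≤ B * w p) → ∀ p, |Φ u p - Φ v p| ≤ B / 2 * w p)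
    {u₀ : X → ℝ} (hu₀ : P u₀) {B : ℝ} (hB : ∀ p, |u₀ p - Φ u₀ p| ≤ B * w p) :
    ∃ u, P u ∧ Φ u = u := by
  set v : ℕ → X → ℝ := fun n => Φ^[n] u₀ with hv
  have hv1 : ∀ n, v (n + 1) = Φ (v n) := fun n => Function.iterate_succ_apply' Φ n u₀
  have hP : ∀ n, P (v n) := fun n => by
    induction n with
    | zero => exact hu₀
    | succ n ih => rw [hv1]; exact hΦ _ ih
  have hd : ∀ n p, |v n p - v (n + 1) p| ≤ B / 2 ^ n * w p := fun n => by
    induction n with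
    | zero => simpa [hv] using hB
    | succ n ih =>
      intro p
      have := hc (v n) (v (n + 1)) _ (hP n) (hP _) ih p
      rw [← hv1, ← hv1] at this
      rwa [pow_succ, ← div_div]
  have hd' : ∀ p n, dist (v n p) (v (n + 1) p) ≤ (2 * (B * w p)) / 2 / 2 ^ n := fun p n => by
    rw [Real.dist_eq]
    refine (hd n p).trans_eq ?_
    ring
  choose u hu using fun p => cauchySeq_tendsto_of_complete
    (cauchySeq_of_le_geometric_two (hd' p))
  have hPu : P u := hlim v u hP hu
  refine ⟨u, hPu, funext fun p => ?_⟩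
  have h1 : ∀ n p, |u p - v n p| ≤ 2 * B / 2 ^ n * w p := fun n p => by
    rw [← Real.dist_eq, dist_comm]
    refine (dist_le_of_le_geometric_two_of_tendsto (hd' p) (hu p) n).trans_eq ?_
    ring
  have h2 : ∀ n, |Φ u p - v (n + 1) p| ≤ 2 * B / 2 ^ n / 2 * w p := fun n => by
    rw [hv1]; exact hc _ _ _ hPu (hP n) (h1 n) p
  have h3 : Tendsto (fun n : ℕ => 2 * B / 2 ^ n / 2 * w p) atTop (𝓝 0) := by
    have h4 : Tendsto (fun n : ℕ => ((1 / 2 : ℝ)) ^ n) atTop (𝓝 0) :=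
      tendsto_pow_atTop_nhds_zero_of_lt_one (by norm_num) (by norm_num)
    have h5 := h4.const_mul (B * w p)
    rw [mul_zero] at h5
    refine h5.congr fun n => ?_
    rw [one_div, inv_pow]; field_simp
  have h6 : Tendsto (fun n => v (n + 1) p) atTop (𝓝 (Φ u p)) := by
    rw [tendsto_iff_dist_tendsto_zero]
    refine squeeze_zero (fun _ => dist_nonneg) (fun n => ?_) h3
    rw [dist_comm, Real.dist_eq]; exact h2 n
  exact tendsto_nhds_unique h6 ((hu p).comp (tendsto_add_atTop_nat 1))

/-- Fatou's lemma. -/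
lemma lintegral_enorm_le_of_tendsto {v : ℕ → ℝ → ℝ} {u : ℝ → ℝ} {N : ENNReal}
    (hm : ∀ n, Measurable (v n)) (h : ∀ n, ∫⁻ x, ‖v n x‖ₑ ≤ N)
    (hlim : ∀ x, Tendsto (fun n => v n x) atTop (𝓝 (u x))) : ∫⁻ x, ‖u x‖ₑ ≤ N := by
  calc ∫⁻ x, ‖u x‖ₑ = ∫⁻ x, liminf (fun n => ‖v n x‖ₑ) atTop :=
        lintegral_congr fun x => (hlim x).enorm.liminf_eq.symm
    _ ≤ liminf (fun n => ∫⁻ x, ‖v n x‖ₑ) atTop := lintegral_liminf_le fun n => (hm n).enorm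
    _ ≤ N := by
        refine liminf_le_of_frequently_le' ?_
        exact Frequently.of_forall h

/-! ### A monotone upwind scheme -/

/-- The source term of the damped upwind scheme with mesh size `h`. -/
def upwindSource (f : ℝ → ℝ) (μ h : ℝ) (w : ℝ × ℝ → ℝ) (q : ℝ × ℝ) : ℝ :=
  if 0 < q.1 then μ * w q - f (w q) / h + f (w (q.1, q.2 - h)) / h else 0

/-- The kernel damped by `exp (-μ t)`. -/
def damped (K : ℝ → ℝ → ℝ) (μ t x : ℝ) : ℝ := Real.exp (-(μ * t)) * K t x

/-- The map whose fixed point is the solution of the damped upwind scheme. -/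
def upwindMap (K : ℝ → ℝ → ℝ) (f u₀ : ℝ → ℝ) (μ h : ℝ) (w : ℝ × ℝ → ℝ) (p : ℝ × ℝ) : ℝ :=
  if 0 < p.1 then Real.exp (-(μ * p.1)) * xConv (K p.1) u₀ p.2 +
    stConv (uncurry (damped K μ)) (upwindSource f μ h w) p else 0

/-- Measurable functions on the half plane `t > 0`, extended by `0`, with values in `[m, M]` and
with `L¹` norms at most `N`. -/
structure IsAdmissible (m M : ℝ) (N : ENNReal) (w : ℝ × ℝ → ℝ) : Prop where
  measurable : Measurable w
  eq_zero : ∀ p : ℝ × ℝ, p.1 ≤ 0 → w p = 0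
  mem_Icc : ∀ p : ℝ × ℝ, 0 < p.1 → w p ∈ Set.Icc m M
  lintegral_le : ∀ t, 0 < t → ∫⁻ x, ‖w (t, x)‖ₑ ≤ N

lemma IsAdmissible.of_tendsto {m M : ℝ} {N : ENNReal} {v : ℕ → ℝ × ℝ → ℝ} {u : ℝ × ℝ → ℝ}
    (hv : ∀ n, IsAdmissible m M N (v n))
    (hlim : ∀ p, Tendsto (fun n => v n p) atTop (𝓝 (u p))) : IsAdmissible m M N u where
  measurable := measurable_of_tendsto_metrizable (fun n => (hv n).measurable)
    (tendsto_pi_nhds.mpr hlim)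
  eq_zero p hp := by
    have := hlim p
    simp only [(hv _).eq_zero p hp] at this
    exact tendsto_nhds_unique this tendsto_const_nhds
  mem_Icc p hp := isClosed_Icc.mem_of_tendsto (hlim p) (.of_forall fun n => (hv n).mem_Icc p hp)
  lintegral_le t ht := lintegral_enorm_le_of_tendsto
    (fun n => (hv n).measurable.comp (measurable_const.prodMk measurable_id))
    (fun n => (hv n).lintegral_le t ht) (fun x => hlim (t, x))

lemma IsAdmissible.abs_le {m M R : ℝ} {N : ENNReal} {w : ℝ × ℝ → ℝ} (hw : IsAdmissible m M N w)
    (hm : -R ≤ m) (hM : M ≤ R) (hR : 0 ≤ R) (p : ℝ × ℝ) : |w p| ≤ R := by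
  rcases le_or_gt p.1 0 with h | h
  · rw [hw.eq_zero p h]; simpa
  · have := hw.mem_Icc p h
    exact _root_.abs_le.mpr ⟨hm.trans this.1, this.2.trans hM⟩

/-- A monotone function vanishing at `0` that is `L`-Lipschitz on `[-R, R]`. -/
structure IsFlux (R L : ℝ) (f : ℝ → ℝ) : Prop where
  monotone : Monotone f
  map_zero : f 0 = 0
  radius_nonneg : 0 ≤ R
  lipschitz_pos : 0 < L
  lipschitz : ∀ v w, |v| ≤ R → |w| ≤ R → |f v - f w| ≤ L * |v - w|

lemma IsFlux.abs_le {R L : ℝ} {f : ℝ → ℝ} (hf : IsFlux R L f) {v : ℝ} (hv : |v| ≤ R) :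
    |f v| ≤ L * |v| := by
  simpa [hf.map_zero] using hf.lipschitz v 0 hv (by simpa using hf.radius_nonneg)

lemma IsFlux.sub_le {R L : ℝ} {f : ℝ → ℝ} (hf : IsFlux R L f) {v w : ℝ} (hv : |v| ≤ R)
    (hw : |w| ≤ R) (h : v ≤ w) : f w - f v ≤ L * (w - v) := by
  have := hf.lipschitz w v hw hv
  rw [abs_of_nonneg (sub_nonneg.mpr h)] at this
  exact (le_abs_self _).trans this

section Scheme

variable {R L h m M : ℝ} {N : ENNReal} {f : ℝ → ℝ} {w v : ℝ × ℝ → ℝ}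

lemma measurable_upwindSource (hf : Monotone f) (μ h : ℝ) (hw : Measurable w) :
    Measurable (upwindSource f μ h w) := by
  have hfm := hf.measurable
  have h1 : Measurable fun q : ℝ × ℝ => w (q.1, q.2 - h) := hw.comp (by fun_prop)
  refine Measurable.ite (measurableSet_lt measurable_const measurable_fst) ?_ measurable_const
  exact ((hw.const_mul μ).sub ((hfm.comp hw).div_const h)).add ((hfm.comp h1).div_const h)

lemma upwindSource_of_nonpos (f : ℝ → ℝ) (μ h : ℝ) (w : ℝ × ℝ → ℝ) {q : ℝ × ℝ} (hq : q.1 ≤ 0) :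
    upwindSource f μ h w q = 0 := by simp [upwindSource, not_lt.mpr hq]

/-- With `μ = L/h` the source is `(L w - f(w) + f(w'))/h`, where `w'` is the value one step to the
left. Both `v ↦ L v - f(v)` and `f` are nondecreasing on `[-R, R]`, so the extremes occur at
constant `m` or `M`, where the flux terms cancel. -/
lemma upwindSource_mem_Icc (hf : IsFlux R L f) (hh : 0 < h) (hm : -R ≤ m) (hM : M ≤ R)
    (hw : IsAdmissible m M N w) {q : ℝ × ℝ} (hq : 0 < q.1) :
    upwindSource f (L / h) h w q ∈ Set.Icc (L / h * m) (L / h * M) := by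
  have hmM : m ≤ M := (hw.mem_Icc q hq).1.trans (hw.mem_Icc q hq).2
  have hmR : |m| ≤ R := abs_le.mpr ⟨hm, hmM.trans hM⟩
  have hMR : |M| ≤ R := abs_le.mpr ⟨hm.trans hmM, hM⟩
  obtain ⟨h1, h2⟩ := hw.mem_Icc q hq
  obtain ⟨h3, h4⟩ := hw.mem_Icc (q.1, q.2 - h) hq
  have hwR := hw.abs_le hm hM hf.radius_nonneg q
  simp only [upwindSource, hq, if_true]
  have e : L / h * w q - f (w q) / h + f (w (q.1, q.2 - h)) / h =
      (L * w q - f (w q) + f (w (q.1, q.2 - h))) / h := by ring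
  rw [e, div_mul_eq_mul_div, div_mul_eq_mul_div]
  constructor
  · gcongr
    have := hf.sub_le hmR hwR h1
    have := hf.monotone h3
    linarith
  · gcongr
    have := hf.sub_le hwR hMR h2
    have := hf.monotone h4
    linarith

lemma abs_upwindSource_le (hf : IsFlux R L f) (hh : 0 < h) (hm : -R ≤ m) (hM : M ≤ R)
    (hw : IsAdmissible m M N w) {l : ℝ} (hl : 0 ≤ l) (q : ℝ × ℝ) :
    |upwindSource f (L / h) h w q| ≤ L / h * R * Real.exp (l * q.1) := by
  have hμ : 0 < L / h := div_pos hf.lipschitz_pos hh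
  have hR := hf.radius_nonneg
  rcases le_or_gt q.1 0 with hq | hq
  · rw [upwindSource_of_nonpos _ _ _ _ hq, abs_zero]; positivity
  · obtain ⟨h1, h2⟩ := upwindSource_mem_Icc hf hh hm hM hw hq
    have h3 : |upwindSource f (L / h) h w q| ≤ L / h * R :=
      abs_le.mpr ⟨by nlinarith, by nlinarith⟩
    refine h3.trans (le_mul_of_one_le_right (by positivity) ?_)
    exact Real.one_le_exp (by positivity)

/-- The factor `2` counts the maps `v ↦ L v - f(v)` and `f`, each `L`-Lipschitz. -/
lemma abs_upwindSource_sub_le (hf : IsFlux R L f) (hh : 0 < h) (hm : -R ≤ m) (hM : M ≤ R)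
    (hw : IsAdmissible m M N w) (hv : IsAdmissible m M N v) {l B : ℝ}
    (hB : ∀ q, |w q - v q| ≤ B * Real.exp (l * q.1)) (q : ℝ × ℝ) :
    |upwindSource f (L / h) h w q - upwindSource f (L / h) h v q| ≤
      2 * (L / h) * B * Real.exp (l * q.1) := by
  have hμ : 0 < L / h := div_pos hf.lipschitz_pos hh
  have hBq := (abs_nonneg _).trans (hB q)
  rcases le_or_gt q.1 0 with hq | hq
  · rw [upwindSource_of_nonpos _ _ _ _ hq, upwindSource_of_nonpos _ _ _ _ hq, sub_zero, abs_zero]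
    rw [mul_assoc]; positivity
  · simp only [upwindSource, hq, if_true]
    have hw1 := hw.abs_le hm hM hf.radius_nonneg
    have hv1 := hv.abs_le hm hM hf.radius_nonneg
    set q' : ℝ × ℝ := (q.1, q.2 - h)
    have h1 : |L * w q - f (w q) - (L * v q - f (v q))| ≤ L * |w q - v q| := by
      rcases le_total (v q) (w q) with h2 | h2
      · have h3 := hf.sub_le (hv1 q) (hw1 q) h2
        have h4 := hf.monotone h2
        rw [abs_of_nonneg (sub_nonneg.mpr h2), abs_le]
        constructor <;> linarith
      · have h3 := hf.sub_le (hw1 q) (hv1 q) h2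
        have h4 := hf.monotone h2
        rw [abs_of_nonpos (sub_nonpos.mpr h2), abs_le]
        constructor <;> linarith
    have h2 := hf.lipschitz _ _ (hw1 q') (hv1 q')
    have h3 : |w q - v q| ≤ B * Real.exp (l * q.1) := hB q
    have h4 : |w q' - v q'| ≤ B * Real.exp (l * q.1) := hB q'
    have hL := hf.lipschitz_pos
    have e : L / h * w q - f (w q) / h + f (w q') / h - (L / h * v q - f (v q) / h + f (v q') / h) =
        ((L * w q - f (w q) - (L * v q - f (v q))) + (f (w q') - f (v q'))) / h := by ring
    rw [e, abs_div, abs_of_pos hh, div_le_iff₀ hh]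
    have e2 : 2 * (L / h) * B * Real.exp (l * q.1) * h =
        L * (B * Real.exp (l * q.1)) + L * (B * Real.exp (l * q.1)) := by
      field_simp; ring
    rw [e2]
    refine (abs_add_le _ _).trans (add_le_add (h1.trans ?_) (h2.trans ?_))
    · gcongr
    · gcongr

/-- Since `f(w)` has the sign of `w` and `|f(w)| ≤ L|w|`, one has `|L w - f(w)| = L|w| - |f(w)|`.
The shifted term contributes `|f(w)|` again after translation, so the flux cancels from the `L¹`
norm. -/
lemma lintegral_enorm_upwindSource_le (hf : IsFlux R L f) (hh : 0 < h) (hm : -R ≤ m) (hM : M ≤ R)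
    (hw : IsAdmissible m M N w) {s : ℝ} (hs : 0 < s) :
    ∫⁻ y, ‖upwindSource f (L / h) h w (s, y)‖ₑ ≤ ENNReal.ofReal (L / h) * N := by
  have hμ : 0 < L / h := div_pos hf.lipschitz_pos hh
  have hwm : Measurable fun y => w (s, y) := hw.measurable.comp (measurable_const.prodMk measurable_id)
  have hfm := hf.monotone.measurable
  set F : ℝ → ENNReal := fun y => ENNReal.ofReal (|f (w (s, y))| / h) with hF
  set G : ℝ → ENNReal := fun y => ENNReal.ofReal (L / h * |w (s, y)| - |f (w (s, y))| / h) with hG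
  have hFm : Measurable F := ((hfm.comp hwm).abs.div_const h).ennreal_ofReal
  have hFm' : Measurable fun y => F (y - h) := hFm.comp (by fun_prop)
  have hle : ∀ y, |f (w (s, y))| / h ≤ L / h * |w (s, y)| := fun y => by
    rw [div_mul_eq_mul_div]
    have := hf.abs_le (hw.abs_le hm hM hf.radius_nonneg (s, y))
    gcongr
  calc ∫⁻ y, ‖upwindSource f (L / h) h w (s, y)‖ₑ ≤ ∫⁻ y, (G y + F (y - h)) := by
        refine lintegral_mono fun y => ?_
        simp only [upwindSource, hs, if_true, hF, hG]
        rw [← ENNReal.ofReal_add (sub_nonneg.mpr (hle y)) (by positivity), Real.enorm_eq_ofReal_abs]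
        refine ENNReal.ofReal_le_ofReal ((abs_add_le _ _).trans (add_le_add (le_of_eq ?_)
          (by rw [abs_div, abs_of_pos hh])))
        have h1 := hle y
        rcases le_total 0 (w (s, y)) with h0 | h0
        · have h2 : 0 ≤ f (w (s, y)) := by simpa [hf.map_zero] using hf.monotone h0
          rw [abs_of_nonneg h0, abs_of_nonneg h2] at h1 ⊢
          exact abs_of_nonneg (sub_nonneg.mpr h1)
        · have h2 : f (w (s, y)) ≤ 0 := by simpa [hf.map_zero] using hf.monotone h0
          rw [abs_of_nonpos h0, abs_of_nonpos h2] at h1 ⊢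
          have e : L / h * w (s, y) - f (w (s, y)) / h =
              -(L / h * -w (s, y) - -f (w (s, y)) / h) := by ring
          rw [e, abs_neg]
          exact abs_of_nonneg (sub_nonneg.mpr h1)
    _ = ∫⁻ y, (G y + F y) := by
        rw [lintegral_add_right _ hFm', lintegral_add_right _ hFm]
        congr 1
        exact lintegral_sub_right_eq_self F h
    _ = ∫⁻ y, ENNReal.ofReal (L / h) * ‖w (s, y)‖ₑ := by
        refine lintegral_congr fun y => ?_
        simp only [hF, hG]
        rw [← ENNReal.ofReal_add (sub_nonneg.mpr (hle y)) (by positivity), sub_add_cancel,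
          ENNReal.ofReal_mul hμ.le, Real.enorm_eq_ofReal_abs]
    _ = ENNReal.ofReal (L / h) * ∫⁻ y, ‖w (s, y)‖ₑ := lintegral_const_mul _ hwm.enorm
    _ ≤ ENNReal.ofReal (L / h) * N := by gcongr; exact hw.lintegral_le s hs

end Scheme

/-! ### The damped kernel -/

lemma integral_exp_damping {μ : ℝ} (t : ℝ) :
    ∫ s in (0 : ℝ)..t, μ * Real.exp (-(μ * (t - s))) = 1 - Real.exp (-(μ * t)) := by
  have h1 : ∀ s ∈ Set.uIcc 0 t, HasDerivAt (fun s => Real.exp (-(μ * (t - s))))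
      (μ * Real.exp (-(μ * (t - s)))) s := fun s _ => by
    have h2 : HasDerivAt (fun s : ℝ => -(μ * (t - s))) μ s := by
      simpa using! (((hasDerivAt_id s).const_sub t).const_mul μ).neg
    exact h2.exp.congr_deriv (mul_comm _ _)
  rw [intervalIntegral.integral_eq_sub_of_hasDerivAt h1
    ((by fun_prop : Continuous fun s => μ * Real.exp (-(μ * (t - s)))).intervalIntegrable _ _)]
  simp

namespace IsSmoothingKernel

variable {b C : ℝ} {K D : ℝ → ℝ → ℝ} (hK : IsSmoothingKernel b C K D)
include hK

lemma lintegral_enorm_eq_one {t : ℝ} (ht : 0 < t) : ∫⁻ x, ‖K t x‖ₑ = 1 := by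
  rw [← ofReal_integral_norm_eq_lintegral_enorm (hK.integrable t)]
  simp only [Real.norm_of_nonneg (hK.nonneg t _), hK.integral_eq_one t ht, ENNReal.ofReal_one]

lemma measurable_damped (μ : ℝ) : Measurable (uncurry (damped K μ)) :=
  (by fun_prop : Measurable fun q : ℝ × ℝ => Real.exp (-(μ * q.1))).mul hK.measurable

lemma weightedIntegrable_damped {l μ : ℝ} (hl : 0 < l) (hμ : 0 < μ) :
    WeightedIntegrable l (uncurry (damped K μ)) ∧
      weightedNorm l (uncurry (damped K μ)) ≤ 1 / (l + μ) := by
  have h := hK.weightedIntegrable_aux (add_pos hl hμ)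
  have e : ∀ q : ℝ × ℝ, Real.exp (-((l + μ) * q.1)) =
      Real.exp (-(l * q.1)) * Real.exp (-(μ * q.1)) := fun q => by
    rw [← Real.exp_add]; congr 1; ring
  constructor
  · refine h.1.congr (ae_of_all _ fun q => ?_)
    simp only [e, uncurry, damped, mul_assoc]
  · refine le_trans (le_of_eq ?_) h.2
    refine integral_congr_ae (ae_of_all _ fun q => ?_)
    simp only [e, uncurry, damped, abs_mul, mul_assoc, Real.abs_exp]

/-- The weights `exp(-μ t)` of the linear part and `1 - exp(-μ t)` of a constant source add up to
one; this makes the upwind map an average. -/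
lemma stConv_damped_const {μ : ℝ} (hμ : 0 < μ) (c : ℝ) {t : ℝ} (ht : 0 < t) (x : ℝ) :
    stConv (uncurry (damped K μ)) (fun q => if 0 < q.1 then μ * c else 0) (t, x) =
      (1 - Real.exp (-(μ * t))) * c := by
  have hm : Measurable fun q : ℝ × ℝ => if 0 < q.1 then μ * c else 0 :=
    Measurable.ite (measurableSet_lt measurable_const measurable_fst) measurable_const
      measurable_const
  have hB : ∀ q : ℝ × ℝ, |if 0 < q.1 then μ * c else 0| ≤ |μ * c| * Real.exp (1 * q.1) := fun q => by
    split_ifs with hq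
    · exact le_mul_of_one_le_right (abs_nonneg _) (Real.one_le_exp (by linarith))
    · rw [abs_zero]; positivity
  rw [stConv_eq_intervalIntegral ht.le (fun s x hs => by simp [damped, hK.eq_zero s x hs])
    (fun q hq => by simp [not_lt.mpr hq])
    (integrable_stConv (hK.weightedIntegrable_damped one_pos hμ).1 hm hB _),
    ← integral_exp_damping, ← intervalIntegral.integral_mul_const]
  refine intervalIntegral.integral_congr_Ioo_of_le ht.le fun s hs => ?_
  obtain ⟨hs, hst⟩ := hs
  simp only [hs, if_true, damped]
  rw [integral_mul_const, integral_const_mul, integral_sub_left_eq_self (K (t - s)) volume x,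
    hK.integral_eq_one _ (sub_pos.mpr hst)]
  ring

end IsSmoothingKernel

lemma measurable_xConv {K : ℝ → ℝ → ℝ} {u₀ : ℝ → ℝ} (hK : Measurable (uncurry K))
    (hu : AEStronglyMeasurable u₀ volume) :
    Measurable fun p : ℝ × ℝ => xConv (K p.1) u₀ p.2 := by
  have h1 : ∀ p : ℝ × ℝ, xConv (K p.1) u₀ p.2 = ∫ y, K p.1 (p.2 - y) * hu.mk u₀ y := fun p => by
    refine integral_congr_ae ?_
    filter_upwards [hu.ae_eq_mk] with y hy
    rw [hy]
  simp only [h1]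
  have h2 : Measurable fun z : (ℝ × ℝ) × ℝ => uncurry K (z.1.1, z.1.2 - z.2) * hu.mk u₀ z.2 :=
    (hK.comp (by fun_prop)).mul (hu.stronglyMeasurable_mk.measurable.comp measurable_snd)
  exact h2.stronglyMeasurable.integral_prod_right'.measurable

lemma stConv_sub {A g g' : ℝ × ℝ → ℝ} {p : ℝ × ℝ} (h : Integrable fun q => A (p - q) * g q)
    (h' : Integrable fun q => A (p - q) * g' q) :
    stConv A (fun q => g q - g' q) p = stConv A g p - stConv A g' p := by
  rw [stConv, stConv, stConv, ← integral_sub h h']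
  simp only [mul_sub]

/-- Initial data with values in `[m, M] ⊆ [-R, R]`. -/
structure IsDatum (R m M : ℝ) (u₀ : ℝ → ℝ) : Prop where
  aestronglyMeasurable : AEStronglyMeasurable u₀ volume
  le_lower : -R ≤ m
  upper_le : M ≤ R
  lower : ∀ᵐ y, m ≤ u₀ y
  upper : ∀ᵐ y, u₀ y ≤ M

lemma IsDatum.bound {R m M : ℝ} {u₀ : ℝ → ℝ} (hd : IsDatum R m M u₀) : ∀ᵐ y, |u₀ y| ≤ R := by
  filter_upwards [hd.lower, hd.upper] with y h1 h2
  exact abs_le.mpr ⟨hd.le_lower.trans h1, h2.trans hd.upper_le⟩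

/-! ### Solvability of the damped scheme within the bounds of the datum. -/

namespace IsSmoothingKernel

variable {b C : ℝ} {K D : ℝ → ℝ → ℝ} (hK : IsSmoothingKernel b C K D)
  {R L h m M : ℝ} {f u₀ : ℝ → ℝ} (hf : IsFlux R L f) (hh : 0 < h) (hd : IsDatum R m M u₀)
  {w v : ℝ × ℝ → ℝ}

include hK hd in
lemma xConv_mem_Icc {t : ℝ} (ht : 0 < t) (x : ℝ) : xConv (K t) u₀ x ∈ Set.Icc m M :=
  RieszFeller.xConv_mem_Icc (hK.integrable t) (hK.nonneg t) (hK.integral_eq_one t ht)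
    hd.aestronglyMeasurable hd.bound hd.lower hd.upper x

include hK hd in
lemma lintegral_enorm_xConv_le {t : ℝ} (ht : 0 < t) :
    ∫⁻ x, ‖xConv (K t) u₀ x‖ₑ ≤ ∫⁻ x, ‖u₀ x‖ₑ := by
  have := RieszFeller.lintegral_enorm_xConv_le (hK.integrable t).aestronglyMeasurable
    hd.aestronglyMeasurable
  rwa [hK.lintegral_enorm_eq_one ht, one_mul] at this

include hK hf hh hd in
lemma integrable_damped_upwindSource (hw : IsAdmissible m M (∫⁻ x, ‖u₀ x‖ₑ) w) (p : ℝ × ℝ) :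
    Integrable fun q => uncurry (damped K (L / h)) (p - q) * upwindSource f (L / h) h w q :=
  integrable_stConv (hK.weightedIntegrable_damped one_pos (div_pos hf.lipschitz_pos hh)).1
    (measurable_upwindSource hf.monotone _ h hw.measurable)
    (abs_upwindSource_le hf hh hd.le_lower hd.upper_le hw zero_le_one) p

include hK hf hh hd in
-- By positivity of the kernel the source may be replaced by the constants `μ m` and `μ M`; the
-- value of the map then lies between convex combinations of equal endpoints.
lemma upwindMap_mem_Icc (hw : IsAdmissible m M (∫⁻ x, ‖u₀ x‖ₑ) w) {p : ℝ × ℝ} (hp : 0 < p.1) :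
    upwindMap K f u₀ (L / h) h w p ∈ Set.Icc m M := by
  have hμ : 0 < L / h := div_pos hf.lipschitz_pos hh
  obtain ⟨h1, h2⟩ := hK.xConv_mem_Icc hd hp p.2
  have hi := hK.integrable_damped_upwindSource hf hh hd hw p
  have hci : ∀ c, Integrable fun q : ℝ × ℝ => uncurry (damped K (L / h)) (p - q) *
      (if 0 < q.1 then L / h * c else 0) := fun c => by
    refine integrable_stConv (l := 1) (B := |L / h * c|)
      (hK.weightedIntegrable_damped one_pos hμ).1
      (Measurable.ite (measurableSet_lt measurable_const measurable_fst) measurable_const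
        measurable_const) (fun q => ?_) p
    split_ifs with hq
    · exact le_mul_of_one_le_right (abs_nonneg _) (Real.one_le_exp (by linarith))
    · rw [abs_zero]; positivity
  have hc : ∀ c, stConv (uncurry (damped K (L / h)))
      (fun q => if 0 < q.1 then L / h * c else 0) p = (1 - Real.exp (-(L / h * p.1))) * c :=
    fun c => hK.stConv_damped_const hμ c hp p.2
  have hdn : ∀ q, 0 ≤ uncurry (damped K (L / h)) q := fun q =>
    mul_nonneg (Real.exp_pos _).le (hK.nonneg _ _)
  have h3 : (1 - Real.exp (-(L / h * p.1))) * m ≤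
      stConv (uncurry (damped K (L / h))) (upwindSource f (L / h) h w) p := by
    rw [← hc]
    refine integral_mono (hci m) hi fun q => mul_le_mul_of_nonneg_left ?_ (hdn _)
    beta_reduce
    split_ifs with hq
    · exact (upwindSource_mem_Icc hf hh hd.le_lower hd.upper_le hw hq).1
    · rw [upwindSource_of_nonpos _ _ _ _ (not_lt.mp hq)]
  have h4 : stConv (uncurry (damped K (L / h))) (upwindSource f (L / h) h w) p ≤
      (1 - Real.exp (-(L / h * p.1))) * M := by
    rw [← hc]
    refine integral_mono hi (hci M) fun q => mul_le_mul_of_nonneg_left ?_ (hdn _)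
    beta_reduce
    split_ifs with hq
    · exact (upwindSource_mem_Icc hf hh hd.le_lower hd.upper_le hw hq).2
    · rw [upwindSource_of_nonpos _ _ _ _ (not_lt.mp hq)]
  simp only [upwindMap, hp, if_true]
  have he := Real.exp_pos (-(L / h * p.1))
  have h5 := mul_le_mul_of_nonneg_left h1 he.le
  have h6 := mul_le_mul_of_nonneg_left h2 he.le
  constructor <;> linarith

include hK hf hh hd in
-- The same weights as in the pointwise bound: the linear part carries `exp(-μ t)` of the norm of
-- `u₀`, the source at most `1 - exp(-μ t)`.
lemma lintegral_enorm_upwindMap_le (hw : IsAdmissible m M (∫⁻ x, ‖u₀ x‖ₑ) w) {t : ℝ}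
    (ht : 0 < t) :
    ∫⁻ x, ‖upwindMap K f u₀ (L / h) h w (t, x)‖ₑ ≤ ∫⁻ x, ‖u₀ x‖ₑ := by
  have hμ : 0 < L / h := div_pos hf.lipschitz_pos hh
  set μ := L / h with hμdef
  set N := ∫⁻ x, ‖u₀ x‖ₑ with hN
  have hmx : Measurable fun x => Real.exp (-(μ * t)) * xConv (K t) u₀ x :=
    ((measurable_xConv hK.measurable hd.aestronglyMeasurable).comp
      (measurable_const.prodMk measurable_id)).const_mul _
  have h1 : ∫⁻ x, ‖Real.exp (-(μ * t)) * xConv (K t) u₀ x‖ₑ ≤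
      ENNReal.ofReal (Real.exp (-(μ * t))) * N := by
    simp only [enorm_mul]
    rw [lintegral_const_mul' _ _ enorm_ne_top, Real.enorm_of_nonneg (Real.exp_pos _).le]
    gcongr
    exact hK.lintegral_enorm_xConv_le hd ht
  have hslice : ∀ s, (∫⁻ z, ‖damped K μ (t - s) z‖ₑ) * ∫⁻ y, ‖upwindSource f μ h w (s, y)‖ₑ ≤
      (Set.Ioc 0 t).indicator (fun s => ENNReal.ofReal (μ * Real.exp (-(μ * (t - s)))) * N) s := by
    intro s
    by_cases hs : 0 < s ∧ s < t
    · rw [Set.indicator_of_mem (Set.mem_Ioc.mpr ⟨hs.1, hs.2.le⟩)]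
      have e : ∫⁻ z, ‖damped K μ (t - s) z‖ₑ = ENNReal.ofReal (Real.exp (-(μ * (t - s)))) := by
        simp only [damped, enorm_mul]
        rw [lintegral_const_mul' _ _ enorm_ne_top, hK.lintegral_enorm_eq_one (sub_pos.mpr hs.2),
          mul_one, Real.enorm_of_nonneg (Real.exp_pos _).le]
      rw [e, mul_comm μ (Real.exp _), ENNReal.ofReal_mul (Real.exp_pos _).le, mul_assoc]
      gcongr
      exact lintegral_enorm_upwindSource_le hf hh hd.le_lower hd.upper_le hw hs.1
    · rw [not_and_or, not_lt, not_lt] at hs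
      refine le_trans (le_of_eq ?_) zero_le
      rcases hs with hs | hs
      · simp [upwindSource_of_nonpos _ _ _ _ (show ((s, _) : ℝ × ℝ).1 ≤ 0 from hs)]
      · simp [damped, hK.eq_zero (t - s) _ (sub_nonpos.mpr hs)]
  have h2 : ∫⁻ x, ‖stConv (uncurry (damped K μ)) (upwindSource f μ h w) (t, x)‖ₑ ≤
      ENNReal.ofReal (1 - Real.exp (-(μ * t))) * N := by
    refine (lintegral_enorm_stConv_le (hK.measurable_damped μ)
      (measurable_upwindSource hf.monotone μ h hw.measurable) t).trans ?_
    refine (lintegral_mono hslice).trans_eq ?_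
    have hc : Continuous fun s => μ * Real.exp (-(μ * (t - s))) := by fun_prop
    rw [lintegral_indicator measurableSet_Ioc,
      lintegral_mul_const _ hc.measurable.ennreal_ofReal,
      ← ofReal_integral_eq_lintegral_ofReal (hc.integrableOn_Ioc)
        (ae_of_all _ fun s => by positivity),
      ← intervalIntegral.integral_of_le ht.le, integral_exp_damping]
  calc ∫⁻ x, ‖upwindMap K f u₀ μ h w (t, x)‖ₑ
      ≤ ∫⁻ x, (‖Real.exp (-(μ * t)) * xConv (K t) u₀ x‖ₑ +
          ‖stConv (uncurry (damped K μ)) (upwindSource f μ h w) (t, x)‖ₑ) := by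
        refine lintegral_mono fun x => ?_
        simp only [upwindMap, ht, if_true]
        exact enorm_add_le _ _
    _ ≤ ENNReal.ofReal (Real.exp (-(μ * t))) * N +
          ENNReal.ofReal (1 - Real.exp (-(μ * t))) * N := by
        rw [lintegral_add_left hmx.enorm]
        exact add_le_add h1 h2
    _ = N := by
        rw [← add_mul, ← ENNReal.ofReal_add (Real.exp_pos _).le, add_sub_cancel, ENNReal.ofReal_one,
          one_mul]
        rw [sub_nonneg, Real.exp_le_one_iff]
        have := mul_pos hμ ht
        linarith

include hK hf hh hd in
lemma isAdmissible_upwindMap (hw : IsAdmissible m M (∫⁻ x, ‖u₀ x‖ₑ) w) :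
    IsAdmissible m M (∫⁻ x, ‖u₀ x‖ₑ) (upwindMap K f u₀ (L / h) h w) where
  measurable := by
    have hμ : 0 < L / h := div_pos hf.lipschitz_pos hh
    have h1 := (continuous_stConv (hK.weightedIntegrable_damped one_pos hμ).1
      (measurable_upwindSource hf.monotone _ h hw.measurable)
      (abs_upwindSource_le hf hh hd.le_lower hd.upper_le hw zero_le_one)).measurable
    refine Measurable.ite (measurableSet_lt measurable_const measurable_fst) ?_ measurable_const
    exact ((by fun_prop : Measurable fun q : ℝ × ℝ => Real.exp (-(L / h * q.1))).mul
      (measurable_xConv hK.measurable hd.aestronglyMeasurable)).add h1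
  eq_zero p hp := by simp [upwindMap, not_lt.mpr hp]
  mem_Icc p hp := hK.upwindMap_mem_Icc hf hh hd hw hp
  lintegral_le t ht := hK.lintegral_enorm_upwindMap_le hf hh hd hw ht

include hK hf hh hd in
lemma abs_upwindMap_sub_le (hw : IsAdmissible m M (∫⁻ x, ‖u₀ x‖ₑ) w)
    (hv : IsAdmissible m M (∫⁻ x, ‖u₀ x‖ₑ) v) {B : ℝ}
    (hB : ∀ q, |w q - v q| ≤ B * Real.exp (3 * (L / h) * q.1)) (p : ℝ × ℝ) :
    |upwindMap K f u₀ (L / h) h w p - upwindMap K f u₀ (L / h) h v p| ≤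
      B / 2 * Real.exp (3 * (L / h) * p.1) := by
  have hμ : 0 < L / h := div_pos hf.lipschitz_pos hh
  have hB0 : 0 ≤ B := by simpa using (abs_nonneg _).trans (hB 0)
  by_cases hp : 0 < p.1
  -- With weight `3μ` the damped kernel has norm at most `1/(4μ)`, and the source is `2μ`-Lipschitz:
  -- the product is `1/2`.
  · have hA := hK.weightedIntegrable_damped (l := 3 * (L / h)) (by positivity) hμ
    have h1 := abs_stConv_le (A := uncurry (damped K (L / h))) hA.1
      (abs_upwindSource_sub_le hf hh hd.le_lower hd.upper_le hw hv hB) p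
    simp only [upwindMap, hp, if_true]
    rw [add_sub_add_left_eq_sub, ← stConv_sub (hK.integrable_damped_upwindSource hf hh hd hw p)
      (hK.integrable_damped_upwindSource hf hh hd hv p)]
    refine h1.trans (mul_le_mul_of_nonneg_right ?_ (Real.exp_pos _).le)
    calc weightedNorm (3 * (L / h)) (uncurry (damped K (L / h))) * (2 * (L / h) * B)
        ≤ 1 / (3 * (L / h) + L / h) * (2 * (L / h) * B) := by gcongr; exact hA.2
      _ = B / 2 := by
        have := hf.lipschitz_pos.ne'
        field_simp; ring
  · simp only [upwindMap, hp, if_false, sub_self, abs_zero]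
    positivity

include hK hf hh hd in
/-- The damped upwind scheme is solvable. -/
lemma exists_upwindMap_fixedPoint :
    ∃ w, IsAdmissible m M (∫⁻ x, ‖u₀ x‖ₑ) w ∧ upwindMap K f u₀ (L / h) h w = w := by
  have hμ : 0 < L / h := div_pos hf.lipschitz_pos hh
  have h0 : IsAdmissible m M (∫⁻ x, ‖u₀ x‖ₑ)
      (fun p => if 0 < p.1 then xConv (K p.1) u₀ p.2 else 0) := by
    refine ⟨?_, fun p hp => by simp [not_lt.mpr hp], fun p hp => ?_, fun t ht => ?_⟩
    · exact Measurable.ite (measurableSet_lt measurable_const measurable_fst)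
        (measurable_xConv hK.measurable hd.aestronglyMeasurable) measurable_const
    · simp only [hp, if_true]
      exact hK.xConv_mem_Icc hd hp p.2
    · simp only [ht, if_true]
      exact hK.lintegral_enorm_xConv_le hd ht
  refine exists_fixedPoint_of_weighted_contraction (w := fun p => Real.exp (3 * (L / h) * p.1))
    (fun _ _ hv hlim => IsAdmissible.of_tendsto hv hlim)
    (fun _ hw => hK.isAdmissible_upwindMap hf hh hd hw)
    (fun _ _ _ hw hv hB => hK.abs_upwindMap_sub_le hf hh hd hw hv hB) h0 (B := 2 * R) fun p => ?_
  have hR := hf.radius_nonneg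
  by_cases hp : 0 < p.1
  · have h1 := h0.abs_le hd.le_lower hd.upper_le hf.radius_nonneg p
    have h2 := (hK.isAdmissible_upwindMap hf hh hd h0).abs_le hd.le_lower hd.upper_le
      hf.radius_nonneg p
    refine ((abs_sub _ _).trans (add_le_add h1 h2)).trans ?_
    rw [← two_mul]
    exact le_mul_of_one_le_right (by positivity) (Real.one_le_exp (by positivity))
  · simp only [upwindMap, hp, if_false, sub_self, abs_zero]
    positivity

end IsSmoothingKernel

/-! ### Removing the damping -/

lemma integral_exp_damping' {μ : ℝ} (t : ℝ) :
    ∫ s in (0 : ℝ)..t, μ * Real.exp (-(μ * s)) = 1 - Real.exp (-(μ * t)) := by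
  rw [← integral_exp_damping t,
    intervalIntegral.integral_comp_sub_left (fun s => μ * Real.exp (-(μ * s))) t]
  simp

lemma stConv_add {A g g' : ℝ × ℝ → ℝ} {p : ℝ × ℝ} (h : Integrable fun q => A (p - q) * g q)
    (h' : Integrable fun q => A (p - q) * g' q) :
    stConv A (fun q => g q + g' q) p = stConv A g p + stConv A g' p := by
  rw [stConv, stConv, stConv, ← integral_add h h']
  simp only [mul_add]

lemma stConv_const_mul (A g : ℝ × ℝ → ℝ) (c : ℝ) (p : ℝ × ℝ) :
    stConv A (fun q => c * g q) p = c * stConv A g p := by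
  rw [stConv, stConv, ← integral_const_mul]
  simp only [mul_left_comm]

lemma stConv_const_mul_left (A g : ℝ × ℝ → ℝ) (c : ℝ) (p : ℝ × ℝ) :
    stConv (fun q => c * A q) g p = c * stConv A g p := by
  rw [stConv, stConv, ← integral_const_mul]
  simp only [mul_assoc]

lemma stConv_sub_left {A A' g : ℝ × ℝ → ℝ} {p : ℝ × ℝ} (h : Integrable fun q => A (p - q) * g q)
    (h' : Integrable fun q => A' (p - q) * g q) :
    stConv (fun q => A q - A' q) g p = stConv A g p - stConv A' g p := by
  rw [stConv, stConv, stConv, ← integral_sub h h']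
  simp only [sub_mul]

lemma stConv_comp_sub (A g : ℝ × ℝ → ℝ) (r p : ℝ × ℝ) :
    stConv A (fun q => g (q - r)) p = stConv (fun q => A (q - r)) g p := by
  rw [stConv, stConv, ← integral_sub_right_eq_self (fun q => A (p - q - r) * g q) r]
  refine integral_congr_ae (ae_of_all _ fun q => ?_)
  simp only [show p - (q - r) - r = p - q by abel]

namespace IsSmoothingKernel

variable {b C : ℝ} {K D : ℝ → ℝ → ℝ} (hK : IsSmoothingKernel b C K D)
  {R L h m M : ℝ} {f u₀ : ℝ → ℝ} (hf : IsFlux R L f) (hh : 0 < h) (hd : IsDatum R m M u₀)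
  {w v : ℝ × ℝ → ℝ}

include hK in
-- Each `K t` is an antiderivative of an integrable function.
lemma exists_abs_le (t : ℝ) : ∃ B, ∀ x, |K t x| ≤ B := by
  refine ⟨|K t 0| + ∫ x, |D t x|, fun x => ?_⟩
  have h1 := intervalIntegral.integral_eq_sub_of_hasDerivAt (a := 0) (b := x)
    (fun y _ => hK.hasDerivAt t y) ((hK.integrable_deriv t).intervalIntegrable)
  have h2 : |∫ y in (0 : ℝ)..x, D t y| ≤ ∫ x, |D t x| := by
    rw [← Real.norm_eq_abs]
    refine (intervalIntegral.norm_integral_le_integral_norm_uIoc).trans ?_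
    exact setIntegral_le_integral (hK.integrable_deriv t).abs (ae_of_all _ fun _ => abs_nonneg _)
  rw [h1] at h2
  have := abs_sub_abs_le_abs_sub (K t x) (K t 0)
  linarith

include hK in
lemma integrable_mul_kernel (s t x : ℝ) : Integrable fun y => K t (x - y) * K s y := by
  obtain ⟨B, hB⟩ := hK.exists_abs_le t
  refine (hK.integrable s).bdd_mul (c := B) ?_ (ae_of_all _ fun y => hB _)
  exact ((hK.measurable.comp (measurable_const.prodMk measurable_id)).comp
    (measurable_const.sub measurable_id)).aestronglyMeasurable

include hK in
-- A resolvent identity: by the semigroup law the slice at time `s` contributes `μ exp(-μ s) K t`,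
-- and the total mass of `μ exp(-μ s)` on `(0, t)` is `1 - exp(-μ t)`.
lemma stConv_kernel_damped {μ : ℝ} (hμ : 0 < μ) (p : ℝ × ℝ) :
    stConv (uncurry K) (fun q => μ * uncurry (damped K μ) q) p =
      uncurry K p - uncurry (damped K μ) p := by
  obtain ⟨t, x⟩ := p
  have hd0 : ∀ q : ℝ × ℝ, q.1 ≤ 0 → μ * uncurry (damped K μ) q = 0 := fun q hq => by
    simp [uncurry, damped, hK.eq_zero q.1 q.2 hq]
  rcases le_or_gt t 0 with ht | ht
  · rw [stConv_eq_zero ht hK.eq_zero hd0]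
    simp [uncurry, damped, hK.eq_zero t x ht]
  have hslice : ∀ s, 0 < s → s < t →
      ∫ y, K (t - s) (x - y) * (μ * damped K μ s y) = μ * Real.exp (-(μ * s)) * K t x := by
    intro s hs hst
    have h1 := hK.semigroup s (t - s) x hs (sub_pos.mpr hst)
    rw [add_sub_cancel] at h1
    rw [← h1, ← integral_const_mul]
    refine integral_congr_ae (ae_of_all _ fun y => ?_)
    simp only [damped]; ring
  have hm : Measurable fun q : ℝ × ℝ =>
      uncurry K ((t, x) - q) * (μ * uncurry (damped K μ) q) :=
    (hK.measurable.comp (measurable_const.sub measurable_id)).mul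
      ((hK.measurable_damped μ).const_mul μ)
  have hnn : ∀ s y, 0 ≤ K (t - s) (x - y) * (μ * damped K μ s y) := fun s y =>
    mul_nonneg (hK.nonneg _ _) (mul_nonneg hμ.le (mul_nonneg (Real.exp_pos _).le (hK.nonneg _ _)))
  -- The second factor is not known to be bounded on space-time, so `integrable_stConv` is
  -- unavailable; nonnegativity and the slice computation give integrability instead.
  have hi : Integrable fun q : ℝ × ℝ =>
      uncurry K ((t, x) - q) * (μ * uncurry (damped K μ) q) := by
    rw [Measure.volume_eq_prod, integrable_prod_iff hm.aestronglyMeasurable]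
    constructor
    · refine ae_of_all _ fun s => ?_
      refine ((hK.integrable_mul_kernel s (t - s) x).const_mul (μ * Real.exp (-(μ * s)))).congr
        (ae_of_all _ fun y => ?_)
      simp only [uncurry, damped, Prod.mk_sub_mk]; ring
    · have hc : Continuous fun s => μ * Real.exp (-(μ * s)) * K t x := by fun_prop
      have h2 : Integrable ((Set.Ioo 0 t).indicator fun s => μ * Real.exp (-(μ * s)) * K t x) :=
        (hc.integrableOn_Icc.mono_set Set.Ioo_subset_Icc_self).integrable_indicator
          measurableSet_Ioo
      refine h2.congr (ae_of_all _ fun s => ?_)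
      simp only [uncurry, Prod.mk_sub_mk, Real.norm_of_nonneg (hnn s _)]
      by_cases hs : s ∈ Set.Ioo 0 t
      · rw [Set.indicator_of_mem hs, hslice s hs.1 hs.2]
      · rw [Set.indicator_of_notMem hs]
        rw [Set.mem_Ioo, not_and_or, not_lt, not_lt] at hs
        rcases hs with hs | hs
        · simp [damped, hK.eq_zero s _ hs]
        · simp [hK.eq_zero (t - s) _ (sub_nonpos.mpr hs)]
  rw [stConv_eq_intervalIntegral ht.le hK.eq_zero hd0 hi]
  have h3 : ∫ s in (0 : ℝ)..t, ∫ y, K (t - s) (x - y) * (μ * uncurry (damped K μ) (s, y)) =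
      ∫ s in (0 : ℝ)..t, μ * Real.exp (-(μ * s)) * K t x :=
    intervalIntegral.integral_congr_Ioo_of_le ht.le fun s hs => hslice s hs.1 hs.2
  rw [h3, intervalIntegral.integral_mul_const, integral_exp_damping']
  simp only [uncurry, damped]; ring

include hd in
lemma _root_.RieszFeller.IsDatum.radius_nonneg : 0 ≤ R := by
  obtain ⟨y, hy⟩ := hd.bound.exists
  exact (abs_nonneg _).trans hy

include hK hd in
lemma abs_xConv_le_radius (t x : ℝ) : |xConv (K t) u₀ x| ≤ R := by
  refine (abs_xConv_le (hK.integrable t) hd.bound x).trans ?_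
  exact mul_le_of_le_one_left hd.radius_nonneg (hK.integral_abs_le_one t)

include hK hd in
-- The same resolvent identity for the linear evolution of `u₀`.
lemma stConv_kernel_linear {μ : ℝ} (hμ : 0 < μ) {p : ℝ × ℝ} (hp : 0 < p.1) :
    Integrable (fun q : ℝ × ℝ => uncurry K (p - q) *
        if 0 < q.1 then μ * (Real.exp (-(μ * q.1)) * xConv (K q.1) u₀ q.2) else 0) ∧
    stConv (uncurry K) (fun q : ℝ × ℝ => if 0 < q.1 then
        μ * (Real.exp (-(μ * q.1)) * xConv (K q.1) u₀ q.2) else 0) p =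
      (1 - Real.exp (-(μ * p.1))) * xConv (K p.1) u₀ p.2 := by
  obtain ⟨t, x⟩ := p
  have hm : Measurable fun q : ℝ × ℝ => if 0 < q.1 then
      μ * (Real.exp (-(μ * q.1)) * xConv (K q.1) u₀ q.2) else 0 := by
    refine Measurable.ite (measurableSet_lt measurable_const measurable_fst) ?_ measurable_const
    exact ((by fun_prop : Measurable fun q : ℝ × ℝ => Real.exp (-(μ * q.1))).mul
      (measurable_xConv hK.measurable hd.aestronglyMeasurable)).const_mul μ
  have hR := hd.radius_nonneg
  have hB : ∀ q : ℝ × ℝ, |if 0 < q.1 then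
      μ * (Real.exp (-(μ * q.1)) * xConv (K q.1) u₀ q.2) else 0| ≤ μ * R * Real.exp (1 * q.1) := by
    intro q
    split_ifs with hq
    · rw [abs_mul, abs_mul, abs_of_pos hμ, Real.abs_exp, mul_assoc]
      refine mul_le_mul_of_nonneg_left ?_ hμ.le
      rw [mul_comm R]
      refine mul_le_mul (Real.exp_le_exp.mpr ?_) (hK.abs_xConv_le_radius hd _ _) (abs_nonneg _)
        (Real.exp_pos _).le
      nlinarith
    · rw [abs_zero]; positivity
  have hi := integrable_stConv (hK.weightedIntegrable one_pos) hm hB (t, x)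
  refine ⟨hi, ?_⟩
  rw [stConv_eq_intervalIntegral hp.le hK.eq_zero (fun q hq => by simp [not_lt.mpr hq]) hi,
    ← integral_exp_damping', ← intervalIntegral.integral_mul_const]
  refine intervalIntegral.integral_congr_Ioo_of_le hp.le fun s hs => ?_
  obtain ⟨hs, hst⟩ := hs
  simp only [hs, if_true]
  have h1 := hK.xConv_semigroup hd.aestronglyMeasurable hd.bound (sub_pos.mpr hst) hs x
  rw [sub_add_cancel] at h1
  rw [← h1, xConv, ← integral_const_mul]
  refine integral_congr_ae (ae_of_all _ fun y => ?_)
  simp only; ring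

include hK hf hh hd in
/-- A fixed point of the damped scheme solves the undamped scheme. -/
lemma eq_of_upwindMap_eq (hw : IsAdmissible m M (∫⁻ x, ‖u₀ x‖ₑ) w)
    (he : upwindMap K f u₀ (L / h) h w = w) {p : ℝ × ℝ} (hp : 0 < p.1) :
    w p = xConv (K p.1) u₀ p.2 - stConv (diffQuot K h) (fun q => f (w q)) p := by
  have hμ : 0 < L / h := div_pos hf.lipschitz_pos hh
  have hR := hd.radius_nonneg
  set μ := L / h with hμdef
  set g := upwindSource f μ h w with hg
  have hgm : Measurable g := measurable_upwindSource hf.monotone _ h hw.measurable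
  have hgB : ∀ q, |g q| ≤ μ * R * Real.exp (1 * q.1) :=
    abs_upwindSource_le hf hh hd.le_lower hd.upper_le hw zero_le_one
  have hKw := hK.weightedIntegrable one_pos
  have hdw := (hK.weightedIntegrable_damped one_pos hμ).1
  have hKg := integrable_stConv hKw hgm hgB p
  have hdg := integrable_stConv hdw hgm hgB p
  have hwR := hw.abs_le hd.le_lower hd.upper_le hR
  have hexp : ∀ q : ℝ × ℝ, 0 < q.1 → 1 ≤ Real.exp (1 * q.1) := fun q hq =>
    Real.one_le_exp (by linarith)
  have hwB : ∀ q, |w q| ≤ R * Real.exp (1 * q.1) := fun q => by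
    rcases le_or_gt q.1 0 with hq | hq
    · rw [hw.eq_zero q hq, abs_zero]; positivity
    · exact (hwR q).trans (le_mul_of_one_le_right hR (hexp q hq))
  have hFm : Measurable fun q => f (w q) := hf.monotone.measurable.comp hw.measurable
  have hFB : ∀ q, |f (w q)| ≤ L * R * Real.exp (1 * q.1) := fun q => by
    refine (hf.abs_le (hwR q)).trans ?_
    rw [mul_assoc]
    exact mul_le_mul_of_nonneg_left (hwB q) hf.lipschitz_pos.le
  have hwval : ∀ q : ℝ × ℝ, 0 < q.1 → w q = Real.exp (-(μ * q.1)) * xConv (K q.1) u₀ q.2 +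
      stConv (uncurry (damped K μ)) g q := fun q hq => by
    conv_lhs => rw [← he]
    simp only [upwindMap, hq, if_true]
    rfl
  have hμw : (fun q => μ * w q) = fun q => (if 0 < q.1 then
      μ * (Real.exp (-(μ * q.1)) * xConv (K q.1) u₀ q.2) else 0) +
      stConv (fun r => μ * uncurry (damped K μ) r) g q := by
    funext q
    rw [stConv_const_mul_left]
    split_ifs with hq
    · rw [hwval q hq]; ring
    · rw [hw.eq_zero q (not_lt.mp hq), stConv_eq_zero (not_lt.mp hq)
        (fun s x hs => by simp [damped, hK.eq_zero s x hs])
        (fun q hq => upwindSource_of_nonpos _ _ _ _ hq)]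
      simp
  obtain ⟨hi1, e1⟩ := hK.stConv_kernel_linear hd hμ hp
  have hdw' : WeightedIntegrable 1 fun r => μ * uncurry (damped K μ) r := by
    refine (Integrable.const_mul hdw μ).congr (ae_of_all _ fun q => ?_)
    simp only [mul_left_comm]
  have hi3 : Integrable fun q => uncurry K (p - q) * (μ * w q) :=
    integrable_stConv (B := μ * R) hKw (hw.measurable.const_mul μ) (fun q => by
      rw [abs_mul, abs_of_pos hμ, mul_assoc]
      exact mul_le_mul_of_nonneg_left (hwB q) hμ.le) p
  have hi2 : Integrable fun q => uncurry K (p - q) *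
      stConv (fun r => μ * uncurry (damped K μ) r) g q := by
    refine (hi3.sub hi1).congr (ae_of_all _ fun q => ?_)
    have := congrFun hμw q
    simp only [Pi.sub_apply, this]; ring
  -- The two resolvent identities give `K * (μ w) = K(t) * u₀ - w + K * g`. Hence `w` is the linear
  -- evolution plus `K * (g - μ w)`, without damping.
  have e2 : stConv (uncurry K) (fun q => μ * w q) p =
      xConv (K p.1) u₀ p.2 - w p + stConv (uncurry K) g p := by
    rw [hμw, stConv_add hi1 hi2, e1, stConv_stConv hKw hdw' hK.measurable
      ((hK.measurable_damped μ).const_mul μ) hgm hgB,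
      show stConv (uncurry K) (fun r => μ * uncurry (damped K μ) r) =
        fun q => uncurry K q - uncurry (damped K μ) q from
        funext fun q => hK.stConv_kernel_damped hμ q, stConv_sub_left hKg hdg, hwval p hp]
    ring
  -- What survives of the source is minus the backward difference quotient of `f(w)`.
  have hsrc : (fun q => g q - μ * w q) =
      fun q => (-h⁻¹) * (f (w q) - f (w (q - (0, h)))) := by
    funext q
    have e : q - (0, h) = (q.1, q.2 - h) := by ext <;> simp
    rw [e]
    rcases le_or_gt q.1 0 with hq | hq
    · rw [hg, upwindSource_of_nonpos _ _ _ _ hq, hw.eq_zero q hq, hw.eq_zero (q.1, q.2 - h) hq]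
      simp
    · simp only [hg, upwindSource, hq, if_true]
      field_simp; ring
  have hKsw : WeightedIntegrable 1 fun q => uncurry K (q - (0, h)) := by
    have := Integrable.comp_sub_right hKw ((0, h) : ℝ × ℝ)
    refine this.congr (ae_of_all _ fun q => ?_)
    simp
  have hFsB : ∀ q, |f (w (q - (0, h)))| ≤ L * R * Real.exp (1 * q.1) := fun q => by
    have := hFB (q - (0, h))
    rwa [Prod.fst_sub, sub_zero] at this
  have hFsm : Measurable fun q => f (w (q - (0, h))) := hFm.comp (measurable_id.sub_const _)
  -- Translation invariance moves the difference quotient from `f(w)` to the kernel.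
  have e3 : stConv (diffQuot K h) (fun q => f (w q)) p =
      h⁻¹ * (stConv (uncurry K) (fun q => f (w q)) p -
        stConv (uncurry K) (fun q => f (w (q - (0, h)))) p) := by
    rw [stConv_comp_sub (uncurry K) (fun q => f (w q)),
      ← stConv_sub_left (integrable_stConv hKw hFm hFB p) (integrable_stConv hKsw hFm hFB p),
      ← stConv_const_mul_left]
    refine congrFun (congrFun (congrArg stConv (funext fun q => ?_)) _) _
    simp only [diffQuot, uncurry, Prod.fst_sub, Prod.snd_sub, sub_zero]
    field_simp
  have e4 : stConv (uncurry K) g p - stConv (uncurry K) (fun q => μ * w q) p =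
      -h⁻¹ * (stConv (uncurry K) (fun q => f (w q)) p -
        stConv (uncurry K) (fun q => f (w (q - (0, h)))) p) := by
    rw [← stConv_sub hKg hi3, hsrc, stConv_const_mul, stConv_sub (integrable_stConv hKw hFm hFB p)
      (integrable_stConv hKw hFsm hFsB p)]
  rw [e3]
  linarith

end IsSmoothingKernel

/-! ### Solutions of Duhamel's formula -/

/-- The improvement `B ↦ B/2 + c` is iterated to its fixed point `2c`. Used in place of Grönwall's
inequality; the initial constant `B₀` is immaterial. -/
lemma abs_le_of_forall_half {X : Type*} {d W : X → ℝ} {B₀ c : ℝ}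
    (h0 : ∀ q, |d q| ≤ B₀ * W q)
    (h : ∀ B, (∀ q, |d q| ≤ B * W q) → ∀ q, |d q| ≤ (B / 2 + c) * W q) (q : X) :
    |d q| ≤ 2 * c * W q := by
  have h1 : ∀ n : ℕ, ∀ q, |d q| ≤ ((B₀ - 2 * c) * (1 / 2) ^ n + 2 * c) * W q := by
    intro n
    induction n with
    | zero => intro q; simpa using h0 q
    | succ n ih =>
      intro q
      refine (h _ ih q).trans (le_of_eq ?_)
      rw [pow_succ]; ring
  have h2 : Tendsto (fun n : ℕ => ((B₀ - 2 * c) * (1 / 2 : ℝ) ^ n + 2 * c) * W q) atTop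
      (𝓝 (((B₀ - 2 * c) * 0 + 2 * c) * W q)) :=
    (((tendsto_pow_atTop_nhds_zero_of_lt_one (by norm_num) (by norm_num)).const_mul _).add_const
      _).mul_const _
  simpa using ge_of_tendsto' h2 fun n => h1 n q

/-- Functions bounded by `R` that vanish for `t ≤ 0` and satisfy Duhamel's formula for `t > 0`. -/
structure IsDuhamel (K D : ℝ → ℝ → ℝ) (f u₀ : ℝ → ℝ) (R : ℝ) (u : ℝ × ℝ → ℝ) : Prop where
  measurable : Measurable u
  eq_zero : ∀ p : ℝ × ℝ, p.1 ≤ 0 → u p = 0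
  abs_le : ∀ p, |u p| ≤ R
  eq : ∀ p : ℝ × ℝ, 0 < p.1 →
    u p = xConv (K p.1) u₀ p.2 - stConv (uncurry D) (fun q => f (u q)) p

section Flux

variable {R L l : ℝ} {f : ℝ → ℝ} (hf : IsFlux R L f) {u v : ℝ × ℝ → ℝ}
include hf

lemma IsFlux.abs_comp_le (hu : ∀ p : ℝ × ℝ, p.1 ≤ 0 → u p = 0) (hR : ∀ p, |u p| ≤ R)
    (hl : 0 ≤ l) (q : ℝ × ℝ) : |f (u q)| ≤ L * R * Real.exp (l * q.1) := by
  have h1 := hf.lipschitz_pos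
  have h2 := hf.radius_nonneg
  rcases le_or_gt q.1 0 with hq | hq
  · rw [hu q hq, hf.map_zero, abs_zero]; positivity
  · refine (hf.abs_le (hR q)).trans ((mul_le_mul_of_nonneg_left (hR q) h1.le).trans ?_)
    exact le_mul_of_one_le_right (by positivity) (Real.one_le_exp (by positivity))

lemma IsFlux.abs_comp_sub_le {B : ℝ} (hR : ∀ p, |u p| ≤ R) (hR' : ∀ p, |v p| ≤ R)
    (hB : ∀ q, |u q - v q| ≤ B * Real.exp (l * q.1)) (q : ℝ × ℝ) :
    |f (u q) - f (v q)| ≤ L * B * Real.exp (l * q.1) := by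
  refine (hf.lipschitz _ _ (hR q) (hR' q)).trans ?_
  rw [mul_assoc]
  exact mul_le_mul_of_nonneg_left (hB q) hf.lipschitz_pos.le

end Flux

namespace IsSmoothingKernel

variable {b C : ℝ} {K D : ℝ → ℝ → ℝ} (hK : IsSmoothingKernel b C K D)
  {R L m M : ℝ} {f u₀ : ℝ → ℝ} (hf : IsFlux R L f) (hd : IsDatum R m M u₀)

include hK hf hd in
/-- The undamped upwind scheme is solvable. -/
lemma exists_upwind {h : ℝ} (hh : 0 < h) : ∃ w, IsAdmissible m M (∫⁻ x, ‖u₀ x‖ₑ) w ∧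
    ∀ p : ℝ × ℝ, 0 < p.1 →
      w p = xConv (K p.1) u₀ p.2 - stConv (diffQuot K h) (fun q => f (w q)) p := by
  obtain ⟨w, hw, he⟩ := hK.exists_upwindMap_fixedPoint hf hh hd
  exact ⟨w, hw, fun p hp => hK.eq_of_upwindMap_eq hf hh hd hw he hp⟩

include hK hf in
lemma integrable_duhamel {l : ℝ} (hl : 0 < l) {u : ℝ × ℝ → ℝ} (hum : Measurable u)
    (hu : ∀ p : ℝ × ℝ, p.1 ≤ 0 → u p = 0) (hR : ∀ p, |u p| ≤ R) (p : ℝ × ℝ) :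
    Integrable fun q => uncurry D (p - q) * f (u q) :=
  integrable_stConv (hK.weightedIntegrable_deriv hl) (hf.monotone.measurable.comp hum)
    (hf.abs_comp_le hu hR hl.le) p

include hK hf in
lemma abs_duhamel_sub_le {l B : ℝ} (hl : 0 < l) {u v : ℝ × ℝ → ℝ} (hum : Measurable u)
    (hu : ∀ p : ℝ × ℝ, p.1 ≤ 0 → u p = 0) (hR : ∀ p, |u p| ≤ R) (hvm : Measurable v)
    (hv : ∀ p : ℝ × ℝ, p.1 ≤ 0 → v p = 0) (hR' : ∀ p, |v p| ≤ R)
    (hB : ∀ q, |u q - v q| ≤ B * Real.exp (l * q.1)) (p : ℝ × ℝ) :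
    |stConv (uncurry D) (fun q => f (u q)) p - stConv (uncurry D) (fun q => f (v q)) p| ≤
      weightedNorm l (uncurry D) * (L * B) * Real.exp (l * p.1) := by
  rw [← stConv_sub (hK.integrable_duhamel hf hl hum hu hR p)
    (hK.integrable_duhamel hf hl hvm hv hR' p)]
  exact abs_stConv_le (hK.weightedIntegrable_deriv hl) (hf.abs_comp_sub_le hR hR' hB) p

include hK hf in
lemma exists_weight : ∃ l > 0, weightedNorm l (uncurry D) * L ≤ 1 / 2 := by
  have hL := hf.lipschitz_pos
  obtain ⟨l, hl, h⟩ := hK.exists_weightedNorm_deriv_le (ε := 1 / (2 * L)) (by positivity)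
  refine ⟨l, hl, (mul_le_mul_of_nonneg_right h hL.le).trans (le_of_eq ?_)⟩
  field_simp

include hK hf in
-- The datum cancels in the difference, so the halving argument applies with `c = 0`, starting from
-- the trivial bound `2R`.
lemma duhamel_unique {u v : ℝ × ℝ → ℝ} (hu : IsDuhamel K D f u₀ R u)
    (hv : IsDuhamel K D f u₀ R v) : u = v := by
  obtain ⟨l, hl, hl'⟩ := hK.exists_weight hf
  have hR := hf.radius_nonneg
  have hzero : ∀ B, 0 ≤ B → ∀ q : ℝ × ℝ, q.1 ≤ 0 → |u q - v q| ≤ B * Real.exp (l * q.1) := by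
    intro B hB q hq
    rw [hu.eq_zero q hq, hv.eq_zero q hq, sub_zero, abs_zero]
    positivity
  have h1 := abs_le_of_forall_half (d := fun q => u q - v q)
    (W := fun q : ℝ × ℝ => Real.exp (l * q.1)) (B₀ := 2 * R) (c := 0) ?_ ?_
  · funext q
    have := h1 q
    simpa [sub_eq_zero] using this
  · intro q
    rcases le_or_gt q.1 0 with hq | hq
    · exact hzero _ (by positivity) q hq
    · refine (abs_sub _ _).trans ?_
      have h2 := hu.abs_le q
      have h3 := hv.abs_le q
      have h4 : 1 ≤ Real.exp (l * q.1) := Real.one_le_exp (by positivity)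
      nlinarith
  · intro B hB q
    have hB0 : 0 ≤ B := by simpa using (abs_nonneg _).trans (hB 0)
    rcases le_or_gt q.1 0 with hq | hq
    · exact hzero _ (by positivity) q hq
    · rw [hu.eq q hq, hv.eq q hq, sub_sub_sub_cancel_left, abs_sub_comm]
      refine (hK.abs_duhamel_sub_le hf hl hu.measurable hu.eq_zero hu.abs_le hv.measurable
        hv.eq_zero hv.abs_le hB q).trans ?_
      gcongr
      nlinarith

include hK hf hd in
-- Consistency and stability of the scheme: upwind solutions satisfy Duhamel's formula up to a small
-- weighted error, the contraction turns these errors into a Cauchy estimate, and the limit inherits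
-- range and `L¹` bound.
theorem exists_duhamel : ∃ u, IsAdmissible m M (∫⁻ x, ‖u₀ x‖ₑ) u ∧ IsDuhamel K D f u₀ R u := by
  obtain ⟨l, hl, hl'⟩ := hK.exists_weight hf
  have hR := hf.radius_nonneg
  have hL := hf.lipschitz_pos
  set κ := weightedNorm l (uncurry D) with hκ
  have hκ0 : 0 ≤ κ := weightedNorm_nonneg _ _
  set E : ℝ × ℝ → ℝ := fun q => Real.exp (l * q.1) with hE
  have hE0 : ∀ q, 0 < E q := fun q => Real.exp_pos _
  have hstep : ∀ n : ℕ, ∃ w : ℝ × ℝ → ℝ, IsAdmissible m M (∫⁻ x, ‖u₀ x‖ₑ) w ∧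
      ∀ p : ℝ × ℝ, 0 < p.1 →
        |w p - (xConv (K p.1) u₀ p.2 - stConv (uncurry D) (fun q => f (w q)) p)| ≤
          (1 / 2) ^ n * (L * R) * E p := by
    intro n
    -- The mesh is `δ/2`, chosen so that the difference quotient is within `2^(-n)` of `D` in the
    -- weighted norm.
    obtain ⟨δ, hδ, hδ'⟩ := hK.exists_weightedNorm_diffQuot_sub_le hl
      (ε := (1 / 2 : ℝ) ^ n) (by positivity)
    obtain ⟨w, hw, hwe⟩ := hK.exists_upwind hf hd (half_pos hδ)
    have hwR := hw.abs_le hd.le_lower hd.upper_le hR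
    refine ⟨w, hw, fun p hp => ?_⟩
    have hFm : Measurable fun q => f (w q) := hf.monotone.measurable.comp hw.measurable
    have hFB := hf.abs_comp_le hw.eq_zero hwR hl.le
    have hq := hK.weightedIntegrable_diffQuot hl (δ / 2)
    have hD := hK.weightedIntegrable_deriv hl
    rw [hwe p hp, sub_sub_sub_cancel_left, abs_sub_comm, ← stConv_sub_left
      (integrable_stConv hq hFm hFB p) (integrable_stConv hD hFm hFB p)]
    refine (abs_stConv_le (hq.sub hD) hFB p).trans ?_
    gcongr
    exact hδ' _ (half_pos hδ) (half_lt_self hδ)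
  choose w hw hwe using hstep
  have hwR : ∀ n p, |w n p| ≤ R := fun n => (hw n).abs_le hd.le_lower hd.upper_le hR
  -- Two Duhamel errors of size `2^(-n) L R` give `c = 2 · 2^(-n) L R`, and the halving argument
  -- doubles it: hence the factor `4`.
  have hdist : ∀ n k, n ≤ k → ∀ q, |w n q - w k q| ≤ 4 * ((1 / 2) ^ n * (L * R)) * E q := by
    intro n k hnk
    have hzero : ∀ B, 0 ≤ B → ∀ q : ℝ × ℝ, q.1 ≤ 0 → |w n q - w k q| ≤ B * E q := by
      intro B hB q hq
      rw [(hw n).eq_zero q hq, (hw k).eq_zero q hq, sub_zero, abs_zero]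
      exact mul_nonneg hB (hE0 q).le
    have h1 := abs_le_of_forall_half (d := fun q => w n q - w k q) (W := E) (B₀ := 2 * R)
      (c := 2 * ((1 / 2) ^ n * (L * R))) ?_ ?_
    · intro q
      refine (h1 q).trans (le_of_eq ?_)
      ring
    · intro q
      rcases le_or_gt q.1 0 with hq | hq
      · exact hzero _ (by positivity) q hq
      · refine (abs_sub _ _).trans ?_
        have h2 := hwR n q
        have h3 := hwR k q
        have h4 : 1 ≤ E q := Real.one_le_exp (by positivity)
        nlinarith
    · intro B hB q
      have hB0 : 0 ≤ B := nonneg_of_mul_nonneg_left ((abs_nonneg _).trans (hB 0)) (hE0 0)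
      rcases le_or_gt q.1 0 with hq | hq
      · exact hzero _ (by positivity) q hq
      · have h1 := hwe n q hq
        have h2 := hwe k q hq
        have h3 := hK.abs_duhamel_sub_le hf hl (hw n).measurable (hw n).eq_zero (hwR n)
          (hw k).measurable (hw k).eq_zero (hwR k) hB q
        have h4 : κ * (L * B) * E q ≤ B / 2 * E q := by
          refine mul_le_mul_of_nonneg_right ?_ (hE0 q).le
          nlinarith
        have h5 : (1 / 2 : ℝ) ^ k * (L * R) * E q ≤ (1 / 2) ^ n * (L * R) * E q := by
          have := pow_le_pow_of_le_one (by norm_num : (0:ℝ) ≤ 1 / 2) (by norm_num) hnk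
          have := (hE0 q).le
          gcongr
        rw [abs_le] at h1 h2 h3 ⊢
        constructor <;> linarith
  have hb0 : ∀ c q, Tendsto (fun n : ℕ => c * ((1 / 2 : ℝ) ^ n * (L * R)) * E q) atTop (𝓝 0) := by
    intro c q
    have := (((tendsto_pow_atTop_nhds_zero_of_lt_one (r := (1 / 2 : ℝ)) (by norm_num)
      (by norm_num)).mul_const (L * R)).const_mul c).mul_const (E q)
    simpa using this
  have hcauchy : ∀ q, CauchySeq fun n => w n q := fun q =>
    cauchySeq_of_le_tendsto_0' _ (fun n k hnk => hdist n k hnk q) (hb0 4 q)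
  choose u hu using fun q => cauchySeq_tendsto_of_complete (hcauchy q)
  have huA : IsAdmissible m M (∫⁻ x, ‖u₀ x‖ₑ) u := .of_tendsto hw hu
  have huR := huA.abs_le hd.le_lower hd.upper_le hR
  refine ⟨u, huA, huA.measurable, huA.eq_zero, huR, fun p hp => ?_⟩
  have hdu : ∀ n q, |w n q - u q| ≤ 4 * ((1 / 2) ^ n * (L * R)) * E q := fun n q =>
    le_of_tendsto (((hu q).const_sub (w n q)).abs)
      (eventually_atTop.mpr ⟨n, fun k hk => hdist n k hk q⟩)
  have hlim1 : Tendsto (fun n => stConv (uncurry D) (fun q => f (w n q)) p) atTop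
      (𝓝 (stConv (uncurry D) (fun q => f (u q)) p)) := by
    refine tendsto_iff_dist_tendsto_zero.mpr (squeeze_zero (fun _ => dist_nonneg) (fun n =>
      hK.abs_duhamel_sub_le hf hl (hw n).measurable (hw n).eq_zero (hwR n) huA.measurable
        huA.eq_zero huR (hdu n) p) ?_)
    refine (hb0 (κ * L * 4) p).congr fun n => ?_
    ring
  have hlim2 : Tendsto (fun n => w n p) atTop
      (𝓝 (xConv (K p.1) u₀ p.2 - stConv (uncurry D) (fun q => f (u q)) p)) := by
    have h1 : Tendsto (fun n => w n p -
        (xConv (K p.1) u₀ p.2 - stConv (uncurry D) (fun q => f (w n q)) p)) atTop (𝓝 0) := by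
      rw [tendsto_zero_iff_abs_tendsto_zero]
      refine squeeze_zero (fun _ => abs_nonneg _) (fun n => hwe n p hp) ?_
      simpa using hb0 1 p
    simpa using h1.add (hlim1.const_sub (xConv (K p.1) u₀ p.2))
  exact tendsto_nhds_unique (hu p) hlim2

end IsSmoothingKernel

/-! ### Continuity and restarting -/

lemma IsDuhamel.mono {K D : ℝ → ℝ → ℝ} {f u₀ : ℝ → ℝ} {R R' : ℝ} {u : ℝ × ℝ → ℝ}
    (hu : IsDuhamel K D f u₀ R u) (h : R ≤ R') : IsDuhamel K D f u₀ R' u :=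
  ⟨hu.measurable, hu.eq_zero, fun p => (hu.abs_le p).trans h, hu.eq⟩

lemma IsDuhamel.isDatum {K D : ℝ → ℝ → ℝ} {f u₀ : ℝ → ℝ} {R : ℝ} {u : ℝ × ℝ → ℝ}
    (hu : IsDuhamel K D f u₀ R u) (s : ℝ) : IsDatum R (-R) R fun x => u (s, x) where
  aestronglyMeasurable :=
    (hu.measurable.comp (measurable_const.prodMk measurable_id)).aestronglyMeasurable
  le_lower := le_rfl
  upper_le := le_rfl
  lower := ae_of_all _ fun x => (_root_.abs_le.mp (hu.abs_le (s, x))).1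
  upper := ae_of_all _ fun x => (_root_.abs_le.mp (hu.abs_le (s, x))).2

lemma measurable_of_continuousOn_pos {u : ℝ × ℝ → ℝ} (hu0 : ∀ p : ℝ × ℝ, p.1 ≤ 0 → u p = 0)
    (hc : ContinuousOn u {p | 0 < p.1}) : Measurable u := by
  classical
  have ho : IsOpen {p : ℝ × ℝ | 0 < p.1} := isOpen_lt continuous_const continuous_fst
  have h1 := hc.measurable_piecewise (g := fun _ => 0) continuousOn_const ho.measurableSet
  convert h1 using 1
  funext p
  by_cases hp : 0 < p.1
  · simp [Set.piecewise, hp]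
  · simp [Set.piecewise, hp, hu0 p (not_lt.mp hp)]

namespace IsSmoothingKernel

variable {b C : ℝ} {K D : ℝ → ℝ → ℝ} (hK : IsSmoothingKernel b C K D)
  {R L m M : ℝ} {f u₀ : ℝ → ℝ} (hf : IsFlux R L f) (hd : IsDatum R m M u₀) {u : ℝ × ℝ → ℝ}

include hK hd in
lemma tendstoUniformly_duhamel {g : ℝ × ℝ → ℝ} {l B : ℝ} (hl : 0 < l) (hg : Measurable g)
    (hB : ∀ q, |g q| ≤ B * Real.exp (l * q.1)) {t : ℝ} (ht : 0 < t) :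
    TendstoUniformly (fun s x => xConv (K s) u₀ x - stConv (uncurry D) g (s, x))
      (fun x => xConv (K t) u₀ x - stConv (uncurry D) g (t, x)) (𝓝 t) :=
  (hK.tendstoUniformly_xConv hd.aestronglyMeasurable hd.bound ht).sub
    (tendstoUniformly_stConv (hK.weightedIntegrable_deriv hl) hg hB t)

include hK hd in
lemma continuousAt_duhamel {g : ℝ × ℝ → ℝ} {l B : ℝ} (hl : 0 < l) (hg : Measurable g)
    (hB : ∀ q, |g q| ≤ B * Real.exp (l * q.1)) {p : ℝ × ℝ} (hp : 0 < p.1) :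
    ContinuousAt (fun p : ℝ × ℝ => xConv (K p.1) u₀ p.2 - stConv (uncurry D) g p) p := by
  refine continuousAt_of_tendstoUniformly (hK.tendstoUniformly_duhamel hd hl hg hB hp) ?_ p.2
  refine Continuous.sub ?_ ?_
  · exact (uniformContinuous_xConv (hK.integrable _) hd.aestronglyMeasurable hd.bound).continuous
  · exact (continuous_stConv (hK.weightedIntegrable_deriv hl) hg hB).comp
      (continuous_const.prodMk continuous_id)

include hK hf hd in
lemma _root_.RieszFeller.IsDuhamel.tendstoUniformly (hu : IsDuhamel K D f u₀ R u) {t : ℝ}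
    (ht : 0 < t) : TendstoUniformly (fun s x => u (s, x)) (fun x => u (t, x)) (𝓝 t) := by
  have h1 := hK.tendstoUniformly_duhamel hd one_pos (hf.monotone.measurable.comp hu.measurable)
    (hf.abs_comp_le hu.eq_zero hu.abs_le zero_le_one) ht
  have h2 : (fun x => u (t, x)) =
      fun x => xConv (K t) u₀ x - stConv (uncurry D) (f ∘ u) (t, x) :=
    funext fun x => hu.eq (t, x) ht
  rw [h2]
  intro V hV
  filter_upwards [lt_mem_nhds ht, h1 V hV] with s hs h x
  rw [hu.eq (s, x) hs]
  exact h x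

include hK hf hd in
lemma _root_.RieszFeller.IsDuhamel.continuousAt (hu : IsDuhamel K D f u₀ R u) {p : ℝ × ℝ}
    (hp : 0 < p.1) : ContinuousAt u p := by
  refine (hK.continuousAt_duhamel hd one_pos (hf.monotone.measurable.comp hu.measurable)
    (hf.abs_comp_le hu.eq_zero hu.abs_le zero_le_one) hp).congr ?_
  filter_upwards [(isOpen_lt continuous_const continuous_fst).mem_nhds hp] with q hq
  exact (hu.eq q hq).symm

include hK hf hd in
-- Both sides are continuous on the open half plane, so equality almost everywhere is equality
-- everywhere there.
lemma isDuhamel_of_ae (hu0 : ∀ p : ℝ × ℝ, p.1 ≤ 0 → u p = 0) (hR : ∀ p, |u p| ≤ R)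
    (hc : ContinuousOn u {p | 0 < p.1}) (he : ∀ᵐ p ∂(volume.restrict {p : ℝ × ℝ | 0 < p.1}),
      u p = xConv (K p.1) u₀ p.2 - stConv (uncurry D) (fun q => f (u q)) p) :
    IsDuhamel K D f u₀ R u := by
  have ho : IsOpen {p : ℝ × ℝ | 0 < p.1} := isOpen_lt continuous_const continuous_fst
  have hum := measurable_of_continuousOn_pos hu0 hc
  refine ⟨hum, hu0, hR, fun p hp => ?_⟩
  refine Measure.eqOn_open_of_ae_eq he ho hc (fun p hp => ?_) hp
  exact (hK.continuousAt_duhamel hd one_pos (hf.monotone.measurable.comp hum)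
    (hf.abs_comp_le hu0 hR zero_le_one) hp).continuousWithinAt

include hK hf hd in
-- The Duhamel integral at time `s + t` is cut at time `s`. By the semigroup law for `D`, the
-- earlier part is what `K t` produces from the Duhamel term of `u(s, ·)`; the later part is the
-- restarted integral.
lemma _root_.RieszFeller.IsDuhamel.restart (hu : IsDuhamel K D f u₀ R u) {s : ℝ} (hs : 0 < s) :
    IsDuhamel K D f (fun x => u (s, x)) R
      (fun p => if 0 < p.1 then u (s + p.1, p.2) else 0) where
  measurable := Measurable.ite (measurableSet_lt measurable_const measurable_fst)
    (hu.measurable.comp (by fun_prop)) measurable_const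
  eq_zero p hp := by simp [not_lt.mpr hp]
  abs_le p := by
    split_ifs
    · exact hu.abs_le _
    · simpa using hf.radius_nonneg
  eq p hp := by
    obtain ⟨t, x⟩ := p
    have ht : 0 < t := hp
    simp only [hp, if_true]
    have hFm : Measurable (f ∘ u) := hf.monotone.measurable.comp hu.measurable
    have hFB := hf.abs_comp_le hu.eq_zero hu.abs_le zero_le_one
    have hDw := hK.weightedIntegrable_deriv one_pos
    set F := f ∘ u with hF
    have hi := integrable_stConv hDw hFm hFB (s + t, x)
    have e1 : xConv (K t) (fun y => u (s, y)) x = xConv (K (s + t)) u₀ x -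
        ∫ q in {q : ℝ × ℝ | q.1 < s}, uncurry D ((s + t, x) - q) * F q := by
      have h1 : (fun y => u (s, y)) =
          fun y => xConv (K s) u₀ y - stConv (uncurry D) F (s, y) :=
        funext fun y => hu.eq (s, y) hs
      have h2 : xConv (K t) (fun y => xConv (K s) u₀ y - stConv (uncurry D) F (s, y)) x =
          xConv (K t) (xConv (K s) u₀) x - xConv (K t) (fun y => stConv (uncurry D) F (s, y)) x := by
        have hc1 : Continuous (xConv (K s) u₀) :=
          (uniformContinuous_xConv (hK.integrable s) hd.aestronglyMeasurable hd.bound).continuous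
        have hc2 : Continuous fun y => stConv (uncurry D) F (s, y) :=
          (continuous_stConv hDw hFm hFB).comp (continuous_const.prodMk continuous_id)
        simp only [xConv, mul_sub]
        refine integral_sub ?_ ?_
        · exact integrable_xConv (hK.integrable t) hc1.aestronglyMeasurable
            (ae_of_all _ fun y => hK.abs_xConv_le_radius hd s y) x
        · exact integrable_xConv (R := weightedNorm 1 (uncurry D) * (L * R) * Real.exp (1 * s))
            (hK.integrable t) hc2.aestronglyMeasurable
            (ae_of_all _ fun y => abs_stConv_le hDw (g := F) hFB (s, y)) x
      rw [h1, h2, hK.xConv_semigroup hd.aestronglyMeasurable hd.bound ht hs, add_comm t s,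
        xConv_stConv (hK.integrable t)
          (hK.measurable.comp (measurable_const.prodMk measurable_id)) hDw hK.measurable_deriv hFm
          hFB, ← integral_indicator (measurableSet_lt measurable_fst measurable_const)]
      congr 1
      refine integral_congr_ae (ae_of_all _ fun q => ?_)
      simp only [uncurry, Set.indicator, Set.mem_ofPred_eq, Prod.fst_sub, Prod.snd_sub]
      split_ifs with hq
      · have := congrFun (hK.xConv_deriv_eq ht (sub_pos.mpr hq)) (x - q.2)
        rw [show (fun z => D (s - q.1) z) = D (s - q.1) from rfl, this,
          show t + (s - q.1) = s + t - q.1 by ring]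
      · have : ∀ z, D (s - q.1) z = 0 := fun z => hK.deriv_eq_zero _ _ (by linarith)
        simp [this, xConv]
    have e2 : stConv (uncurry D) (fun q => f (if 0 < q.1 then u (s + q.1, q.2) else 0)) (t, x) =
        ∫ q in {q : ℝ × ℝ | q.1 < s}ᶜ, uncurry D ((s + t, x) - q) * F q := by
      rw [stConv, ← integral_indicator (measurableSet_lt measurable_fst measurable_const).compl,
        ← integral_add_right_eq_self (Set.indicator {q : ℝ × ℝ | q.1 < s}ᶜ
          fun q => uncurry D ((s + t, x) - q) * F q) ((s, 0) : ℝ × ℝ)]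
      -- At time `0` the restarted function is `0` instead of `u(s, ·)`; this line is null.
      have hae : ∀ᵐ q : ℝ × ℝ, q.1 ≠ 0 :=
        Measure.quasiMeasurePreserving_fst.ae (compl_mem_ae_iff.mpr (measure_singleton (0 : ℝ)))
      refine integral_congr_ae ?_
      filter_upwards [hae] with q hq
      simp only [Set.indicator, Set.mem_compl_iff, Set.mem_ofPred_eq, Prod.fst_add, not_lt, hF,
        le_add_iff_nonneg_left, Function.comp_apply]
      rcases lt_or_gt_of_ne hq with h | h
      · rw [if_neg (not_lt.mpr h.le), if_neg (not_le.mpr h), hf.map_zero, mul_zero]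
      · rw [if_pos h, if_pos h.le]
        congr 2
        · ext <;> simp; ring
        · congr 1
          ext <;> simp [add_comm]
    rw [e1, e2, sub_sub, integral_add_compl (measurableSet_lt measurable_fst measurable_const) hi]
    exact hu.eq (s + t, x) (add_pos hs ht)

end IsSmoothingKernel

/-! ### Lipschitz bounds -/

lemma stConv_add_right (A g : ℝ × ℝ → ℝ) (p r : ℝ × ℝ) :
    stConv A g (p + r) = stConv A (fun q => g (q + r)) p := by
  rw [stConv, stConv, ← integral_add_right_eq_self (fun q => A (p + r - q) * g q) r]
  simp only [add_sub_add_right_eq_sub]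

/-- Subadditivity of `x ↦ x^b` separates the singularities at the two ends of `(0, t)`, so that
elementary integrals suffice instead of a Beta function. -/
lemma rpow_neg_mul_rpow_neg_le {b s t : ℝ} (hb : 0 < b) (hb' : b < 1) (hs : 0 < s) (hst : s < t) :
    (t - s) ^ (-b) * s ^ (-b) ≤ t ^ (-b) * ((t - s) ^ (-b) + s ^ (-b)) := by
  have ht : 0 < t := hs.trans hst
  have hts : 0 < t - s := sub_pos.mpr hst
  have h1 : t ^ b ≤ (t - s) ^ b + s ^ b := by
    have := Real.rpow_add_le_add_rpow hts.le hs.le hb.le hb'.le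
    rwa [sub_add_cancel] at this
  rw [Real.rpow_neg ht.le, Real.rpow_neg hts.le, Real.rpow_neg hs.le]
  have p1 := Real.rpow_pos_of_pos ht b
  have p2 := Real.rpow_pos_of_pos hts b
  have p3 := Real.rpow_pos_of_pos hs b
  rw [← mul_inv, inv_mul_eq_div, le_div_iff₀ p1, inv_mul_eq_div, div_le_iff₀ (mul_pos p2 p3)]
  calc t ^ b ≤ (t - s) ^ b + s ^ b := h1
    _ = _ := by field_simp; ring

lemma intervalIntegrable_and_integral_rpow_add {b t : ℝ} (hb' : b < 1) :
    IntervalIntegrable (fun s => (t - s) ^ (-b) + s ^ (-b)) volume 0 t ∧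
    ∫ s in (0 : ℝ)..t, ((t - s) ^ (-b) + s ^ (-b)) = 2 * (t ^ (1 - b) / (1 - b)) := by
  have h1 : IntervalIntegrable (fun s : ℝ => s ^ (-b)) volume 0 t :=
    intervalIntegral.intervalIntegrable_rpow' (by linarith)
  have h2 : IntervalIntegrable (fun s : ℝ => (t - s) ^ (-b)) volume 0 t := by
    simpa using (h1.comp_sub_left t).symm
  refine ⟨h2.add h1, ?_⟩
  rw [intervalIntegral.integral_add h2 h1,
    intervalIntegral.integral_comp_sub_left (fun s : ℝ => s ^ (-b)) t, sub_self, sub_zero,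
    integral_rpow (Or.inl (by linarith)), Real.zero_rpow (by linarith), sub_zero,
    show -b + 1 = 1 - b by ring]
  ring

namespace IsSmoothingKernel

variable {b C : ℝ} {K D : ℝ → ℝ → ℝ} (hK : IsSmoothingKernel b C K D)
  {R L m M : ℝ} {f u₀ : ℝ → ℝ} (hf : IsFlux R L f) (hd : IsDatum R m M u₀) {u : ℝ × ℝ → ℝ}

include hK in
lemma abs_stConv_deriv_le {g : ℝ × ℝ → ℝ} {γ ψ : ℝ → ℝ} {t x : ℝ} (ht : 0 < t)
    (hi : Integrable fun q => uncurry D ((t, x) - q) * g q)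
    (hg : ∀ q : ℝ × ℝ, q.1 ≤ 0 → g q = 0) (hγ : ∀ s y, 0 < s → s < t → |g (s, y)| ≤ γ s)
    (hψ : ∀ s, 0 < s → s < t → (t - s) ^ (-b) * γ s ≤ ψ s)
    (hψi : IntervalIntegrable ψ volume 0 t) :
    |stConv (uncurry D) g (t, x)| ≤ C * ∫ s in (0 : ℝ)..t, ψ s := by
  rw [stConv_eq_intervalIntegral ht.le hK.deriv_eq_zero hg hi, ← intervalIntegral.integral_const_mul,
    ← Real.norm_eq_abs]
  refine intervalIntegral.norm_integral_le_of_norm_le ht.le ?_ (hψi.const_mul C)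
  have hne : ∀ᵐ s : ℝ, s ≠ t := compl_mem_ae_iff.mpr (measure_singleton t)
  filter_upwards [hne] with s hs hs'
  have hst : s < t := lt_of_le_of_ne hs'.2 hs
  have h1 := abs_xConv_le (hK.integrable_deriv (t - s)) (u₀ := fun y => g (s, y)) (R := γ s)
    (ae_of_all _ fun y => hγ s y hs'.1 hst) x
  have hγ0 : 0 ≤ γ s := (abs_nonneg _).trans (hγ s 0 hs'.1 hst)
  refine h1.trans ((mul_le_mul_of_nonneg_right
    (hK.integral_abs_deriv_le _ (sub_pos.mpr hst)) hγ0).trans ?_)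
  rw [mul_assoc]
  exact mul_le_mul_of_nonneg_left (hψ s hs'.1 hst) hK.const_nonneg

include hK hd in
lemma abs_xConv_sub_le {t : ℝ} (ht : 0 < t) (x y : ℝ) :
    |xConv (K t) u₀ y - xConv (K t) u₀ x| ≤ C * t ^ (-b) * R * |y - x| := by
  refine Convex.norm_image_sub_le_of_norm_hasDerivWithin_le (s := Set.univ)
    (fun z _ => (hK.hasDerivAt_xConv hd.aestronglyMeasurable hd.bound t z).hasDerivWithinAt)
    (fun z _ => ?_) convex_univ (Set.mem_univ x) (Set.mem_univ y)
  exact (abs_xConv_le (hK.integrable_deriv t) hd.bound z).trans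
    (mul_le_mul_of_nonneg_right (hK.integral_abs_deriv_le t ht) hd.radius_nonneg)

include hK hf in
-- The estimate `B t^(-b)` is fed into Duhamel's formula and returns with `B/2` plus the linear
-- contribution when `T` is small. Finite differences are used because they satisfy a first bound of
-- this kind trivially. `T` and `A` are chosen before the datum and the solution, so they serve all
-- restarts.
lemma exists_lipschitz_of_le : ∃ T > 0, ∃ A ≥ 0, ∀ (u₀ : ℝ → ℝ) (u : ℝ × ℝ → ℝ) (m M : ℝ),
    IsDatum R m M u₀ → IsDuhamel K D f u₀ R u → ∀ t, 0 < t → t ≤ T → ∀ x δ,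
      |u (t, x + δ) - u (t, x)| ≤ A * |δ| * t ^ (-b) := by
  have hR := hf.radius_nonneg
  have hL := hf.lipschitz_pos
  have hC := hK.const_nonneg
  have hb' := hK.exponent_lt_one
  have hlim : Tendsto (fun T : ℝ => C * L * (2 * (T ^ (1 - b) / (1 - b)))) (𝓝[>] 0) (𝓝 0) := by
    have h1 : Tendsto (fun T : ℝ => T ^ (1 - b)) (𝓝[>] 0) (𝓝 0) := by
      have h2 : ContinuousAt (fun T : ℝ => T ^ (1 - b)) 0 :=
        Real.continuousAt_rpow_const 0 (1 - b) (Or.inr (by linarith))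
      have h3 := h2.tendsto.mono_left (nhdsWithin_le_nhds (s := Set.Ioi 0))
      rwa [Real.zero_rpow (by linarith)] at h3
    simpa using ((h1.div_const (1 - b)).const_mul 2).const_mul (C * L)
  obtain ⟨T, hTs, hT⟩ := ((hlim.eventually (ge_mem_nhds (by norm_num : (0 : ℝ) < 1 / 2))).and
    self_mem_nhdsWithin).exists
  have hT0 : 0 < T := hT
  refine ⟨T, hT0, 2 * (C * R), by positivity, fun u₀ u m M hd hu t ht htT x δ => ?_⟩
  set X := {p : ℝ × ℝ // 0 < p.1 ∧ p.1 ≤ T} with hX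
  have hW0 : ∀ p : X, 0 < p.1.1 ^ (-b) := fun p => Real.rpow_pos_of_pos p.2.1 _
  -- `B₀` comes from `|u| ≤ R` and `t ≤ T`; `c` is the Lipschitz bound for the linear evolution.
  have key := abs_le_of_forall_half (X := X)
    (d := fun p => u (p.1.1, p.1.2 + δ) - u (p.1.1, p.1.2)) (W := fun p => p.1.1 ^ (-b))
    (B₀ := 2 * R * T ^ b) (c := C * R * |δ|) ?_ ?_ ⟨(t, x), ht, htT⟩
  · refine key.trans (le_of_eq ?_)
    simp only; ring
  · rintro ⟨⟨t, x⟩, ht, htT⟩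
    simp only at ht htT ⊢
    have h1 := hu.abs_le (t, x + δ)
    have h2 := hu.abs_le (t, x)
    have h3 : 1 ≤ T ^ b * t ^ (-b) := by
      rw [Real.rpow_neg ht.le, ← div_eq_mul_inv, one_le_div (Real.rpow_pos_of_pos ht _)]
      exact Real.rpow_le_rpow ht.le htT hK.exponent_pos.le
    refine (abs_sub _ _).trans ?_
    rw [mul_assoc]
    nlinarith
  · rintro B hB ⟨⟨t, x⟩, ht, htT⟩
    simp only at ht htT ⊢
    have hB0 : 0 ≤ B := nonneg_of_mul_nonneg_left
      ((abs_nonneg _).trans (hB ⟨(T, 0), hT0, le_rfl⟩)) (hW0 ⟨(T, 0), hT0, le_rfl⟩)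
    have hFm : Measurable fun q => f (u q) := hf.monotone.measurable.comp hu.measurable
    have hFB := hf.abs_comp_le hu.eq_zero hu.abs_le zero_le_one
    have hDw := hK.weightedIntegrable_deriv one_pos
    have hFm' : Measurable fun q => f (u (q + (0, δ))) := hFm.comp (measurable_id.add_const _)
    have hFB' : ∀ q, |f (u (q + (0, δ)))| ≤ L * R * Real.exp (1 * q.1) := fun q => by
      have := hFB (q + (0, δ))
      rwa [Prod.fst_add, add_zero] at this
    have e1 : stConv (uncurry D) (fun q => f (u q)) (t, x + δ) -
        stConv (uncurry D) (fun q => f (u q)) (t, x) =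
        stConv (uncurry D) (fun q => f (u (q + (0, δ))) - f (u q)) (t, x) := by
      rw [stConv_sub (integrable_stConv hDw hFm' hFB' _) (integrable_stConv hDw hFm hFB _)]
      have := stConv_add_right (uncurry D) (fun q => f (u q)) (t, x) (0, δ)
      rw [Prod.mk_add_mk, add_zero] at this
      rw [this]
    obtain ⟨hψi, hψ⟩ := intervalIntegrable_and_integral_rpow_add (t := t) hb'
    have h2 := hK.abs_stConv_deriv_le (g := fun q => f (u (q + (0, δ))) - f (u q))
      (γ := fun s => L * (B * s ^ (-b)))
      (ψ := fun s => L * B * t ^ (-b) * ((t - s) ^ (-b) + s ^ (-b))) (x := x) ht ?_ ?_ ?_ ?_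
      (hψi.const_mul _)
    · rw [intervalIntegral.integral_const_mul, hψ, ← e1] at h2
      have h3 := hK.abs_xConv_sub_le hd ht x (x + δ)
      rw [add_sub_cancel_left] at h3
      rw [hu.eq _ ht, hu.eq _ ht]
      have h4 : C * (L * B * t ^ (-b) * (2 * (t ^ (1 - b) / (1 - b)))) ≤ B / 2 * t ^ (-b) := by
        have h5 : C * L * (2 * (t ^ (1 - b) / (1 - b))) ≤ 1 / 2 := by
          refine le_trans ?_ hTs
          have h6 := Real.rpow_le_rpow ht.le htT (by linarith : 0 ≤ 1 - b)
          have h7 : 0 < 1 - b := by linarith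
          gcongr
        have h8 := mul_le_mul_of_nonneg_left h5
          (mul_nonneg hB0 (Real.rpow_pos_of_pos ht (-b)).le)
        calc _ = B * t ^ (-b) * (C * L * (2 * (t ^ (1 - b) / (1 - b)))) := by ring
          _ ≤ _ := h8
          _ = _ := by ring
      simp only
      rw [abs_le] at h2 h3 ⊢
      constructor <;> linarith
    · refine ((integrable_stConv hDw hFm' hFB' (t, x)).sub
        (integrable_stConv hDw hFm hFB (t, x))).congr (ae_of_all _ fun q => ?_)
      simp only [Pi.sub_apply]; ring
    · intro q hq
      have : (q + (0, δ)).1 ≤ 0 := by simpa using hq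
      simp only [hu.eq_zero q hq, hu.eq_zero _ this, sub_self]
    · intro s y hs hst
      refine (hf.lipschitz _ _ (hu.abs_le _) (hu.abs_le _)).trans ?_
      refine mul_le_mul_of_nonneg_left ?_ hL.le
      have := hB ⟨(s, y), hs, (hst.trans_le htT).le⟩
      simpa using this
    · intro s hs hst
      have := rpow_neg_mul_rpow_neg_le hK.exponent_pos hb' hs hst
      have h9 := mul_le_mul_of_nonneg_left this (mul_nonneg hL.le hB0)
      calc _ = L * B * ((t - s) ^ (-b) * s ^ (-b)) := by ring
        _ ≤ _ := h9
        _ = _ := by ring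

include hK hf hd in
-- Every `t ≥ t₀` is reached by restarting a fixed time `τ` earlier, so the constant is uniform in
-- `t`.
lemma _root_.RieszFeller.IsDuhamel.exists_lipschitz (hu : IsDuhamel K D f u₀ R u) {t₀ : ℝ}
    (ht₀ : 0 < t₀) :
    ∃ Λ ≥ 0, ∀ t, t₀ ≤ t → ∀ x y, |u (t, x) - u (t, y)| ≤ Λ * |x - y| := by
  obtain ⟨T, hT, A, hA, h⟩ := hK.exists_lipschitz_of_le hf
  have hτ : 0 < min (t₀ / 2) T := lt_min (half_pos ht₀) hT
  set τ := min (t₀ / 2) T with hτdef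
  refine ⟨A * τ ^ (-b), mul_nonneg hA (Real.rpow_pos_of_pos hτ _).le, fun t ht x y => ?_⟩
  have hs : 0 < t - τ := by
    have := min_le_left (t₀ / 2) T
    linarith
  have h1 := h _ _ _ _ (hu.isDatum (t - τ)) (hu.restart hK hf hd hs) τ hτ (min_le_right _ _)
    y (x - y)
  simp only [hτ, if_true, sub_add_cancel, add_sub_cancel] at h1
  refine h1.trans (le_of_eq ?_)
  ring

end IsSmoothingKernel

/-! ### Spatial differentiability -/

/-- The slicewise derivative of a function of `(t, x)` with respect to `x`. -/
def derivX (G : ℝ × ℝ → ℝ) (q : ℝ × ℝ) : ℝ := deriv (fun y => G (q.1, y)) q.2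

lemma lipschitzWith_of_abs_sub_le {g : ℝ → ℝ} {Λ : ℝ} (h : ∀ x y, |g x - g y| ≤ Λ * |x - y|) :
    LipschitzWith (Real.toNNReal Λ) g :=
  LipschitzWith.of_dist_le_mul fun x y => (h x y).trans
    (mul_le_mul_of_nonneg_right (Real.le_coe_toNNReal Λ) (abs_nonneg _))

section DerivX

variable {G : ℝ × ℝ → ℝ} {Λ : ℝ}

lemma derivX_of_nonpos (h0 : ∀ p : ℝ × ℝ, p.1 ≤ 0 → G p = 0) {q : ℝ × ℝ} (hq : q.1 ≤ 0) :
    derivX G q = 0 := by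
  simp [derivX, fun y => h0 (q.1, y) hq]

lemma abs_derivX_le (hΛ : 0 ≤ Λ) (hL : ∀ t x y, |G (t, x) - G (t, y)| ≤ Λ * |x - y|) (q : ℝ × ℝ) :
    |derivX G q| ≤ Λ := by
  have := norm_deriv_le_of_lipschitz (x₀ := q.2) (lipschitzWith_of_abs_sub_le (hL q.1))
  rwa [Real.coe_toNNReal _ hΛ] at this

variable (hc : ∀ p : ℝ × ℝ, 0 < p.1 → ContinuousAt G p) (h0 : ∀ p : ℝ × ℝ, p.1 ≤ 0 → G p = 0)
include hc

/-- The substitution `t = exp σ` maps the half plane to the whole plane, where the measurability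
results for derivatives with a parameter ask for global continuity. -/
lemma continuous_comp_exp : Continuous (uncurry fun σ y : ℝ => G (Real.exp σ, y)) := by
  refine continuous_iff_continuousAt.mpr fun p => ?_
  have h1 : Continuous fun p : ℝ × ℝ => (Real.exp p.1, p.2) := by fun_prop
  exact (hc (Real.exp p.1, p.2) (Real.exp_pos _)).comp_of_eq h1.continuousAt rfl

include h0

lemma measurable_derivX : Measurable (derivX G) := by
  have h1 := measurable_deriv_with_param (continuous_comp_exp hc)
  have h2 : derivX G = fun q => if 0 < q.1 then
      deriv (fun y => G (Real.exp (Real.log q.1), y)) q.2 else 0 := by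
    funext q
    split_ifs with hq
    · rw [Real.exp_log hq, derivX]
    · exact derivX_of_nonpos h0 (not_lt.mp hq)
  rw [h2]
  refine Measurable.ite (measurableSet_lt measurable_const measurable_fst) ?_ measurable_const
  exact h1.comp ((Real.measurable_log.comp measurable_fst).prodMk measurable_snd)

/-- Rademacher's theorem on each line `t = const`, then Fubini for the measurable exceptional set.
-/
lemma ae_hasDerivAt_derivX (hL : ∀ t x y, |G (t, x) - G (t, y)| ≤ Λ * |x - y|) :
    ∀ᵐ q : ℝ × ℝ, HasDerivAt (fun y => G (q.1, y)) (derivX G q) q.2 := by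
  have hm : MeasurableSet {q : ℝ × ℝ | ¬ DifferentiableAt ℝ (fun y => G (q.1, y)) q.2} := by
    have h1 := (measurableSet_of_differentiableAt_with_param ℝ (continuous_comp_exp hc)).compl
    have h2 : Measurable fun q : ℝ × ℝ => (Real.log q.1, q.2) :=
      (Real.measurable_log.comp measurable_fst).prodMk measurable_snd
    have h3 := (measurableSet_lt (measurable_const (a := (0 : ℝ))) measurable_fst).inter (h2 h1)
    convert h3 using 1
    ext q
    simp only [Set.mem_ofPred_eq, Set.mem_inter_iff, Set.mem_preimage, Set.mem_compl_iff]
    rcases le_or_gt q.1 0 with hq | hq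
    · have : (fun y => G (q.1, y)) = fun _ => 0 := funext fun y => h0 (q.1, y) hq
      simp [this, not_lt.mpr hq]
    · simp [hq, Real.exp_log hq]
  have hnull : volume {q : ℝ × ℝ | ¬ DifferentiableAt ℝ (fun y => G (q.1, y)) q.2} = 0 := by
    rw [Measure.volume_eq_prod]
    refine Measure.measure_prod_null_of_ae_null hm (ae_of_all _ fun t => ?_)
    exact (lipschitzWith_of_abs_sub_le (hL t)).ae_differentiableAt_real
  have hae : ∀ᵐ q : ℝ × ℝ, DifferentiableAt ℝ (fun y => G (q.1, y)) q.2 := hnull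
  filter_upwards [hae] with q hq using hq.hasDerivAt

end DerivX

lemma stConv_eq_integral_sub (A g : ℝ × ℝ → ℝ) (p : ℝ × ℝ) :
    stConv A g p = ∫ q, A q * g (p - q) := by
  rw [stConv, ← integral_sub_left_eq_self _ volume p]
  simp only [sub_sub_cancel]

/-- The convolution is written as `∫ A(q) G(p - q)`, so the derivative falls on `G`. Dominated
differentiation in its Lipschitz form needs differentiability only almost everywhere. -/
lemma hasDerivAt_stConv {A G : ℝ × ℝ → ℝ} {l B Λ : ℝ} (hl : 0 ≤ l) (hA : WeightedIntegrable l A)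
    (hB : ∀ q, |G q| ≤ B * Real.exp (l * q.1)) (hΛ : 0 ≤ Λ)
    (hGm : Measurable G) (hc : ∀ p : ℝ × ℝ, 0 < p.1 → ContinuousAt G p)
    (h0 : ∀ p : ℝ × ℝ, p.1 ≤ 0 → G p = 0)
    (hL : ∀ t x y, |G (t, x) - G (t, y)| ≤ Λ * |x - y|) (t x : ℝ) :
    HasDerivAt (fun y => stConv A G (t, y)) (stConv A (derivX G) (t, x)) x := by
  have hi : ∀ p, Integrable fun q => A q * G (p - q) := fun p => by
    refine ((integrable_stConv hA hGm hB p).comp_sub_left p).congr (ae_of_all _ fun q => ?_)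
    simp only [sub_sub_cancel]
  have hPB : ∀ q, |if 0 < q.1 then derivX G q else 0| ≤ Λ * Real.exp (l * q.1) := fun q => by
    split_ifs with hq
    · exact (abs_derivX_le hΛ hL q).trans
        (le_mul_of_one_le_right hΛ (Real.one_le_exp (by positivity)))
    · rw [abs_zero]; positivity
  have hP : (fun q : ℝ × ℝ => if 0 < q.1 then derivX G q else 0) = derivX G := by
    funext q
    split_ifs with hq
    · rfl
    · exact (derivX_of_nonpos h0 (not_lt.mp hq)).symm
  have hPB' : ∀ q, |derivX G q| ≤ Λ * Real.exp (l * q.1) := fun q => by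
    have := hPB q
    rwa [congrFun hP q] at this
  have hPi : Integrable fun q => A q * derivX G ((t, x) - q) := by
    refine ((integrable_stConv hA (measurable_derivX hc h0) hPB' (t, x)).comp_sub_left
      (t, x)).congr (ae_of_all _ fun q => ?_)
    simp only [sub_sub_cancel]
  simp only [stConv_eq_integral_sub]
  refine (hasDerivAt_integral_of_dominated_loc_of_lip (s := Set.univ)
    (bound := fun q => Λ * (Real.exp (l * t) * (Real.exp (-(l * q.1)) * |A q|))) univ_mem
    (.of_forall fun y => (hi (t, y)).aestronglyMeasurable) (hi (t, x)) hPi.aestronglyMeasurable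
    (ae_of_all _ fun q => ?_) ((hA.abs.const_mul _).const_mul _) ?_).2
  · refine LipschitzOnWith.of_dist_le_mul fun y _ z _ => ?_
    rw [Real.coe_nnabs, Real.dist_eq, Real.dist_eq, ← mul_sub, abs_mul,
      abs_of_nonneg (a := Λ * _) (mul_nonneg hΛ (mul_nonneg (Real.exp_pos _).le
        (mul_nonneg (Real.exp_pos _).le (abs_nonneg _))))]
    have e1 : ∀ y, ((t, y) : ℝ × ℝ) - q = (t - q.1, y - q.2) := fun y => rfl
    rw [e1, e1]
    rcases le_or_gt t q.1 with hq | hq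
    · rw [h0 _ (sub_nonpos.mpr hq), h0 _ (sub_nonpos.mpr hq), sub_self, abs_zero, mul_zero]
      positivity
    · have h1 := hL (t - q.1) (y - q.2) (z - q.2)
      rw [sub_sub_sub_cancel_right] at h1
      have h2 : 1 ≤ Real.exp (l * t) * Real.exp (-(l * q.1)) := by
        rw [← Real.exp_add]
        refine Real.one_le_exp ?_
        nlinarith
      calc |A q| * |G (t - q.1, y - q.2) - G (t - q.1, z - q.2)|
          ≤ |A q| * (Λ * |y - z|) := by gcongr
        _ ≤ Real.exp (l * t) * Real.exp (-(l * q.1)) * (|A q| * (Λ * |y - z|)) :=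
            le_mul_of_one_le_left (by positivity) h2
        _ = _ := by ring
  · have h1 := (Measure.measurePreserving_sub_left (volume : Measure (ℝ × ℝ))
      ((t, x) : ℝ × ℝ)).quasiMeasurePreserving.ae (ae_hasDerivAt_derivX hc h0 hL)
    filter_upwards [h1] with q hq
    exact (HasDerivAt.comp_sub_const x q.2 hq).const_mul (A q)

namespace IsSmoothingKernel

variable {b C : ℝ} {K D : ℝ → ℝ → ℝ} (hK : IsSmoothingKernel b C K D)
  {R L m M : ℝ} {f u₀ : ℝ → ℝ} (hf : IsFlux R L f) (hd : IsDatum R m M u₀) {u : ℝ × ℝ → ℝ}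

include hK hf hd in
-- The derivative is `D * u₀ - D * ∂ₓ f(u)`, where `∂ₓ f(u)` is a bounded measurable function.
-- Convolution with `D` makes it continuous, so neither a chain rule nor smoothness of `f` is
-- required.
lemma _root_.RieszFeller.IsDuhamel.exists_hasDerivAt_of_lipschitz (hu : IsDuhamel K D f u₀ R u)
    {Λ : ℝ} (hΛ : 0 ≤ Λ) (hL : ∀ t x y, |u (t, x) - u (t, y)| ≤ Λ * |x - y|) :
    ∃ W : ℝ → ℝ → ℝ, ∀ t, 0 < t → (∀ x, HasDerivAt (fun y => u (t, y)) (W t x) x) ∧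
      Continuous (W t) ∧ (∃ B, ∀ x, |W t x| ≤ B) ∧ TendstoUniformly W (W t) (𝓝 t) := by
  have hL0 := hf.lipschitz_pos
  set G : ℝ × ℝ → ℝ := fun q => f (u q) with hG
  have hGm : Measurable G := hf.monotone.measurable.comp hu.measurable
  have hGB := hf.abs_comp_le hu.eq_zero hu.abs_le zero_le_one
  have hDw := hK.weightedIntegrable_deriv one_pos
  have hG0 : ∀ p : ℝ × ℝ, p.1 ≤ 0 → G p = 0 := fun p hp => by
    simp only [hG, hu.eq_zero p hp, hf.map_zero]
  have hGL : ∀ t x y, |G (t, x) - G (t, y)| ≤ L * Λ * |x - y| := fun t x y => by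
    refine (hf.lipschitz _ _ (hu.abs_le _) (hu.abs_le _)).trans ?_
    rw [mul_assoc]
    exact mul_le_mul_of_nonneg_left (hL t x y) hL0.le
  have hGc : ∀ p : ℝ × ℝ, 0 < p.1 → ContinuousAt G p := fun p hp => by
    have h1 := hu.continuousAt hK hf hd hp
    refine tendsto_iff_dist_tendsto_zero.mpr (squeeze_zero (fun _ => dist_nonneg)
      (fun q => hf.lipschitz _ _ (hu.abs_le q) (hu.abs_le p)) ?_)
    simpa [Real.dist_eq] using (tendsto_iff_dist_tendsto_zero.mp h1.tendsto).const_mul L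
  have hPm := measurable_derivX hGc hG0
  have hPB : ∀ q, |derivX G q| ≤ L * Λ * Real.exp (1 * q.1) := fun q => by
    rcases le_or_gt q.1 0 with hq | hq
    · rw [derivX_of_nonpos hG0 hq, abs_zero]; positivity
    · exact (abs_derivX_le (by positivity) hGL q).trans
        (le_mul_of_one_le_right (by positivity) (Real.one_le_exp (by positivity)))
  refine ⟨fun t x => xConv (D t) u₀ x - stConv (uncurry D) (derivX G) (t, x), fun t ht =>
    ⟨fun x => ?_, ?_, ?_, ?_⟩⟩
  · have h1 : (fun y => u (t, y)) = fun y => xConv (K t) u₀ y - stConv (uncurry D) G (t, y) :=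
      funext fun y => hu.eq (t, y) ht
    rw [h1]
    exact (hK.hasDerivAt_xConv hd.aestronglyMeasurable hd.bound t x).sub
      (hasDerivAt_stConv zero_le_one hDw hGB
        (by positivity) hGm hGc hG0 hGL t x)
  · exact (uniformContinuous_xConv (hK.integrable_deriv t) hd.aestronglyMeasurable
      hd.bound).continuous.sub ((continuous_stConv hDw hPm hPB).comp
        (continuous_const.prodMk continuous_id))
  · exact ⟨_ + weightedNorm 1 (uncurry D) * (L * Λ) * Real.exp (1 * t), fun x => (abs_sub _ _).trans (add_le_add
      (abs_xConv_le (hK.integrable_deriv t) hd.bound x) (abs_stConv_le hDw hPB (t, x)))⟩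
  · exact (hK.tendstoUniformly_xConv_deriv hd.aestronglyMeasurable hd.bound ht).sub
      (tendstoUniformly_stConv hDw hPm hPB t)

include hK hf hd in
theorem _root_.RieszFeller.IsDuhamel.contDiff (hu : IsDuhamel K D f u₀ R u) {t : ℝ} (ht : 0 < t) :
    ContDiff ℝ 1 (fun x => u (t, x)) ∧ (∃ B, ∀ x, |deriv (fun y => u (t, y)) x| ≤ B) ∧
      TendstoUniformly (fun s => deriv fun y => u (s, y)) (deriv fun y => u (t, y)) (𝓝 t) := by
  have ht2 := half_pos ht
  obtain ⟨Λ, hΛ, hL⟩ := hu.exists_lipschitz hK hf hd ht2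
  -- Restarted at time `t/2`, the solution is Lipschitz in space uniformly in time.
  obtain ⟨W, hW⟩ := (hu.restart hK hf hd ht2).exists_hasDerivAt_of_lipschitz hK hf
    (hu.isDatum (t / 2)) hΛ fun s x y => by
      split_ifs with hs
      · exact hL _ (by linarith) x y
      · rw [sub_self, abs_zero]; positivity
  have hd' : ∀ s, t / 2 < s → ∀ x, HasDerivAt (fun y => u (s, y)) (W (s - t / 2) x) x := by
    intro s hs x
    have h1 := (hW (s - t / 2) (sub_pos.mpr hs)).1 x
    simpa [hs] using h1
  have hlt : t / 2 < t := half_lt_self ht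
  obtain ⟨-, h2, h3, h4⟩ := hW (t - t / 2) (sub_pos.mpr hlt)
  have e : ∀ s, t / 2 < s → (deriv fun y => u (s, y)) = W (s - t / 2) := fun s hs =>
    funext fun x => (hd' s hs x).deriv
  rw [e t hlt]
  refine ⟨contDiff_one_iff_deriv.mpr ⟨fun x => (hd' t hlt x).differentiableAt, ?_⟩, h3, ?_⟩
  · rw [e t hlt]; exact h2
  · intro V hV
    have h5 : Tendsto (fun s => s - t / 2) (𝓝 t) (𝓝 (t - t / 2)) :=
      (continuous_id.sub continuous_const).tendsto t
    filter_upwards [h5.eventually (h4 V hV), lt_mem_nhds hlt] with s hs hs' x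
    rw [e s hs']
    exact hs x

end IsSmoothingKernel

/-! ### Continuity in `L¹` -/

/-- The `L¹` modulus of continuity. -/
def translationModulus (v : ℝ → ℝ) (z : ℝ) : ℝ := ∫ x, |v (-z + x) - v x|

lemma continuous_translationModulus {v : ℝ → ℝ} (hv : Integrable v) :
    Continuous (translationModulus v) := by
  refine continuous_iff_continuousAt.mpr fun z => ?_
  have hs : ∀ z, Integrable fun x => v (-z + x) := fun z => hv.comp_add_left (-z)
  have h1 : Tendsto (fun z' : ℝ => -z' + z) (𝓝 z) (𝓝 0) := by
    have : Continuous fun z' : ℝ => -z' + z := by fun_prop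
    simpa using this.tendsto z
  have h2 := (tendsto_integral_abs_translate_sub volume hv).comp h1
  refine tendsto_iff_dist_tendsto_zero.mpr (squeeze_zero (fun _ => dist_nonneg) (fun z' => ?_) h2)
  have e : ∫ x, |v (-z' + z + x) - v x| = ∫ x, |v (-z' + x) - v (-z + x)| := by
    rw [← integral_add_left_eq_self (fun x => |v (-z' + x) - v (-z + x)|) z]
    refine integral_congr_ae (ae_of_all _ fun x => ?_)
    simp only [← add_assoc, neg_add_cancel, zero_add]
  have hsv : ∀ z, Integrable fun x => |v (-z + x) - v x| := fun z => ((hs z).sub hv).abs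
  simp only [Function.comp_apply]
  rw [e, Real.dist_eq, translationModulus, translationModulus, ← integral_sub (hsv z') (hsv z)]
  refine (abs_integral_le_integral_abs).trans (integral_mono_of_nonneg
    (ae_of_all _ fun _ => abs_nonneg _) ((hs z').sub (hs z)).abs (ae_of_all _ fun x => ?_))
  refine (abs_abs_sub_abs_le_abs_sub _ _).trans (le_of_eq ?_)
  congr 1; ring

lemma abs_translationModulus_le {v : ℝ → ℝ} (hv : Integrable v) (z : ℝ) :
    |translationModulus v z| ≤ 2 * ∫ x, |v x| := by
  have hs : Integrable fun x => v (-z + x) := hv.comp_add_left (-z)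
  rw [translationModulus, abs_of_nonneg (integral_nonneg fun _ => abs_nonneg _)]
  calc ∫ x, |v (-z + x) - v x| ≤ ∫ x, (|v (-z + x)| + |v x|) :=
        integral_mono (hs.sub hv).abs (hs.abs.add hv.abs) fun x => abs_sub _ _
    _ = 2 * ∫ x, |v x| := by
        rw [integral_add hs.abs hv.abs, integral_add_left_eq_self (fun x => |v x|) (-z), two_mul]

lemma ofReal_integral_abs_sub {X : Type*} [MeasurableSpace X] {μ : Measure X} {g g' : X → ℝ}
    (hg : Integrable g μ) (hg' : Integrable g' μ) :
    ENNReal.ofReal (∫ x, |g x - g' x| ∂μ) = ∫⁻ x, ‖g x - g' x‖ₑ ∂μ :=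
  ofReal_integral_norm_eq_lintegral_enorm (hg.sub hg')

namespace IsSmoothingKernel

variable {b C : ℝ} {K D : ℝ → ℝ → ℝ} (hK : IsSmoothingKernel b C K D)
  {R L m M : ℝ} {f u₀ : ℝ → ℝ} (hf : IsFlux R L f) (hd : IsDatum R m M u₀) {u : ℝ × ℝ → ℝ}

include hK in
-- Since `K t` has mass one, `K t * v - v` is an average of translates of `v` minus `v`; Fubini
-- gives the averaged modulus of continuity.
lemma lintegral_xConv_sub_le {v : ℝ → ℝ} (hvm : Measurable v) (hv : Integrable v) {R : ℝ}
    (hR : ∀ᵐ y, |v y| ≤ R) {t : ℝ} (ht : 0 < t) :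
    ∫⁻ x, ‖xConv (K t) v x - v x‖ₑ ≤ ENNReal.ofReal (∫ z, K t z * translationModulus v z) := by
  have hKm : Measurable (K t) := hK.measurable.comp (measurable_const.prodMk measurable_id)
  have h1 : ∀ x, ‖xConv (K t) v x - v x‖ₑ ≤ ∫⁻ z, ‖K t z‖ₑ * ‖v (-z + x) - v x‖ₑ := by
    intro x
    have hi : Integrable fun z => K t z * v (-z + x) := by
      refine ((integrable_xConv (hK.integrable t) hvm.aestronglyMeasurable hR x).comp_sub_left
        x).congr (ae_of_all _ fun z => ?_)
      simp only [sub_sub_cancel, neg_add_eq_sub]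
    have e : xConv (K t) v x - v x = ∫ z, K t z * (v (-z + x) - v x) := by
      simp only [mul_sub]
      rw [integral_sub hi ((hK.integrable t).mul_const _), integral_mul_const,
        hK.integral_eq_one t ht, one_mul, xConv,
        ← integral_sub_left_eq_self (fun y => K t (x - y) * v y) volume x]
      simp only [sub_sub_cancel, neg_add_eq_sub]
    rw [e]
    refine (enorm_integral_le_lintegral_enorm _).trans (le_of_eq ?_)
    simp only [enorm_mul]
  have hm : Measurable fun p : ℝ × ℝ => ‖K t p.2‖ₑ * ‖v (-p.2 + p.1) - v p.1‖ₑ :=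
    (hKm.comp measurable_snd).enorm.mul
      ((hvm.comp (by fun_prop)).sub (hvm.comp measurable_fst)).enorm
  refine (lintegral_mono h1).trans (le_of_eq ?_)
  rw [lintegral_lintegral_swap hm.aemeasurable]
  have hω0 : ∀ z, 0 ≤ translationModulus v z := fun z => integral_nonneg fun _ => abs_nonneg _
  have hi : Integrable fun z => K t z * translationModulus v z :=
    (hK.integrable t).mul_bdd (continuous_translationModulus hv).aestronglyMeasurable
      (ae_of_all _ fun z => abs_translationModulus_le hv z)
  rw [ofReal_integral_eq_lintegral_ofReal hi
    (ae_of_all _ fun z => mul_nonneg (hK.nonneg t z) (hω0 z))]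
  refine lintegral_congr fun z => ?_
  rw [lintegral_const_mul' _ _ enorm_ne_top, ENNReal.ofReal_mul (hK.nonneg t z),
    Real.enorm_of_nonneg (hK.nonneg t z), translationModulus,
    ofReal_integral_abs_sub (hv.comp_add_left (-z)) hv]

include hK in
lemma tendsto_lintegral_xConv_sub_self (hv : Integrable u₀) {R : ℝ} (hR : ∀ᵐ y, |u₀ y| ≤ R) :
    Tendsto (fun t => ∫⁻ x, ‖xConv (K t) u₀ x - u₀ x‖ₑ) (𝓝[>] 0) (𝓝 0) := by
  set v := hv.aestronglyMeasurable.mk u₀ with hvdef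
  have hae : u₀ =ᵐ[volume] v := hv.aestronglyMeasurable.ae_eq_mk
  have hvm : Measurable v := hv.aestronglyMeasurable.stronglyMeasurable_mk.measurable
  have hvi : Integrable v := hv.congr hae
  have hvR : ∀ᵐ y, |v y| ≤ R := by
    filter_upwards [hR, hae] with y h1 h2
    rwa [← h2]
  have h1 := hK.tendsto_integral_mul (translationModulus v) (continuous_translationModulus hvi)
    ⟨_, abs_translationModulus_le hvi⟩
  have h0 : translationModulus v 0 = 0 := by simp [translationModulus]
  rw [h0] at h1
  have h2 := ENNReal.tendsto_ofReal h1
  rw [ENNReal.ofReal_zero] at h2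
  refine tendsto_of_tendsto_of_tendsto_of_le_of_le' tendsto_const_nhds h2
    (.of_forall fun _ => zero_le) ?_
  filter_upwards [self_mem_nhdsWithin] with t ht
  refine le_trans (le_of_eq ?_) (hK.lintegral_xConv_sub_le hvm hvi hvR ht)
  refine lintegral_congr_ae ?_
  have e : ∀ x, xConv (K t) u₀ x = xConv (K t) v x := fun x => by
    refine integral_congr_ae ?_
    filter_upwards [hae] with y hy
    rw [hy]
  filter_upwards [hae] with x hx
  rw [e, hx]

include hK hd in
lemma tendsto_lintegral_xConv_sub (hN : ∫⁻ x, ‖u₀ x‖ₑ ≠ ⊤) {t : ℝ} (ht : 0 < t) :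
    Tendsto (fun s => ∫⁻ x, ‖xConv (K s) u₀ x - xConv (K t) u₀ x‖ₑ) (𝓝 t) (𝓝 0) := by
  have h1 : ∀ s, ∫⁻ x, ‖xConv (K s) u₀ x - xConv (K t) u₀ x‖ₑ ≤
      ENNReal.ofReal (∫ x, |K s x - K t x|) * ∫⁻ x, ‖u₀ x‖ₑ := fun s => by
    have h2 := (hK.integrable s).sub (hK.integrable t)
    have h3 := RieszFeller.lintegral_enorm_xConv_le h2.aestronglyMeasurable hd.aestronglyMeasurable
    rw [ofReal_integral_abs_sub (hK.integrable s) (hK.integrable t)]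
    refine le_trans (le_of_eq (lintegral_congr fun x => ?_)) h3
    rw [← xConv_sub (hK.integrable s) (hK.integrable t) hd.aestronglyMeasurable hd.bound]
    rfl
  have h2 := ENNReal.Tendsto.mul_const (ENNReal.tendsto_ofReal (hK.tendsto_integral_abs_sub t ht))
    (Or.inr hN)
  rw [ENNReal.ofReal_zero, zero_mul] at h2
  exact tendsto_of_tendsto_of_tendsto_of_le_of_le tendsto_const_nhds h2
    (fun _ => zero_le) h1

/-- The part of `D` on the strip `0 < t < T`. -/
def truncated (D : ℝ → ℝ → ℝ) (T t x : ℝ) : ℝ := if 0 < t ∧ t < T then D t x else 0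

include hK in
-- On `0 < t < T` the exponential weight is bounded below, so the truncated derivative is integrable
-- without weight and its translates converge in `L¹`.
lemma integrable_truncated (T : ℝ) : Integrable (uncurry (truncated D T)) := by
  have h1 := (hK.weightedIntegrable_deriv one_pos).abs.const_mul (Real.exp T)
  have hm : Measurable (uncurry (truncated D T)) :=
    Measurable.ite ((measurableSet_lt measurable_const measurable_fst).inter
      (measurableSet_lt measurable_fst measurable_const)) hK.measurable_deriv measurable_const
  refine h1.mono' hm.aestronglyMeasurable (ae_of_all _ fun q => ?_)
  simp only [uncurry, truncated]
  split_ifs with hq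
  · rw [← mul_assoc, ← Real.exp_add]
    exact le_mul_of_one_le_left (abs_nonneg _) (Real.one_le_exp (by linarith [hq.2]))
  · rw [norm_zero]; positivity

include hK in
lemma stConv_truncated {g : ℝ × ℝ → ℝ} (hg0 : ∀ q : ℝ × ℝ, q.1 ≤ 0 → g q = 0) {T : ℝ}
    {p : ℝ × ℝ} (hp : p.1 ≤ T) :
    stConv (uncurry (truncated D T)) g p = stConv (uncurry D) g p := by
  refine integral_congr_ae (ae_of_all _ fun q => ?_)
  simp only [uncurry, truncated, Prod.fst_sub, Prod.snd_sub]
  rcases le_or_gt q.1 0 with hq | hq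
  · simp only [hg0 q hq, mul_zero]
  · split_ifs with h
    · rfl
    · rw [hK.deriv_eq_zero]
      by_contra hc
      exact h ⟨not_le.mp hc, by linarith⟩

include hK in
-- A change of time is a translation of the kernel in space-time; its `L¹` size multiplies the
-- uniform bound on the slices of `g`.
lemma tendsto_lintegral_stConv_sub {g : ℝ × ℝ → ℝ} {B : ℝ} {N : ENNReal} (hg : Measurable g)
    (hg0 : ∀ q : ℝ × ℝ, q.1 ≤ 0 → g q = 0) (hB : ∀ q, |g q| ≤ B) (hN : N ≠ ⊤)
    (hgN : ∀ s, ∫⁻ y, ‖g (s, y)‖ₑ ≤ N) (t : ℝ) :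
    Tendsto (fun s => ∫⁻ x, ‖stConv (uncurry D) g (s, x) - stConv (uncurry D) g (t, x)‖ₑ)
      (𝓝 t) (𝓝 0) := by
  -- One truncation, at `t + 1`, serves all times near `t`.
  set A := uncurry (truncated D (t + 1)) with hA
  have hAi : Integrable A := hK.integrable_truncated (t + 1)
  have hAm : Measurable A :=
    Measurable.ite ((measurableSet_lt measurable_const measurable_fst).inter
      (measurableSet_lt measurable_fst measurable_const)) hK.measurable_deriv measurable_const
  have hgi : ∀ A' : ℝ × ℝ → ℝ, Integrable A' → ∀ p, Integrable fun q => A' (p - q) * g q :=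
    fun A' hA' p => (hA'.comp_sub_left p).mul_bdd hg.aestronglyMeasurable
      (ae_of_all _ fun q => hB q)
  have h1 : Tendsto (fun s : ℝ => ((s - t, 0) : ℝ × ℝ)) (𝓝 t) (𝓝 0) := by
    have : Continuous fun s : ℝ => ((s - t, 0) : ℝ × ℝ) := by fun_prop
    simpa [← Prod.zero_eq_mk] using this.tendsto t
  have h2 := ENNReal.Tendsto.mul_const (ENNReal.tendsto_ofReal
    ((tendsto_integral_abs_translate_sub volume hAi).comp h1)) (Or.inr hN)
  rw [ENNReal.ofReal_zero, zero_mul] at h2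
  refine tendsto_of_tendsto_of_tendsto_of_le_of_le' tendsto_const_nhds h2
    (.of_forall fun _ => zero_le) ?_
  filter_upwards [ge_mem_nhds (lt_add_one t)] with s hs
  have hs' : s ≤ t + 1 := hs
  have hAs : Integrable fun q => A ((s - t, 0) + q) := hAi.comp_add_left ((s - t, 0) : ℝ × ℝ)
  have e : ∀ x, stConv (uncurry D) g (s, x) - stConv (uncurry D) g (t, x) =
      stConv (uncurry fun τ z => A ((s - t, 0) + (τ, z)) - A (τ, z)) g (t, x) := by
    intro x
    rw [← hK.stConv_truncated hg0 (T := t + 1) (p := (s, x)) hs',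
      ← hK.stConv_truncated hg0 (T := t + 1) (p := (t, x)) (lt_add_one t).le]
    have h3 := stConv_sub_left (A := fun q => A ((s - t, 0) + q)) (hgi _ hAs (t, x)) (hgi _ hAi (t, x))
    have h4 : stConv (fun q => A ((s - t, 0) + q)) g (t, x) = stConv A g (s, x) := by
      refine integral_congr_ae (ae_of_all _ fun q => ?_)
      have : ((s - t, 0) : ℝ × ℝ) + ((t, x) - q) = (s, x) - q := by
        rw [← add_sub_assoc]; congr 1; ext <;> simp
      simp only [this]
    rw [h4] at h3
    exact h3.symm
  have hAsm : Measurable fun q => A ((s - t, 0) + q) - A q :=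
    (hAm.comp (measurable_const_add _)).sub hAm
  simp only [e]
  refine (lintegral_enorm_stConv_le (A := fun τ z => A ((s - t, 0) + (τ, z)) - A (τ, z)) hAsm hg t).trans ?_
  simp only [Function.comp_apply]
  rw [ofReal_integral_abs_sub hAs hAi]
  calc _ ≤ ∫⁻ r, (∫⁻ z, ‖A ((s - t, 0) + (t - r, z)) - A (t - r, z)‖ₑ) * N :=
        lintegral_mono fun r => by gcongr; exact hgN r
    _ = (∫⁻ r, ∫⁻ z, ‖A ((s - t, 0) + (t - r, z)) - A (t - r, z)‖ₑ) * N :=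
        lintegral_mul_const' _ _ hN
    _ = (∫⁻ r, ∫⁻ z, ‖A ((s - t, 0) + (r, z)) - A (r, z)‖ₑ) * N := by
        rw [lintegral_sub_left_eq_self
          (fun r => ∫⁻ z, ‖A ((s - t, 0) + (r, z)) - A (r, z)‖ₑ) t]
    _ ≤ _ := by
        rw [Measure.volume_eq_prod, lintegral_prod _ hAsm.enorm.aemeasurable]

include hf in
lemma _root_.RieszFeller.IsFlux.lintegral_comp_le (hu0 : ∀ p : ℝ × ℝ, p.1 ≤ 0 → u p = 0)
    (hR : ∀ p, |u p| ≤ R) {N : ENNReal} (hN : ∀ t, 0 < t → ∫⁻ x, ‖u (t, x)‖ₑ ≤ N) (t : ℝ) :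
    ∫⁻ x, ‖f (u (t, x))‖ₑ ≤ ENNReal.ofReal L * N := by
  rcases le_or_gt t 0 with ht | ht
  · simp [hu0 (t, _) ht, hf.map_zero]
  · calc ∫⁻ x, ‖f (u (t, x))‖ₑ ≤ ∫⁻ x, ENNReal.ofReal L * ‖u (t, x)‖ₑ := by
          refine lintegral_mono fun x => ?_
          rw [Real.enorm_eq_ofReal_abs, Real.enorm_eq_ofReal_abs,
            ← ENNReal.ofReal_mul hf.lipschitz_pos.le]
          exact ENNReal.ofReal_le_ofReal (hf.abs_le (hR _))
      _ = ENNReal.ofReal L * ∫⁻ x, ‖u (t, x)‖ₑ := lintegral_const_mul' _ _ ENNReal.ofReal_ne_top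
      _ ≤ _ := by gcongr; exact hN t ht

include hK hf in
lemma _root_.RieszFeller.IsDuhamel.tendsto_lintegral_duhamel (hu : IsDuhamel K D f u₀ R u)
    {N : ENNReal} (hNt : N ≠ ⊤) (hN : ∀ t, 0 < t → ∫⁻ x, ‖u (t, x)‖ₑ ≤ N) (t : ℝ) :
    Tendsto (fun s => ∫⁻ x, ‖stConv (uncurry D) (fun q => f (u q)) (s, x) -
      stConv (uncurry D) (fun q => f (u q)) (t, x)‖ₑ) (𝓝 t) (𝓝 0) :=
  hK.tendsto_lintegral_stConv_sub (hf.monotone.measurable.comp hu.measurable)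
    (fun q hq => by simp only [Function.comp_apply, hu.eq_zero q hq, hf.map_zero])
    (fun q => (hf.abs_le (hu.abs_le q)).trans
      (mul_le_mul_of_nonneg_left (hu.abs_le q) hf.lipschitz_pos.le))
    (ENNReal.mul_ne_top ENNReal.ofReal_ne_top hNt) (hf.lintegral_comp_le hu.eq_zero hu.abs_le hN) t

include hK hf hd in
lemma _root_.RieszFeller.IsDuhamel.tendsto_lintegral_sub (hu : IsDuhamel K D f u₀ R u)
    (hN : ∫⁻ x, ‖u₀ x‖ₑ ≠ ⊤) (hNu : ∀ t, 0 < t → ∫⁻ x, ‖u (t, x)‖ₑ ≤ ∫⁻ x, ‖u₀ x‖ₑ)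
    {t : ℝ} (ht : 0 < t) :
    Tendsto (fun s => ∫⁻ x, ‖u (s, x) - u (t, x)‖ₑ) (𝓝 t) (𝓝 0) := by
  have h := (hK.tendsto_lintegral_xConv_sub hd hN ht).add
    (hu.tendsto_lintegral_duhamel hK hf hN hNu t)
  rw [add_zero] at h
  refine tendsto_of_tendsto_of_tendsto_of_le_of_le' tendsto_const_nhds h
    (.of_forall fun _ => zero_le) ?_
  filter_upwards [lt_mem_nhds ht] with s hs
  have hm : Measurable fun x => xConv (K s) u₀ x - xConv (K t) u₀ x :=
    ((uniformContinuous_xConv (hK.integrable s) hd.aestronglyMeasurable hd.bound).continuous.sub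
      (uniformContinuous_xConv (hK.integrable t) hd.aestronglyMeasurable
        hd.bound).continuous).measurable
  rw [← lintegral_add_left hm.enorm]
  refine lintegral_mono fun x => ?_
  rw [hu.eq (s, x) hs, hu.eq (t, x) ht, sub_sub_sub_comm]
  exact enorm_sub_le

include hK hf hd in
lemma _root_.RieszFeller.IsDuhamel.tendsto_lintegral_sub_datum (hu : IsDuhamel K D f u₀ R u)
    (hi : Integrable u₀) (hNu : ∀ t, 0 < t → ∫⁻ x, ‖u (t, x)‖ₑ ≤ ∫⁻ x, ‖u₀ x‖ₑ) :
    Tendsto (fun s => ∫⁻ x, ‖u (s, x) - u₀ x‖ₑ) (𝓝[>] 0) (𝓝 0) := by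
  have h := (hK.tendsto_lintegral_xConv_sub_self hi hd.bound).add
    ((hu.tendsto_lintegral_duhamel hK hf hi.2.ne hNu 0).mono_left nhdsWithin_le_nhds)
  rw [add_zero] at h
  refine tendsto_of_tendsto_of_tendsto_of_le_of_le' tendsto_const_nhds h
    (.of_forall fun _ => zero_le) ?_
  filter_upwards [self_mem_nhdsWithin] with s hs
  have hm : AEMeasurable fun x => ‖xConv (K s) u₀ x - u₀ x‖ₑ :=
    ((uniformContinuous_xConv (hK.integrable s) hd.aestronglyMeasurable
      hd.bound).continuous.aestronglyMeasurable.sub hd.aestronglyMeasurable).enorm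
  rw [← lintegral_add_left' hm]
  refine lintegral_mono fun x => ?_
  rw [hu.eq (s, x) hs, stConv_eq_zero (p := (0, x)) le_rfl hK.deriv_eq_zero
    (fun q hq => by rw [hu.eq_zero q hq, hf.map_zero]), sub_zero, sub_right_comm]
  exact enorm_sub_le

include hK hf hd in
-- A solution is constructed from the datum `u(s, ·)` with its `L¹` bound; by uniqueness it is the
-- restarted `u`.
lemma _root_.RieszFeller.IsDuhamel.lintegral_antitone (hu : IsDuhamel K D f u₀ R u) {s t : ℝ}
    (hs : 0 < s) (hst : s ≤ t) : ∫⁻ x, ‖u (t, x)‖ₑ ≤ ∫⁻ x, ‖u (s, x)‖ₑ := by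
  rcases hst.eq_or_lt with rfl | hst
  · rfl
  obtain ⟨v, hv, hv'⟩ := hK.exists_duhamel hf (hu.isDatum s)
  have h1 := hK.duhamel_unique hf hv' (hu.restart hK hf hd hs)
  have h2 := hv.lintegral_le (t - s) (sub_pos.mpr hst)
  simpa [h1, hst] using h2

end IsSmoothingKernel

/-! ### The flux and the initial data -/

/-- Splitting into positive and negative parts reduces monotonicity and the Lipschitz bound to the
power function on `[0, ∞)`. -/
lemma flux_eq {q : ℝ} (hq : 1 < q) (v : ℝ) : flux q v = (max v 0) ^ q / q - (max (-v) 0) ^ q / q := by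
  have h : ∀ x : ℝ, 0 ≤ x → x ^ (q - 1) * x = x ^ q := fun x hx => by
    rw [← Real.rpow_add_one' hx (by linarith), sub_add_cancel]
  have h0 : (0 : ℝ) ^ q = 0 := Real.zero_rpow (by linarith)
  rcases le_total 0 v with hv | hv
  · rw [flux, abs_of_nonneg hv, h v hv, max_eq_left hv, max_eq_right (by linarith), h0]
    simp
  · rw [flux, abs_of_nonpos hv, max_eq_right hv, max_eq_left (by linarith), h0,
      ← h (-v) (by linarith)]
    ring

lemma abs_rpow_sub_rpow_le {q R a b : ℝ} (hq : 1 < q) (ha : 0 ≤ a) (haR : a ≤ R) (hb : 0 ≤ b)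
    (hbR : b ≤ R) : |a ^ q - b ^ q| ≤ q * R ^ (q - 1) * |a - b| := by
  refine Convex.norm_image_sub_le_of_norm_hasDerivWithin_le (s := Set.Icc 0 R)
    (fun x _ => (Real.hasDerivAt_rpow_const (Or.inr hq.le)).hasDerivWithinAt)
    (fun x hx => ?_) (convex_Icc 0 R) ⟨hb, hbR⟩ ⟨ha, haR⟩
  have h1 := Real.rpow_nonneg hx.1 (q - 1)
  rw [Real.norm_of_nonneg (by positivity)]
  have := Real.rpow_le_rpow hx.1 hx.2 (by linarith : 0 ≤ q - 1)
  gcongr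

-- Each of the two parts contributes `R^(q-1)`; the summand `1` keeps the constant positive when `R
-- = 0`.
lemma isFlux_flux {q R : ℝ} (hq : 1 < q) (hR : 0 ≤ R) : IsFlux R (2 * R ^ (q - 1) + 1) (flux q) where
  monotone v w h := by
    rw [flux_eq hq, flux_eq hq]
    gcongr
  map_zero := by simp [flux]
  radius_nonneg := hR
  lipschitz_pos := by
    have := Real.rpow_nonneg hR (q - 1)
    linarith
  lipschitz v w hv hw := by
    have hq0 : 0 < q := by linarith
    have hv' := abs_le.mp hv
    have hw' := abs_le.mp hw
    have h1 := abs_rpow_sub_rpow_le hq (le_max_right v 0) (max_le hv'.2 hR) (le_max_right w 0)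
      (max_le hw'.2 hR)
    have h2 := abs_rpow_sub_rpow_le hq (le_max_right (-v) 0) (max_le (by linarith) hR)
      (le_max_right (-w) 0) (max_le (by linarith) hR)
    have h3 : |max v 0 - max w 0| ≤ |v - w| := abs_max_sub_max_le_abs v w 0
    have h4 : |max (-v) 0 - max (-w) 0| ≤ |v - w| := by
      refine (abs_max_sub_max_le_abs (-v) (-w) 0).trans (le_of_eq ?_)
      rw [neg_sub_neg, abs_sub_comm]
    have hRq := Real.rpow_nonneg hR (q - 1)
    have e : flux q v - flux q w = (max v 0 ^ q - max w 0 ^ q) / q -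
        (max (-v) 0 ^ q - max (-w) 0 ^ q) / q := by
      rw [flux_eq hq, flux_eq hq]; ring
    have h5 : ∀ x y : ℝ, |x| ≤ q * R ^ (q - 1) * y → y ≤ |v - w| →
        |x / q| ≤ R ^ (q - 1) * |v - w| := fun x y hx hy => by
      rw [abs_div, abs_of_pos hq0, div_le_iff₀ hq0]
      refine hx.trans ?_
      have := mul_le_mul_of_nonneg_left hy (mul_nonneg hq0.le hRq)
      linarith
    rw [e]
    refine (abs_sub _ _).trans ?_
    have := h5 _ _ h1 h3
    have := h5 _ _ h2 h4
    have := abs_nonneg (v - w)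
    linarith

lemma isDatum_of_memLp {u₀ : ℝ → ℝ} (hu₀ : MemLp u₀ ⊤ (volume : Measure ℝ)) :
    IsDatum (max |essInf u₀ volume| |essSup u₀ volume|) (essInf u₀ volume) (essSup u₀ volume) u₀ := by
  have h1 : ∀ᵐ y, |u₀ y| ≤ (eLpNormEssSup u₀ volume).toReal := by
    filter_upwards [ae_le_eLpNormEssSup (f := u₀) (μ := volume)] with y hy
    have h2 := ENNReal.toReal_mono (by simpa using hu₀.2.ne) hy
    simpa using h2
  refine ⟨hu₀.1, ?_, (le_abs_self _).trans (le_max_right _ _), ?_, ?_⟩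
  · have := neg_abs_le (essInf u₀ volume)
    have := le_max_left |essInf u₀ volume| |essSup u₀ volume|
    linarith
  · refine ae_essInf_le ⟨-(eLpNormEssSup u₀ volume).toReal, ?_⟩
    rw [eventually_map]
    filter_upwards [h1] with y hy using (abs_le.mp hy).1
  · refine ae_le_essSup ⟨(eLpNormEssSup u₀ volume).toReal, ?_⟩
    rw [eventually_map]
    filter_upwards [h1] with y hy using (abs_le.mp hy).2

lemma IsDatum.mono {R R' m M : ℝ} {u₀ : ℝ → ℝ} (hd : IsDatum R m M u₀) (h : R ≤ R') :
    IsDatum R' m M u₀ :=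
  ⟨hd.1, (neg_le_neg h).trans hd.le_lower, hd.upper_le.trans h, hd.lower, hd.upper⟩

/-! ### Mild solutions -/

section Mild

variable {α q R L m M : ℝ} (hα : 0 < α) (hα' : α < 1)

lemma xConv_heatKernel (u₀ : ℝ → ℝ) {t : ℝ} (ht : 0 < t) (x : ℝ) :
    xConv (heatKernel α t) u₀ x = ∫ y, kernel α t (x - y) * u₀ y := by
  rw [xConv, heatKernel_of_pos α ht]

lemma mem_strip_top {p : ℝ × ℝ} : p ∈ strip ⊤ ↔ 0 < p.1 := by
  simp [strip, EReal.coe_lt_top]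

lemma strip_top : strip ⊤ = {p : ℝ × ℝ | 0 < p.1} := Set.ext fun _ => mem_strip_top

include hα hα' in
lemma stConv_heatKernelDx {f : ℝ → ℝ} (hf : IsFlux R L f) {w : ℝ × ℝ → ℝ} (hm : Measurable w)
    (h0 : ∀ p : ℝ × ℝ, p.1 ≤ 0 → w p = 0) (hR : ∀ p, |w p| ≤ R) {v : ℝ → ℝ → ℝ}
    (hv : ∀ t x, 0 < t → w (t, x) = v t x) {t : ℝ} (ht : 0 < t) (x : ℝ) :
    stConv (uncurry (heatKernelDx α)) (fun r => f (w r)) (t, x) =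
      ∫ s in (0 : ℝ)..t, ∫ y, kernelDx α (t - s) (x - y) * f (v s y) := by
  have hK := isSmoothingKernel hα hα'
  rw [stConv_eq_intervalIntegral ht.le hK.deriv_eq_zero
    (fun r hr => by rw [h0 r hr, hf.map_zero]) (hK.integrable_duhamel hf one_pos hm h0 hR (t, x))]
  refine intervalIntegral.integral_congr_Ioo_of_le ht.le fun s hs => ?_
  simp only [heatKernelDx_of_pos α (sub_pos.mpr hs.2), hv s _ hs.1]

variable {u₀ : ℝ → ℝ} (hd : IsDatum R m M u₀) {u : ℝ × ℝ → ℝ}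

include hα hα' hd in
lemma IsDuhamel.isMildSolution (hf : IsFlux R L (flux q))
    (hu : IsDuhamel (heatKernel α) (heatKernelDx α) (flux q) u₀ R u) :
    IsMildSolution α q ⊤ u₀ fun t x => u (t, x) := by
  have hK := isSmoothingKernel hα hα'
  refine ⟨⟨fun p hp => ?_, R, fun p _ => hu.abs_le p⟩, ?_⟩
  · exact (hu.continuousAt hK hf hd (mem_strip_top.mp hp)).continuousWithinAt
  · rw [strip_top]
    refine (ae_restrict_iff' (measurableSet_lt measurable_const measurable_fst)).mpr
      (ae_of_all _ fun p hp => ?_)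
    have hp' : 0 < p.1 := hp
    refine (hu.eq p hp').trans ?_
    rw [xConv_heatKernel u₀ hp', stConv_heatKernelDx hα hα' hf hu.measurable hu.eq_zero
      hu.abs_le (fun _ _ _ => rfl) hp']

include hα hα' hd in
lemma IsMildSolution.isDuhamel (hf : IsFlux R L (flux q)) {v : ℝ → ℝ → ℝ}
    (hv : IsMildSolution α q ⊤ u₀ v) (hR : ∀ p ∈ strip ⊤, |v p.1 p.2| ≤ R) :
    IsDuhamel (heatKernel α) (heatKernelDx α) (flux q) u₀ R
      fun p => if 0 < p.1 then v p.1 p.2 else 0 := by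
  have hK := isSmoothingKernel hα hα'
  obtain ⟨⟨hc, -⟩, he⟩ := hv
  rw [strip_top] at hc he
  set V : ℝ × ℝ → ℝ := fun p => if 0 < p.1 then v p.1 p.2 else 0 with hV
  have hVv : ∀ t x, 0 < t → V (t, x) = v t x := fun t x ht => by simp [hV, ht]
  have hV0 : ∀ p : ℝ × ℝ, p.1 ≤ 0 → V p = 0 := fun p hp => by simp [hV, not_lt.mpr hp]
  have hVR : ∀ p, |V p| ≤ R := fun p => by
    rcases le_or_gt p.1 0 with hp | hp
    · rw [hV0 p hp, abs_zero]; exact hf.radius_nonneg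
    · have := hR p (mem_strip_top.mpr hp)
      rwa [← hVv p.1 p.2 hp] at this
  have hVc : ContinuousOn V {p | 0 < p.1} := hc.congr fun p hp => hVv p.1 p.2 hp
  have hVm := measurable_of_continuousOn_pos hV0 hVc
  refine hK.isDuhamel_of_ae hf hd hV0 hVR hVc ?_
  rw [ae_restrict_iff' (measurableSet_lt measurable_const measurable_fst)] at he ⊢
  filter_upwards [he] with p hp hp'
  have hp0 : 0 < p.1 := hp'
  have h1 := hVv p.1 p.2 hp0
  rw [Prod.mk.eta] at h1
  rw [h1, hp hp', xConv_heatKernel u₀ hp0, ← stConv_heatKernelDx hα hα' hf hVm hV0 hVR hVv hp0]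

include hα hα' hd in
-- A competing solution may have a larger bound `B`. Uniqueness is applied at radius `max R B`, at
-- which both functions solve Duhamel's formula.
lemma IsMildSolution.eq_of_isDuhamel (hq : 1 < q) {v : ℝ → ℝ → ℝ}
    (hv : IsMildSolution α q ⊤ u₀ v)
    (hu : IsDuhamel (heatKernel α) (heatKernelDx α) (flux q) u₀ R u) {t : ℝ} (ht : 0 < t) (x : ℝ) :
    v t x = u (t, x) := by
  obtain ⟨B, hB⟩ := hv.1.2
  have hf := isFlux_flux hq (hd.radius_nonneg.trans (le_max_left R B))
  have hv' := hv.isDuhamel hα hα' (hd.mono (le_max_left R B)) hf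
    fun p hp => (hB p hp).trans (le_max_right R B)
  have h := congrFun ((isSmoothingKernel hα hα').duhamel_unique hf hv'
    (hu.mono (le_max_left R B))) (t, x)
  simpa [ht] using h

include hα hα' hd in
lemma IsDuhamel.isContIntoL1 (hf : IsFlux R L (flux q))
    (hu : IsDuhamel (heatKernel α) (heatKernelDx α) (flux q) u₀ R u) (hi : MemLp u₀ 1 volume)
    (hN : ∀ t, 0 < t → ∫⁻ x, ‖u (t, x)‖ₑ ≤ ∫⁻ x, ‖u₀ x‖ₑ) :
    IsContIntoL1 u₀ fun t x => u (t, x) := by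
  have hK := isSmoothingKernel hα hα'
  have hi' : Integrable u₀ := memLp_one_iff_integrable.mp hi
  set g : ℝ → ℝ → ℝ := fun t x => if 0 < t then u (t, x) else u₀ x with hg
  have hpos : ∀ t, 0 < t → g t = fun x => u (t, x) := fun t ht => by simp [hg, ht]
  have hzero : g 0 = u₀ := by simp [hg]
  have hmem : ∀ t, MemLp (g t) 1 volume := fun t => by
    by_cases ht : 0 < t
    · rw [hpos t ht, memLp_one_iff_integrable]
      exact ⟨(hu.isDatum t).aestronglyMeasurable, (hN t ht).trans_lt hi'.2⟩
    · simpa [hg, ht] using hi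
  have hed : ∀ s t, edist ((hmem s).toLp (g s)) ((hmem t).toLp (g t)) =
      ∫⁻ x, ‖g s x - g t x‖ₑ := fun s t => by
    rw [Lp.edist_toLp_toLp, eLpNorm_one_eq_lintegral_enorm]
    rfl
  refine ⟨fun t => (hmem t).toLp (g t), fun t ht => ?_, ?_, fun t ht => ?_⟩
  · rcases (show (0 : ℝ) ≤ t from ht).eq_or_lt with rfl | ht
    · refine continuousWithinAt_Ioi_iff_Ici.mp ?_
      refine tendsto_iff_edist_tendsto_0.mpr ?_
      refine (hu.tendsto_lintegral_sub_datum hK hf hd hi' hN).congr' ?_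
      filter_upwards [self_mem_nhdsWithin] with s hs
      rw [hed, hpos s hs, hzero]
    · refine ContinuousAt.continuousWithinAt (tendsto_iff_edist_tendsto_0.mpr ?_)
      refine (hu.tendsto_lintegral_sub hK hf hd hi'.2.ne hN ht).congr' ?_
      filter_upwards [lt_mem_nhds ht] with s hs
      rw [hed, hpos s hs, hpos t ht]
  · exact (hmem 0).coeFn_toLp.trans hzero.eventuallyEq
  · exact (hmem t).coeFn_toLp.trans (hpos t ht).eventuallyEq

end Mild

end RieszFeller

end

/-! ### The main theorem. -/

theorem theorem2 (α q : ℝ) (hα₀ : 0 < α) (hα₁ : α < 1) (hq : 1 < q)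
    (u₀ : ℝ → ℝ) (hu₀ : MemLp u₀ ⊤ (volume : Measure ℝ)) :
    ∃ u : ℝ → ℝ → ℝ,
      RieszFeller.IsMildSolution α q ⊤ u₀ u ∧
      (∀ v : ℝ → ℝ → ℝ, RieszFeller.IsMildSolution α q ⊤ u₀ v →
        ∀ t : ℝ, 0 < t → ∀ x : ℝ, v t x = u t x) ∧
      RieszFeller.IsContIntoC1 u ∧
      (∀ t : ℝ, 0 < t → ∀ x : ℝ,
        essInf u₀ (volume : Measure ℝ) ≤ u t x ∧ u t x ≤ essSup u₀ (volume : Measure ℝ)) ∧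
      (MemLp u₀ 1 (volume : Measure ℝ) →
        RieszFeller.IsContIntoL1 u₀ u ∧
        (∀ t : ℝ, 0 < t →
          eLpNorm (u t) 1 (volume : Measure ℝ) ≤ eLpNorm u₀ 1 (volume : Measure ℝ)) ∧
        ∀ s t : ℝ, 0 < s → s ≤ t →
          eLpNorm (u t) 1 (volume : Measure ℝ) ≤ eLpNorm (u s) 1 (volume : Measure ℝ)) := by
  have hd := RieszFeller.isDatum_of_memLp hu₀
  have hf := RieszFeller.isFlux_flux hq hd.radius_nonneg
  have hK := RieszFeller.isSmoothingKernel hα₀ hα₁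
  obtain ⟨u, huA, hu⟩ := hK.exists_duhamel hf hd
  refine ⟨fun t x => u (t, x), hu.isMildSolution hα₀ hα₁ hd hf, fun v hv t ht x =>
    hv.eq_of_isDuhamel hα₀ hα₁ hd hq hu ht x, fun t ht => ?_, fun t ht x => huA.mem_Icc (t, x) ht,
    fun hi => ⟨hu.isContIntoL1 hα₀ hα₁ hd hf hi huA.lintegral_le, fun t ht => ?_,
      fun s t hs hst => ?_⟩⟩
  · obtain ⟨h1, ⟨B, hB⟩, h2⟩ := hu.contDiff hK hf hd ht
    exact ⟨h1, ⟨max _ B, fun x => ⟨(hu.abs_le (t, x)).trans (le_max_left _ B),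
      (hB x).trans (le_max_right _ B)⟩⟩, hu.tendstoUniformly hK hf hd ht, h2⟩
  · simpa only [MeasureTheory.eLpNorm_one_eq_lintegral_enorm] using huA.lintegral_le t ht
  · simpa only [MeasureTheory.eLpNorm_one_eq_lintegral_enorm] using
      hu.lintegral_antitone hK hf hd hs hst
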